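/- Let $k$ be a field of characteristic $0$. Graded vector spaces are $\mathbb Z$-graded over $k$, differentials have degree $1$, Koszul signs are used throughout, and $V[s]^n=V^{s+n}$, with differential $(-1)^s d$ if $(V,d)$ is a complex. Let $s\in\mathbb Z$; the case $s=1$ is the usual notation, and $s=-1$ is the case in which the cooperations below, seen on $V$, have the degrees $2-r$ and $1-a-b$ of the generators of the operad $\mathcal B_\infty$. *$\mathcal B_\infty$-coalgebras.* A $\mathcal B_\infty$-coalgebra is a complex $(V,d)$ with cooperations on $U=V[s]$ dual to the generating operations of $\mathcal B_\infty$: linear maps $m_r:U\to T^rU$ of degree $1$ ($r\ge 2$) and $c_{a,b}:U\to T^aU\otimes T^bU$ of degree $0$ ($a,b\ge 1$). Put $m_0=0$, let $m_1$ be the differential of $V[s]$, $c_{0,1}(u)=1\otimes u$, $c_{1,0}(u)=u\otimes 1$, and $c_{0,b}=0$ for $b\neq 1$, $c_{a,0}=0$ for $a\ne1$. Let $D^{q}_{n}:T^qU\to T^nU$ be the restriction to $T^qU$ of the derivation of $TU$ that extends $m_{n-q+1}$ (it is $0$ if $q>n+1$), and let $C^{r}_{a,b}:T^rU\to T^aU\otimes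 T^bU$ be the components of the multiplicative extension of the family $(c_{a,b})$, that is, $C^{r}_{a,b}(u_1\otimes\dots\otimes u_r)=\sum c_{a_1,b_1}(u_1)\cdots c_{a_r,b_r}(u_r)$ over all $a_1+\dots+a_r=a$, $b_1+\dots+b_r=b$. The following identities are required on $U$, for all $a,b,e,n\geq 0$: $$\sum_r (C^r_{a,b}\otimes 1)\,c_{r,e}=\sum_r(1\otimes C^r_{b,e})\,c_{a,r},\qquad \sum_{q} D^q_n\, m_q=0,\qquad \sum_r C^r_{a,b}\,m_r=\sum_q (D^q_a\otimes 1)\,c_{q,b}+\sum_q(1\otimes D^q_b)\,c_{a,q}$$ (all sums are finite). Morphisms are the maps of complexes that commute with all the $m_r$ and $c_{a,b}$. *Bialgebras.* For a graded vector space $U$ let $\Pi TU=\prod_{r\ge0}T^rU$ (product of graded vector spaces), with the topology in which the subspaces $\prod_{r\ge l}T^rU$ form a base of neighbourhoods of $0$, with the product extended by continuity from $TU$, the unit $1\in T^0U$, and let $\epsilon:\Pi TU\to T^0U=k$ be the projection. A topological dg bialgebra is a graded unital algebra $A$ with a topology in which $0$ has a base of neighbourhoods formed by homogeneous two-sided ideals,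 together with a continuous differential, a continuous counit $A\to k$ and a continuous coproduct $A\to A\widehat\otimes A=\varprojlim (A/I)\otimes(A/J)$ ($I,J$ open subspaces), of degrees $1,0,0$, that satisfy the axioms of a dg bialgebra with unit and counit. Let $\mathcal C_s$ be the following category. Its objects are the topological dg bialgebras $A$ with a graded vector space $V$ and an isomorphism $A\cong\Pi TV[s]$ of topological graded algebras with unit that takes the counit of $A$ to $\epsilon$. Its morphisms from $A\cong \Pi TV[s]$ to $B\cong\Pi TW[s]$ are the degree $0$ linear maps $V\to W$ for which the induced map $A\cong\Pi TV[s]\to\Pi TW[s]\cong B$ is a morphism of topological dg bialgebras with unit and counit. **Proposition.** The category of $\mathcal B_\infty$-coalgebras is equivalent to the category $\mathcal C_s$. The equivalence can be chosen so that it is compatible, up to natural isomorphism, with the functors that take a $\mathcal B_\infty$-coalgebra and an object of $\mathcal C_s$ to the underlying graded vector space $V$. -/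

import Mathlib

open CategoryTheory
open scoped TensorProduct DirectSum

universe u v

namespace BInfty

noncomputable section

/-! ### Graded vector spaces -/

/-- A `ℤ`-graded vector space `V = ⨁ Vⁿ`. -/
structure GrMod (k : Type u) [Field k] where
  carrier : Type v
  [addCommGroup : AddCommGroup carrier]
  [module : Module k carrier]
  /-- `gr n = Vⁿ` -/
  gr : ℤ → Submodule k carrier
  isInternal : DirectSum.IsInternal gr

attribute [instance] GrMod.addCommGroup GrMod.module

instance (k : Type u) [Field k] : CoeSort (GrMod.{u, v} k) (Type v) := ⟨GrMod.carrier⟩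

variable {k : Type u} [Field k]

instance (V : GrMod.{u, v} k) : DirectSum.Decomposition V.gr :=
  V.isInternal.chooseDecomposition

/-- Degree `0` linear maps of graded vector spaces. -/
@[ext]
structure GrHom (V W : GrMod.{u, v} k) where
  toLin : V →ₗ[k] W
  map_gr : ∀ n, ∀ x ∈ V.gr n, toLin x ∈ W.gr n

/-- The identity. -/
abbrev GrHom.id (V : GrMod.{u, v} k) : GrHom V V := ⟨LinearMap.id, fun _ _ h => h⟩

/-- The composite `V → W → X`. -/
abbrev GrHom.comp {V W X : GrMod.{u, v} k} (f : GrHom V W) (g : GrHom W X) : GrHom V X :=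
  ⟨g.toLin ∘ₗ f.toLin, fun n x h => g.map_gr n _ (f.map_gr n x h)⟩

/-- The category of graded vector spaces. -/
instance : Category (GrMod.{u, v} k) where
  Hom := GrHom
  id := GrHom.id
  comp := GrHom.comp

/-- The shift `V[s]`, with `V[s]ⁿ = V^{s+n}`. -/
abbrev GrMod.shift (V : GrMod.{u, v} k) (s : ℤ) : GrMod.{u, v} k where
  carrier := V
  gr n := V.gr (s + n)
  isInternal := by
    have h := (DirectSum.isInternal_submodule_iff_iSupIndep_and_iSup_eq_top _).1 V.isInternal
    refine (DirectSum.isInternal_submodule_iff_iSupIndep_and_iSup_eq_top _).2 ⟨?_, ?_⟩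
    · exact h.1.comp (add_right_injective s)
    · rw [← h.2]
      exact (Equiv.addLeft s).iSup_comp (g := V.gr)

/-- A graded map `V → W`, seen as a graded map `V[s] → W[s]`. -/
abbrev GrHom.shift {V W : GrMod.{u, v} k} (f : GrHom V W) (s : ℤ) :
    GrHom (V.shift s) (W.shift s) :=
  ⟨f.toLin, fun n x h => f.map_gr (s + n) x h⟩

/-- The sign operator `x ↦ (-1)^{|x|} x` of a graded module. -/
def parity {A : Type*} [AddCommGroup A] [Module k A] (𝒜 : ℤ → Submodule k A)
    [DirectSum.Decomposition 𝒜] : A →ₗ[k] A :=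
  DirectSum.toModule k ℤ A (fun n => ((n.negOnePow : ℤˣ) : ℤ) • (𝒜 n).subtype) ∘ₗ
    (DirectSum.decomposeLinearEquiv 𝒜).toLinearMap

/-! ### The tensor algebra of a graded vector space -/

/-- The tensor algebra `TU = ⨁ₖ TᵏU`. -/
abbrev Ten (U : GrMod.{u, v} k) : Type (max u v) := TensorAlgebra k U

/-- The part of `TU` of degree `n` for the grading induced from `U`: it is spanned by the words
`u₁ ⊗ ⋯ ⊗ uᵣ` (of any length) with homogeneous letters such that `|u₁| + ⋯ + |uᵣ| = n`. -/
def Ten.deg (U : GrMod.{u, v} k) (n : ℤ) : Submodule k (Ten U) :=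
  Submodule.span k {x | ∃ l : List (ℤ × U), (∀ p ∈ l, p.2 ∈ U.gr p.1) ∧
    (l.map Prod.fst).sum = n ∧ (l.map fun p => TensorAlgebra.ι k p.2).prod = x}

/-- `TʳU`, the span of the words of length `r`. -/
def Ten.len (U : GrMod.{u, v} k) (r : ℕ) : Submodule k (Ten U) :=
  LinearMap.range (TensorAlgebra.ι k : U →ₗ[k] Ten U) ^ r

/-- The part of degree `n` of `TʳU`. -/
def Ten.piece (U : GrMod.{u, v} k) (r : ℕ) (n : ℤ) : Submodule k (Ten U) :=
  Ten.len U r ⊓ Ten.deg U n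

/-- The part of degree `n` of `TᵃU ⊗ TᵇU`. -/
def Ten.piece₂ (U : GrMod.{u, v} k) (a b : ℕ) (n : ℤ) : Submodule k (Ten U ⊗[k] Ten U) :=
  Submodule.span k {z | ∃ i j : ℤ, i + j = n ∧ ∃ x ∈ Ten.piece U a i, ∃ y ∈ Ten.piece U b j,
    x ⊗ₜ[k] y = z}

theorem Ten.ι_mem_deg (U : GrMod.{u, v} k) {n : ℤ} {x : U} (hx : x ∈ U.gr n) :
    TensorAlgebra.ι k x ∈ Ten.deg U n :=
  Submodule.subset_span ⟨[(n, x)], by simpa using hx, by simp, by simp⟩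

instance (U : GrMod.{u, v} k) : SetLike.GradedMonoid (Ten.deg U) where
  one_mem := Submodule.subset_span ⟨[], by simp, by simp, by simp⟩
  mul_mem := by
    intro i j x y hx hy
    have h : x * y ∈ Ten.deg U i * Ten.deg U j := Submodule.mul_mem_mul hx hy
    rw [Ten.deg, Ten.deg, Submodule.span_mul_span] at h
    refine Submodule.span_mono ?_ h
    rintro _ ⟨_, ⟨l, hl, rfl, rfl⟩, _, ⟨l', hl', rfl, rfl⟩, rfl⟩
    refine ⟨l ++ l', ?_, by simp, by simp⟩
    intro p hp
    rcases List.mem_append.1 hp with h | h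
    · exact hl p h
    · exact hl' p h

/-- The inclusion `U → TU`, with values in the external direct sum of the pieces of `TU`. -/
def Ten.ιGr (U : GrMod.{u, v} k) : U →ₗ[k] ⨁ n, Ten.deg U n :=
  DirectSum.toModule k ℤ _ (fun n => DirectSum.lof k ℤ (fun n => Ten.deg U n) n ∘ₗ
      ((TensorAlgebra.ι k).restrict fun _ hx => Ten.ι_mem_deg U hx)) ∘ₗ
    (DirectSum.decomposeLinearEquiv U.gr).toLinearMap

theorem Ten.ιGr_of_mem (U : GrMod.{u, v} k) {n : ℤ} {x : U} (hx : x ∈ U.gr n) :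
    Ten.ιGr U x = DirectSum.of (fun n => Ten.deg U n) n
      ⟨TensorAlgebra.ι k x, Ten.ι_mem_deg U hx⟩ := by
  have : DirectSum.decompose U.gr x = DirectSum.of (fun n => U.gr n) n ⟨x, hx⟩ :=
    DirectSum.decompose_of_mem _ hx
  simp only [Ten.ιGr, LinearMap.comp_apply, LinearEquiv.coe_coe,
    DirectSum.decomposeLinearEquiv_apply, this]
  rw [← DirectSum.lof_eq_of k, DirectSum.toModule_lof]
  rfl

/-- `TU` is a graded algebra for the grading induced from `U`. -/
instance (U : GrMod.{u, v} k) : GradedAlgebra (Ten.deg U) :=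
  GradedAlgebra.ofAlgHom _ (TensorAlgebra.lift k (Ten.ιGr U))
    (by
      ext x
      simp only [LinearMap.comp_apply, AlgHom.toLinearMap_apply, AlgHom.comp_apply,
        AlgHom.id_apply, TensorAlgebra.lift_ι_apply]
      induction x using DirectSum.Decomposition.inductionOn U.gr with
      | zero => simp
      | homogeneous x => rw [Ten.ιGr_of_mem U x.2, DirectSum.coeAlgHom_of]
      | add x y hx hy => rw [map_add, map_add, hx, hy, map_add])
    (by
      rintro n ⟨x, hx⟩
      induction hx using Submodule.span_induction with
      | mem x h =>
        obtain ⟨l, hl, hn, hx⟩ := h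
        subst hn hx
        dsimp only
        induction l with
        | nil => simpa using (DirectSum.one_def (fun n => Ten.deg U n)).symm ▸ rfl
        | cons p l ih =>
          have ih' := ih (fun q hq => hl q (List.mem_cons_of_mem _ hq))
          simp only [List.map_cons, List.prod_cons, map_mul, TensorAlgebra.lift_ι_apply]
          rw [ih', Ten.ιGr_of_mem U (hl p List.mem_cons_self), DirectSum.of_mul_of]
          exact DirectSum.of_eq_of_gradedMonoid_eq (Sigma.subtype_ext rfl rfl)
      | zero => rw [map_zero]; exact (map_zero _).symm
      | add x y hx hy ihx ihy =>
        dsimp only at ihx ihy ⊢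
        rw [map_add, ihx, ihy, ← map_add]; rfl
      | smul a x hx ih =>
        dsimp only at ih ⊢
        rw [map_smul, ih, ← DirectSum.lof_eq_of k, ← map_smul]; rfl)

/-- The algebra map `Tf : TU → TW` induced by a graded map `f : U → W`. -/
def Ten.map {U W : GrMod.{u, v} k} (f : GrHom U W) : Ten U →ₐ[k] Ten W :=
  TensorAlgebra.lift k (TensorAlgebra.ι k ∘ₗ f.toLin)

/-! ### `B_∞`-coalgebras -/

/-- The algebra `TU ⊗ TU`, with the Koszul sign `(x ⊗ y)(x' ⊗ y') = (-1)^{|y||x'|} xx' ⊗ yy'`. -/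
abbrev Ten.Sq (U : GrMod.{u, v} k) : Type (max u v) := Ten.deg U ᵍ⊗[k] Ten.deg U

/-- The multiplicative extension of a family `c a b : U → TᵃU ⊗ TᵇU`. It is the algebra map
`TU → (TU ⊗ TU)⟦X⟧⟦Y⟧` with `u ↦ ∑ c a b u Xᵃ Yᵇ`; the variables only keep track of the
components. -/
def comulSeries {U : GrMod.{u, v} k} (c : ℕ → ℕ → U →ₗ[k] Ten U ⊗[k] Ten U) :
    Ten U →ₐ[k] PowerSeries (PowerSeries (Ten.Sq U)) :=
  TensorAlgebra.lift k
    { toFun := fun x => PowerSeries.mk fun b => PowerSeries.mk fun a =>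
        GradedTensorProduct.of k (Ten.deg U) (Ten.deg U) (c a b x)
      map_add' := fun x y => by ext b a; simp
      map_smul' := fun r x => by ext b a; simp }

/-- The component `TU → TᵃU ⊗ TᵇU` of the multiplicative extension of the family `c`: on a word
`u₁ ⊗ ⋯ ⊗ uᵣ` it is the sum over `a = a₁ + ⋯ + aᵣ`, `b = b₁ + ⋯ + bᵣ` of the products
`c a₁ b₁ u₁ ⋯ c aᵣ bᵣ uᵣ` in `TU ⊗ TU`. -/
def comulExt {U : GrMod.{u, v} k} (c : ℕ → ℕ → U →ₗ[k] Ten U ⊗[k] Ten U) (a b : ℕ) :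
    Ten U →ₗ[k] Ten U ⊗[k] Ten U where
  toFun x := (GradedTensorProduct.of k (Ten.deg U) (Ten.deg U)).symm
    (PowerSeries.coeff a (PowerSeries.coeff b (comulSeries c x)))
  map_add' x y := by simp
  map_smul' r x := by simp

/-- The algebra map `x ↦ !![(-1)^{|x|} x, D x; 0, x]` which encodes the graded derivation `D`
extending `m : U → TU`. -/
def derivMatrix {U : GrMod.{u, v} k} (m : U →ₗ[k] Ten U) :
    Ten U →ₐ[k] Matrix (Fin 2) (Fin 2) (Ten U) :=
  TensorAlgebra.lift k
    { toFun := fun x => !![parity (Ten.deg U) (TensorAlgebra.ι k x), m x;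
        0, TensorAlgebra.ι k x]
      map_add' := fun x y => by ext i j; fin_cases i <;> fin_cases j <;> simp
      map_smul' := fun r x => by ext i j; fin_cases i <;> fin_cases j <;> simp }

/-- The extension of `m : U → TU` to an odd derivation of `TU`, which is given on words by
`u₁ ⊗ ⋯ ⊗ uᵣ ↦ ∑ᵢ (-1)^{|u₁| + ⋯ + |uᵢ₋₁|} u₁ ⊗ ⋯ ⊗ m uᵢ ⊗ ⋯ ⊗ uᵣ`. -/
def derivExt {U : GrMod.{u, v} k} (m : U →ₗ[k] Ten U) : Ten U →ₗ[k] Ten U where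
  toFun x := derivMatrix m x 0 1
  map_add' x y := by simp
  map_smul' r x := by simp

/-- A `B_∞`-coalgebra, given by the cooperations dual to the generators of the operad and by the
identities dual to its relations.

It is a complex `(V, d)` with cooperations on `U = V[s]`: `m r : U → TʳU` of degree `1` and
`c a b : U → TᵃU ⊗ TᵇU` of degree `0`. The integer `s` is the shift which relates `B_∞` to the
operad that acts on `U`. The value `s = 1` is the usual notation; `s = -1` is the value for which
the cooperations on `V` have the degrees `2 - r` and `1 - a - b` of the generators of `B_∞`. The proper generators are the `m r` with `r ≥ 2` and the
`c a b` with `a, b ≥ 1`; the others are determined by the normalizations. -/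
structure Coalg (k : Type u) [Field k] (s : ℤ) where
  V : GrMod.{u, v} k
  d : V →ₗ[k] V
  d_mem : ∀ n, ∀ x ∈ V.gr n, d x ∈ V.gr (n + 1)
  d_d : ∀ x, d (d x) = 0
  m : ℕ → V.shift s →ₗ[k] Ten (V.shift s)
  m_mem : ∀ r n, ∀ x ∈ (V.shift s).gr n, m r x ∈ Ten.piece (V.shift s) r (n + 1)
  m_zero : ∀ x, m 0 x = 0
  /-- `m 1` is the differential of the complex `V[s]` -/
  m_one : ∀ x : V, m 1 x = ((s.negOnePow : ℤˣ) : ℤ) •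
    (TensorAlgebra.ι k : V.shift s →ₗ[k] Ten (V.shift s)) (d x)
  c : ℕ → ℕ → V.shift s →ₗ[k] Ten (V.shift s) ⊗[k] Ten (V.shift s)
  c_mem : ∀ a b n, ∀ x ∈ (V.shift s).gr n, c a b x ∈ Ten.piece₂ (V.shift s) a b n
  c_zero_left : ∀ b x, c 0 b x = if b = 1 then 1 ⊗ₜ[k] TensorAlgebra.ι k x else 0
  c_zero_right : ∀ a x, c a 0 x = if a = 1 then TensorAlgebra.ι k x ⊗ₜ[k] 1 else 0
  /-- coassociativity, component in `Tᵃ ⊗ Tᵇ ⊗ Tᵉ` -/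
  coassoc : ∀ a b e x,
    TensorProduct.assoc k _ _ _ (∑ r ∈ Finset.range (a + b + 1),
      TensorProduct.map (comulExt c a b) LinearMap.id (c r e x)) =
    ∑ r ∈ Finset.range (b + e + 1), TensorProduct.map LinearMap.id (comulExt c b e) (c a r x)
  /-- the square of the differential is zero, component in `Tⁿ⁻¹` -/
  m_m : ∀ n x, ∑ p ∈ Finset.HasAntidiagonal.antidiagonal n, derivExt (m p.2) (m p.1 x) = 0
  /-- compatibility of the differential and the coproduct, component in `Tᵃ ⊗ Tᵇ` -/
  m_c : ∀ a b x,
    ∑ r ∈ Finset.range (a + b + 1), comulExt c a b (m r x) =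
    ∑ p ∈ Finset.HasAntidiagonal.antidiagonal (a + 1),
      TensorProduct.map (derivExt (m p.2)) LinearMap.id (c p.1 b x) +
    ∑ p ∈ Finset.HasAntidiagonal.antidiagonal (b + 1),
      TensorProduct.map (parity (Ten.deg (V.shift s))) (derivExt (m p.2)) (c a p.1 x)

/-- Morphisms of `B_∞`-coalgebras: maps of complexes which commute with all cooperations. -/
@[ext]
structure Coalg.Hom {s : ℤ} (X Y : Coalg.{u, v} k s) where
  f : GrHom X.V Y.V
  map_d : ∀ x, f.toLin (X.d x) = Y.d (f.toLin x)
  map_m : ∀ r x, Ten.map (f.shift s) (X.m r x) = Y.m r (f.toLin x)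
  map_c : ∀ a b x, TensorProduct.map (Ten.map (f.shift s)).toLinearMap
    (Ten.map (f.shift s)).toLinearMap (X.c a b x) = Y.c a b (f.toLin x)

theorem Ten.map_id (U : GrMod.{u, v} k) (f : GrHom U U) (hf : f.toLin = LinearMap.id) :
    Ten.map f = AlgHom.id k (Ten U) := by
  ext x; simp [Ten.map, hf]

theorem Ten.map_comp {U V W : GrMod.{u, v} k} (f : GrHom U V) (g : GrHom V W) (h : GrHom U W)
    (hh : h.toLin = g.toLin ∘ₗ f.toLin) : Ten.map h = (Ten.map g).comp (Ten.map f) := by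
  ext x; simp [Ten.map, hh]

/-- The category of `B_∞`-coalgebras. -/
instance {s : ℤ} : Category (Coalg.{u, v} k s) where
  Hom := Coalg.Hom
  id X :=
    { f := GrHom.id X.V
      map_d := fun _ => rfl
      map_m := fun r x => by
        rw [Ten.map_id _ ((GrHom.id X.V).shift s) rfl]; rfl
      map_c := fun a b x => by
        rw [Ten.map_id _ ((GrHom.id X.V).shift s) rfl]
        exact congrArg (fun φ : _ →ₗ[k] _ => φ (X.c a b x)) TensorProduct.map_id }
  comp {X Y Z} F G :=
    { f := F.f.comp G.f
      map_d := fun x =>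
        (congrArg G.f.toLin (F.map_d x)).trans (G.map_d _)
      map_m := fun r x => by
        rw [Ten.map_comp (F.f.shift s) (G.f.shift s)
          ((F.f.comp G.f).shift s) rfl]
        exact (congrArg (Ten.map (G.f.shift s)) (F.map_m r x)).trans (G.map_m r _)
      map_c := fun a b x => by
        rw [Ten.map_comp (F.f.shift s) (G.f.shift s)
          ((F.f.comp G.f).shift s) rfl, AlgHom.comp_toLinearMap,
          TensorProduct.map_comp]
        exact (congrArg _ (F.map_c a b x)).trans (G.map_c a b _) }

/-- The underlying graded vector space of a `B_∞`-coalgebra. -/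
def Coalg.forget (k : Type u) [Field k] (s : ℤ) : Coalg.{u, v} k s ⥤ GrMod.{u, v} k where
  obj X := X.V
  map F := Coalg.Hom.f F

/-! ### The topological algebra `ΠTU` -/

/-- The part of degree `n` of `ΠTU`, that is `∏ᵣ (TʳU)ⁿ`. A family `(xᵣ)` is written as the
series `∑ xᵣ Xʳ`. -/
def PiT.deg₀ (U : GrMod.{u, v} k) (n : ℤ) : Submodule k (PowerSeries (Ten U)) where
  carrier := {f | ∀ r, PowerSeries.coeff r f ∈ Ten.piece U r n}
  add_mem' hf hg r := by rw [map_add]; exact add_mem (hf r) (hg r)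
  zero_mem' r := by rw [map_zero]; exact zero_mem _
  smul_mem' a f hf r := by
    have : PowerSeries.coeff r (a • f) = a • PowerSeries.coeff r f := rfl
    rw [this]; exact Submodule.smul_mem _ _ (hf r)

instance (U : GrMod.{u, v} k) : SetLike.GradedMonoid (PiT.deg₀ U) where
  one_mem r := by
    rw [PowerSeries.coeff_one]
    split_ifs with h
    · subst h
      exact ⟨by simp [Ten.len], SetLike.GradedOne.one_mem⟩
    · exact zero_mem _
  mul_mem i j f g hf hg r := by
    rw [PowerSeries.coeff_mul]
    refine Submodule.sum_mem _ fun p hp => ?_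
    rw [Finset.HasAntidiagonal.mem_antidiagonal] at hp
    refine ⟨?_, SetLike.GradedMul.mul_mem (hf p.1).2 (hg p.2).2⟩
    rw [Ten.len, ← hp, pow_add]
    exact Submodule.mul_mem_mul (hf p.1).1 (hg p.2).1

/-- `ΠTU` as a subalgebra of `(TU)⟦X⟧`: the sum of its homogeneous parts. -/
def PiT.sub (U : GrMod.{u, v} k) : Subalgebra k (PowerSeries (Ten U)) :=
  (DirectSum.coeAlgHom (PiT.deg₀ U)).range

/-- The algebra `ΠTU = ∏ᵣ TʳU`, the product being taken in graded vector spaces: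
`(ΠTU)ⁿ = ∏ᵣ (TʳU)ⁿ`. Its product is the extension of concatenation, its unit is `1 ∈ T⁰U`. -/
def PiT (U : GrMod.{u, v} k) : Type (max u v) := PiT.sub U

instance (U : GrMod.{u, v} k) : Ring (PiT U) := inferInstanceAs (Ring (PiT.sub U))

instance (U : GrMod.{u, v} k) : Algebra k (PiT U) := inferInstanceAs (Algebra k (PiT.sub U))

/-- The component in `TʳU`. -/
def PiT.coeff {U : GrMod.{u, v} k} (r : ℕ) : PiT U →ₗ[k] Ten U where
  toFun x := PowerSeries.coeff r x.1
  map_add' x y := map_add (PowerSeries.coeff r) x.1 y.1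
  map_smul' _ _ := rfl

/-- The part of degree `n` of `ΠTU`. -/
def PiT.deg (U : GrMod.{u, v} k) (n : ℤ) : Submodule k (PiT U) where
  carrier := {x | ∀ r, PiT.coeff r x ∈ Ten.piece U r n}
  add_mem' hf hg r := by rw [map_add]; exact add_mem (hf r) (hg r)
  zero_mem' r := by rw [map_zero]; exact zero_mem _
  smul_mem' a f hf r := by rw [map_smul]; exact Submodule.smul_mem _ _ (hf r)

/-- The neighbourhood `∏_{r ≥ l} TʳU` of `0`. -/
def PiT.fil (U : GrMod.{u, v} k) (l : ℕ) : Submodule k (PiT U) where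
  carrier := {x | ∀ r < l, PiT.coeff r x = 0}
  add_mem' hf hg r hr := by rw [map_add, hf r hr, hg r hr, add_zero]
  zero_mem' r _ := map_zero _
  smul_mem' a f hf r hr := by rw [map_smul, hf r hr, smul_zero]

/-- The topology for which the `∏_{r ≥ l} TʳU` are a base of neighbourhoods of `0`. -/
instance (U : GrMod.{u, v} k) : TopologicalSpace (PiT U) where
  IsOpen s := ∀ x ∈ s, ∃ l, ∀ y ∈ PiT.fil U l, x + y ∈ s
  isOpen_univ _ _ := ⟨0, fun _ _ => trivial⟩
  isOpen_inter s t hs ht x hx := by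
    obtain ⟨l, hl⟩ := hs x hx.1
    obtain ⟨l', hl'⟩ := ht x hx.2
    exact ⟨max l l', fun y hy =>
      ⟨hl y fun r hr => hy r (lt_max_of_lt_left hr), hl' y fun r hr => hy r (lt_max_of_lt_right hr)⟩⟩
  isOpen_sUnion S hS x hx := by
    obtain ⟨t, ht, hx⟩ := hx
    obtain ⟨l, hl⟩ := hS t ht x hx
    exact ⟨l, fun y hy => ⟨t, ht, hl y hy⟩⟩

/-- The algebra map `ΠTf : ΠTU → ΠTW` induced by a graded map `f : U → W`, that is, `Tf` on
every component. -/
def PiT.map {U W : GrMod.{u, v} k} (f : GrHom U W) : PiT U →ₐ[k] PiT W :=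
  ((PowerSeries.mapAlgHom (Ten.map f)).comp (PiT.sub U).val).codRestrict (PiT.sub W) (by
    have hlen : ∀ r, ∀ x ∈ Ten.len U r, Ten.map f x ∈ Ten.len W r := by
      intro r x hx
      have h : (Ten.len U r).map (Ten.map f).toLinearMap ≤ Ten.len W r := by
        rw [Ten.len, Ten.len, Submodule.map_pow]
        refine pow_le_pow_left' ?_ r
        rintro _ ⟨_, ⟨y, rfl⟩, rfl⟩
        exact ⟨f.toLin y, by simp [Ten.map]⟩
      exact h ⟨x, hx, rfl⟩
    have hdeg : ∀ n, ∀ x ∈ Ten.deg U n, Ten.map f x ∈ Ten.deg W n := by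
      intro n x hx
      have h : Ten.deg U n ≤ (Ten.deg W n).comap (Ten.map f).toLinearMap := by
        refine Submodule.span_le.2 ?_
        rintro _ ⟨l, hl, rfl, rfl⟩
        refine Submodule.subset_span ⟨l.map fun p => (p.1, f.toLin p.2), ?_, ?_, ?_⟩
        · intro p hp
          obtain ⟨q, hq, rfl⟩ := List.mem_map.1 hp
          exact f.map_gr _ _ (hl q hq)
        · simp [Function.comp_def]
        · simp [map_list_prod, Function.comp_def, Ten.map]
      exact h hx
    rintro ⟨_, x, rfl⟩
    change PowerSeries.mapAlgHom (Ten.map f) (DirectSum.coeAlgHom (PiT.deg₀ U) x) ∈ PiT.sub W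
    induction x using DirectSum.induction_on with
    | zero => simp only [map_zero]; exact zero_mem _
    | of n x =>
      refine ⟨DirectSum.of (fun n => PiT.deg₀ W n) n
        ⟨PowerSeries.mapAlgHom (Ten.map f) x.1, fun r => ?_⟩, ?_⟩
      · have := x.2 r
        exact ⟨hlen r _ this.1, hdeg n _ this.2⟩
      · change DirectSum.coeAlgHom _ _ = _
        rw [DirectSum.coeAlgHom_of, DirectSum.coeAlgHom_of]
    | add x y hx hy => rw [map_add, map_add]; exact add_mem hx hy)

/-! ### Topological dg bialgebras -/

/-- Open subspaces of a topological vector space. -/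
abbrev OpenSub (k : Type u) [Field k] (A : Type*) [AddCommGroup A] [Module k A]
    [TopologicalSpace A] : Type _ := {I : Submodule k A // IsOpen (I : Set A)}

/-- The preimage of an open subspace under a continuous linear map. -/
def OpenSub.comap {A B : Type*} [AddCommGroup A] [Module k A] [TopologicalSpace A]
    [AddCommGroup B] [Module k B] [TopologicalSpace B] (f : A →ₗ[k] B) (hf : Continuous f)
    (I : OpenSub k B) : OpenSub k A :=
  ⟨I.1.comap f, I.2.preimage hf⟩

/-- The completed tensor square `A ⊗̂ A = lim (A/I) ⊗ (A/J)`, the limit being taken over all open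
subspaces `I`, `J` of `A`. -/
def CTensor (k : Type u) [Field k] (A : Type*) [AddCommGroup A] [Module k A]
    [TopologicalSpace A] :
    Submodule k (∀ I J : OpenSub k A, (A ⧸ I.1) ⊗[k] (A ⧸ J.1)) where
  carrier := {x | ∀ (I I' J J' : OpenSub k A) (hI : I.1 ≤ I'.1) (hJ : J.1 ≤ J'.1),
    TensorProduct.map (Submodule.factor hI) (Submodule.factor hJ) (x I J) = x I' J'}
  add_mem' hx hy I I' J J' hI hJ := by
    simp only [Pi.add_apply, map_add, hx I I' J J' hI hJ, hy I I' J J' hI hJ]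
  zero_mem' I I' J J' hI hJ := by simp
  smul_mem' a x hx I I' J J' hI hJ := by
    simp only [Pi.smul_apply, map_smul, hx I I' J J' hI hJ]

/-- The projection `A ⊗ A → (A/I) ⊗ (A/J)`. -/
def tproj {A : Type*} [AddCommGroup A] [Module k A] (I J : Submodule k A) :
    A ⊗[k] A →ₗ[k] (A ⧸ I) ⊗[k] (A ⧸ J) :=
  TensorProduct.map I.mkQ J.mkQ

/-- Homogeneous subspaces. -/
def IsHomog {A : Type*} [AddCommGroup A] [Module k A] (𝒜 : ℤ → Submodule k A)
    [DirectSum.Decomposition 𝒜] (I : Submodule k A) : Prop :=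
  ∀ x ∈ I, ∀ n, (DirectSum.decompose 𝒜 x n : A) ∈ I

/-- Two-sided ideals. -/
def IsIdeal {A : Type*} [Ring A] [Algebra k A] (I : Submodule k A) : Prop :=
  ∀ a, ∀ x ∈ I, a * x ∈ I ∧ x * a ∈ I

/-- Topological dg bialgebras with unit and counit over the discrete field `k`: graded algebras
with a linear topology (`0` has a base of neighbourhoods formed by homogeneous two-sided ideals),
a continuous differential, a continuous counit, and a continuous coproduct `A → A ⊗̂ A`.
Identities in completed tensor products are written in the quotients that define them. -/
structure TopDGBialg (k : Type u) [Field k] where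
  A : Type v
  [ring : Ring A]
  [algebra : Algebra k A]
  [top : TopologicalSpace A]
  gr : ℤ → Submodule k A
  [graded : GradedAlgebra gr]
  [topGroup : IsTopologicalAddGroup A]
  linear_top : ∀ s ∈ nhds (0 : A), ∃ I : OpenSub k A, IsIdeal I.1 ∧ IsHomog gr I.1 ∧
    (I.1 : Set A) ⊆ s
  /-- the differential -/
  d : A →ₗ[k] A
  d_cont : Continuous d
  d_mem : ∀ n, ∀ x ∈ gr n, d x ∈ gr (n + 1)
  d_d : ∀ x, d (d x) = 0
  d_mul : ∀ x y, d (x * y) = d x * y + parity gr x * d y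
  /-- the counit -/
  ε : A →ₐ[k] k
  ε_open : IsOpen (LinearMap.ker ε.toLinearMap : Set A)
  ε_gr : ∀ n, n ≠ 0 → ∀ x ∈ gr n, ε x = 0
  ε_d : ∀ x, ε (d x) = 0
  /-- the coproduct -/
  Δ : A →ₗ[k] CTensor k A
  Δ_open : ∀ I J, IsOpen
    (LinearMap.ker (LinearMap.proj J ∘ₗ LinearMap.proj I ∘ₗ (CTensor k A).subtype ∘ₗ Δ) : Set A)
  Δ_gr : ∀ n, ∀ a ∈ gr n, ∀ I J, (Δ a).1 I J ∈ (Submodule.span k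
    {z : A ⊗[k] A | ∃ i j : ℤ, i + j = n ∧ ∃ x ∈ gr i, ∃ y ∈ gr j, x ⊗ₜ[k] y = z}).map
      (tproj I.1 J.1)
  Δ_one : ∀ I J, (Δ 1).1 I J = tproj I.1 J.1 (1 ⊗ₜ[k] 1)
  /-- multiplicativity: on `(A/I) ⊗ (A/J)`, where `I` and `J` are homogeneous ideals, the product
  is induced by the one of `A ⊗ A` (with Koszul signs) -/
  Δ_mul : ∀ I J : OpenSub k A, IsIdeal I.1 → IsHomog gr I.1 → IsIdeal J.1 → IsHomog gr J.1 →
    ∀ (a b : A) (x y : gr ᵍ⊗[k] gr),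
      tproj I.1 J.1 ((GradedTensorProduct.of k gr gr).symm x) = (Δ a).1 I J →
      tproj I.1 J.1 ((GradedTensorProduct.of k gr gr).symm y) = (Δ b).1 I J →
      (Δ (a * b)).1 I J = tproj I.1 J.1 ((GradedTensorProduct.of k gr gr).symm (x * y))
  /-- `Δ d = (d ⊗ 1 + 1 ⊗ d) Δ` (with Koszul signs): for `I`, `J` homogeneous, the map
  `d ⊗ 1 + 1 ⊗ d` of `A ⊗ A` is defined from `(A/I') ⊗ (A/J')` to `(A/I) ⊗ (A/J)`, where
  `I' = I ∩ d⁻¹ I` and `J' = J ∩ d⁻¹ J` -/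
  Δ_d : ∀ I J I' J' : OpenSub k A, IsHomog gr I.1 → IsHomog gr J.1 →
    I'.1 = I.1 ⊓ I.1.comap d → J'.1 = J.1 ⊓ J.1.comap d →
    ∀ (a : A) (x : A ⊗[k] A), tproj I'.1 J'.1 x = (Δ a).1 I' J' →
      (Δ (d a)).1 I J = tproj I.1 J.1
        (TensorProduct.map d LinearMap.id x + TensorProduct.map (parity gr) d x)
  /-- `(ε ⊗ 1) Δ = 1` -/
  ε_left : ∀ (J : OpenSub k A) (a : A), TensorProduct.lid k (A ⧸ J.1)
    (TensorProduct.map ((LinearMap.ker ε.toLinearMap).liftQ ε.toLinearMap le_rfl) LinearMap.id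
      ((Δ a).1 ⟨LinearMap.ker ε.toLinearMap, ε_open⟩ J)) = J.1.mkQ a
  /-- `(1 ⊗ ε) Δ = 1` -/
  ε_right : ∀ (I : OpenSub k A) (a : A), TensorProduct.rid k (A ⧸ I.1)
    (TensorProduct.map LinearMap.id ((LinearMap.ker ε.toLinearMap).liftQ ε.toLinearMap le_rfl)
      ((Δ a).1 I ⟨LinearMap.ker ε.toLinearMap, ε_open⟩)) = I.1.mkQ a
  /-- `(Δ ⊗ 1) Δ = (1 ⊗ Δ) Δ` in `(A/I) ⊗ (A/J) ⊗ (A/K)` -/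
  coassoc : ∀ (I J K : OpenSub k A) (a : A),
    TensorProduct.assoc k _ _ _ (TensorProduct.map
      (Submodule.liftQ _
        (LinearMap.proj J ∘ₗ LinearMap.proj I ∘ₗ (CTensor k A).subtype ∘ₗ Δ) le_rfl)
      LinearMap.id ((Δ a).1 ⟨_, Δ_open I J⟩ K)) =
    TensorProduct.map LinearMap.id
      (Submodule.liftQ _
        (LinearMap.proj K ∘ₗ LinearMap.proj J ∘ₗ (CTensor k A).subtype ∘ₗ Δ) le_rfl)
      ((Δ a).1 I ⟨_, Δ_open J K⟩)

attribute [instance] TopDGBialg.ring TopDGBialg.algebra TopDGBialg.top TopDGBialg.graded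
  TopDGBialg.topGroup

/-- Morphisms of topological dg bialgebras with unit and counit. -/
structure TopDGBialg.IsMor (A B : TopDGBialg.{u, v} k) (F : A.A →ₐ[k] B.A) : Prop where
  cont : Continuous F.toLinearMap
  map_gr : ∀ n, ∀ x ∈ A.gr n, F x ∈ B.gr n
  map_d : ∀ x, F (A.d x) = B.d (F x)
  map_ε : ∀ x, B.ε (F x) = A.ε x
  /-- `(F ⊗ F) Δ = Δ F` -/
  map_Δ : ∀ (I J : OpenSub k B.A) (a : A.A),
    TensorProduct.map
      (Submodule.mapQ (OpenSub.comap F.toLinearMap cont I).1 I.1 F.toLinearMap le_rfl)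
      (Submodule.mapQ (OpenSub.comap F.toLinearMap cont J).1 J.1 F.toLinearMap le_rfl)
      ((A.Δ a).1 (OpenSub.comap F.toLinearMap cont I) (OpenSub.comap F.toLinearMap cont J)) =
    (B.Δ (F a)).1 I J

/-- A topological dg bialgebra together with a graded vector space `V` and an isomorphism with
`ΠTV[s]` of topological graded algebras with unit, which takes the counit to the projection
`ΠTV[s] → T⁰V[s] = k`. -/
structure ProTensorBialg (k : Type u) [Field k] (s : ℤ) where
  V : GrMod.{u, v} k
  bialg : TopDGBialg.{u, max u v} k
  iso : PiT (V.shift s) ≃ₐ[k] bialg.A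
  iso_cont : Continuous iso
  iso_symm_cont : Continuous iso.symm
  iso_gr : ∀ n x, iso x ∈ bialg.gr n ↔ x ∈ PiT.deg (V.shift s) n
  iso_ε : ∀ x, algebraMap k (Ten (V.shift s)) (bialg.ε (iso x)) = PiT.coeff 0 x

/-- The algebra map induced by a graded map `V → W` on the associated bialgebras. -/
def ProTensorBialg.induced {s : ℤ} (X Y : ProTensorBialg.{u, v} k s) (f : GrHom X.V Y.V) :
    X.bialg.A →ₐ[k] Y.bialg.A :=
  (Y.iso.toAlgHom.comp (PiT.map (f.shift s))).comp X.iso.symm.toAlgHom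

/-- The maps `V → W` which induce a morphism of topological dg bialgebras. -/
@[ext]
structure ProTensorBialg.Hom {s : ℤ} (X Y : ProTensorBialg.{u, v} k s) where
  f : GrHom X.V Y.V
  isMor : X.bialg.IsMor Y.bialg (ProTensorBialg.induced X Y f)

theorem TopDGBialg.isMor_id (A : TopDGBialg.{u, v} k) : A.IsMor A (AlgHom.id k A.A) where
  cont := continuous_id
  map_gr _ _ h := h
  map_d _ := rfl
  map_ε _ := rfl
  map_Δ I J a := by
    exact (A.Δ a).2 I I J J le_rfl le_rfl

theorem TopDGBialg.isMor_comp {A B C : TopDGBialg.{u, v} k} {F : A.A →ₐ[k] B.A}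
    {G : B.A →ₐ[k] C.A} (hF : A.IsMor B F) (hG : B.IsMor C G) : A.IsMor C (G.comp F) where
  cont := hG.cont.comp hF.cont
  map_gr n x h := hG.map_gr n _ (hF.map_gr n x h)
  map_d x := by simp [hF.map_d, hG.map_d]
  map_ε x := by simp [hF.map_ε, hG.map_ε]
  map_Δ I J a := by
    have h : ∀ I : OpenSub k C.A,
        Submodule.mapQ (OpenSub.comap (G.comp F).toLinearMap (hG.cont.comp hF.cont) I).1 I.1
          (G.comp F).toLinearMap le_rfl =
        Submodule.mapQ (OpenSub.comap G.toLinearMap hG.cont I).1 I.1 G.toLinearMap le_rfl ∘ₗ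
          Submodule.mapQ (OpenSub.comap F.toLinearMap hF.cont
            (OpenSub.comap G.toLinearMap hG.cont I)).1
            (OpenSub.comap G.toLinearMap hG.cont I).1 F.toLinearMap le_rfl := fun I => by
      ext x; rfl
    rw [h I, h J]
    refine (congrArg (fun φ : _ →ₗ[k] _ => φ _) (TensorProduct.map_comp _ _ _ _)).trans ?_
    exact (congrArg _ (hF.map_Δ _ _ a)).trans (hG.map_Δ I J (F a))

theorem PiT.coeff_map {U W : GrMod.{u, v} k} (f : GrHom U W) (r : ℕ) (x : PiT U) :
    PiT.coeff r (PiT.map f x) = Ten.map f (PiT.coeff r x) := rfl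

theorem PiT.ext {U : GrMod.{u, v} k} {x y : PiT U} (h : ∀ r, PiT.coeff r x = PiT.coeff r y) :
    x = y :=
  Subtype.ext (PowerSeries.ext h)

/-- The category of topological dg bialgebras isomorphic to some `ΠTV[s]` as algebras with unit
and counit; the morphisms are the maps `V → W` which induce morphisms of bialgebras. -/
instance {s : ℤ} : Category (ProTensorBialg.{u, v} k s) where
  Hom := ProTensorBialg.Hom
  id X :=
    { f := GrHom.id X.V
      isMor := by
        have h : ProTensorBialg.induced X X (GrHom.id X.V) = AlgHom.id k X.bialg.A := by
          ext x
          have : PiT.map ((GrHom.id X.V).shift s) (X.iso.symm x) = X.iso.symm x :=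
            PiT.ext fun r => by
              rw [PiT.coeff_map, Ten.map_id _ ((GrHom.id X.V).shift s) rfl]; rfl
          exact (congrArg X.iso this).trans (X.iso.apply_symm_apply x)
        rw [h]
        exact X.bialg.isMor_id }
  comp {X Y Z} F G :=
    { f := F.f.comp G.f
      isMor := by
        have h : ProTensorBialg.induced X Z (F.f.comp G.f) =
            (ProTensorBialg.induced Y Z G.f).comp (ProTensorBialg.induced X Y F.f) := by
          ext x
          have : PiT.map ((F.f.comp G.f).shift s) (X.iso.symm x) =
              PiT.map (G.f.shift s) (Y.iso.symm (Y.iso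
                (PiT.map (F.f.shift s) (X.iso.symm x)))) := by
            rw [AlgEquiv.symm_apply_apply]
            refine PiT.ext fun r => ?_
            rw [PiT.coeff_map, Ten.map_comp (F.f.shift s) (G.f.shift s)
              ((F.f.comp G.f).shift s) rfl]
            rfl
          exact congrArg Z.iso this
        rw [h]
        exact TopDGBialg.isMor_comp F.isMor G.isMor }

/-- The graded vector space `V` that underlies a bialgebra isomorphic to `ΠTV[s]`. -/
def ProTensorBialg.forget (k : Type u) [Field k] (s : ℤ) :
    ProTensorBialg.{u, v} k s ⥤ GrMod.{u, v} k where
  obj X := X.V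
  map F := ProTensorBialg.Hom.f F

end

end BInfty

-- Put U = V[s]. On ΠTU the product, unit and counit are given, so a bialgebra structure consists of
-- a continuous odd derivation d and a continuous algebra map Δ. Since TU is free on U and dense in
-- ΠTU, both are determined by their restrictions to U, whose components are the m_r and the
-- c_{a,b}. The condition εd = 0 means m_0 = 0, and the two counit axioms fix c_{0,b} and c_{a,0}.
--
-- The other axioms can be tested on U. With σ the parity, d² is an even derivation, Δd - (d⊗1 +
-- 1⊗d)Δ is a derivation along σΔ and Δ, and (Δ⊗1)Δ and (1⊗Δ)Δ are algebra maps. So they vanish or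
-- agree as soon as they do so on generators, and there the components of the axioms are exactly the
-- three families of B_∞ identities. Likewise ΠTf is a morphism if and only if f commutes with all
-- m_r and c_{a,b}.
--
-- Convergence comes from two vanishing operations. As m_0 = 0, d shortens no word. As c_{0,0} = 0,
-- every letter contributes at least 1 to the total length of Δ, so words of length at least 2N have
-- no component in TᵃU ⊗ TᵇU with a, b < N. Modulo words of length at least N, d and Δ are therefore
-- given by maps `Coop.D` and `Coop.comul` on TU itself that extend finitely many cooperations, and
-- all arguments use these truncations. `mem_of_leibniz` and `sub_mem_of_ideal` carry congruences
-- modulo an ideal from U to TU, `isIdeal_ker_map` provides the ideals in tensor products, and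
-- `Coop.proj_D` and `Coop.comulExt_eq` compute components. The predicates `Chart.HasDeriv` and
-- `Chart.HasComul` say that d and Δ come from a family of cooperations; they are used both to read
-- off a coalgebra and to build a bialgebra.
--
-- Reading off components is a functor from bialgebras to coalgebras that leaves V unchanged.
-- `ProTensorBialg.isMor_induced_iff` makes it full and faithful, and `Coalg.toBialg` makes it
-- essentially surjective.

universe w

namespace BInfty

noncomputable section

/-! ### Signs and parity -/

/-- The sign `(-1)ⁿ` as a scalar. -/
def sgn (k : Type*) [Field k] (n : ℤ) : k := (((n.negOnePow : ℤˣ) : ℤ) : k)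

section Sign

variable {k : Type*} [Field k]

theorem sgn_add (m n : ℤ) : sgn k (m + n) = sgn k m * sgn k n := by
  simp [sgn, Int.negOnePow_add]

theorem sgn_zero : sgn k 0 = 1 := by simp [sgn]

theorem sgn_one : sgn k 1 = -1 := by simp [sgn]

theorem sgn_mul_self (n : ℤ) : sgn k n * sgn k n = 1 := by
  rw [← sgn_add, sgn, Int.negOnePow_even _ ⟨n, rfl⟩]; simp

variable {A B : Type*} [Ring A] [Ring B] [Algebra k A] [Algebra k B]
variable (𝒜 : ℤ → Submodule k A) (ℬ : ℤ → Submodule k B)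

theorem parity_of_mem {M : Type*} [AddCommGroup M] [Module k M] (ℳ : ℤ → Submodule k M)
    [DirectSum.Decomposition ℳ] {n : ℤ} {x : M} (hx : x ∈ ℳ n) :
    parity ℳ x = sgn k n • x := by
  simp only [parity, LinearMap.comp_apply, LinearEquiv.coe_coe,
    DirectSum.decomposeLinearEquiv_apply, DirectSum.decompose_of_mem _ hx]
  rw [← DirectSum.lof_eq_of k, DirectSum.toModule_lof, sgn, Int.cast_smul_eq_zsmul]
  rfl

theorem parity_mem {M : Type*} [AddCommGroup M] [Module k M] (ℳ : ℤ → Submodule k M)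
    [DirectSum.Decomposition ℳ] {n : ℤ} {x : M} (hx : x ∈ ℳ n) : parity ℳ x ∈ ℳ n := by
  rw [parity_of_mem ℳ hx]; exact Submodule.smul_mem _ _ hx

/-- A linear map that preserves degrees commutes with the parity. -/
theorem map_parity {M N : Type*} [AddCommGroup M] [Module k M] [AddCommGroup N] [Module k N]
    (ℳ : ℤ → Submodule k M) [DirectSum.Decomposition ℳ] (𝒩 : ℤ → Submodule k N)
    [DirectSum.Decomposition 𝒩] (f : M →ₗ[k] N) (hf : ∀ n, ∀ x ∈ ℳ n, f x ∈ 𝒩 n) (x : M) :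
    f (parity ℳ x) = parity 𝒩 (f x) := by
  induction x using DirectSum.Decomposition.inductionOn ℳ with
  | zero => simp
  | homogeneous x =>
    rw [parity_of_mem ℳ x.2, parity_of_mem 𝒩 (hf _ _ x.2), map_smul]
  | add x y hx hy => simp only [map_add, hx, hy]

/-- A linear map of degree `1` anticommutes with the parity. -/
theorem map_parity_of_odd {M N : Type*} [AddCommGroup M] [Module k M] [AddCommGroup N]
    [Module k N] (ℳ : ℤ → Submodule k M) [DirectSum.Decomposition ℳ] (𝒩 : ℤ → Submodule k N)
    [DirectSum.Decomposition 𝒩] (f : M →ₗ[k] N) (hf : ∀ n, ∀ x ∈ ℳ n, f x ∈ 𝒩 (n + 1))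
    (x : M) : f (parity ℳ x) = -parity 𝒩 (f x) := by
  induction x using DirectSum.Decomposition.inductionOn ℳ with
  | zero => simp
  | homogeneous x =>
    rw [parity_of_mem ℳ x.2, parity_of_mem 𝒩 (hf _ _ x.2), map_smul, sgn_add, sgn_one]
    simp
  | add x y hx hy => simp only [map_add, hx, hy, neg_add]

theorem parity_parity {M : Type*} [AddCommGroup M] [Module k M] (ℳ : ℤ → Submodule k M)
    [DirectSum.Decomposition ℳ] (x : M) : parity ℳ (parity ℳ x) = x := by
  induction x using DirectSum.Decomposition.inductionOn ℳ with
  | zero => simp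
  | homogeneous x =>
    rw [parity_of_mem ℳ x.2, map_smul, parity_of_mem ℳ x.2, smul_smul, sgn_mul_self, one_smul]
  | add x y hx hy => simp only [map_add, hx, hy]

variable [GradedAlgebra 𝒜] [GradedAlgebra ℬ]

theorem parity_one : parity 𝒜 (1 : A) = 1 := by
  rw [parity_of_mem 𝒜 (SetLike.GradedOne.one_mem), sgn_zero, one_smul]

theorem parity_mul (x y : A) : parity 𝒜 (x * y) = parity 𝒜 x * parity 𝒜 y := by
  induction x using DirectSum.Decomposition.inductionOn 𝒜 with
  | zero => simp
  | add x y hx hy => simp only [map_add, add_mul, hx, hy]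
  | homogeneous x =>
    induction y using DirectSum.Decomposition.inductionOn 𝒜 with
    | zero => simp
    | add x y hx hy => simp only [map_add, mul_add, hx, hy]
    | homogeneous y =>
      rw [parity_of_mem 𝒜 x.2, parity_of_mem 𝒜 y.2,
        parity_of_mem 𝒜 (SetLike.GradedMul.mul_mem x.2 y.2), sgn_add, smul_mul_smul_comm]

/-- The parity as an algebra map. -/
def parityHom : A →ₐ[k] A :=
  AlgHom.ofLinearMap (parity 𝒜) (parity_one 𝒜) (parity_mul 𝒜)

@[simp]
theorem parityHom_apply (x : A) : parityHom 𝒜 x = parity 𝒜 x := rfl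

/-! ### Graded tensor products -/

open GradedTensorProduct

/-- The Koszul rule with memberships in place of subtypes and with the sign as a scalar of `k`. Only
the two inner factors, which pass each other, have to be homogeneous. -/
theorem tmul_mul_tmul {i j : ℤ} (a : A) {b : B} (hb : b ∈ ℬ j) {a' : A} (ha : a' ∈ 𝒜 i) (b' : B) :
    (a ᵍ⊗ₜ[k] b * a' ᵍ⊗ₜ[k] b' : 𝒜 ᵍ⊗[k] ℬ) =
      sgn k (j * i) • ((a * a') ᵍ⊗ₜ[k] (b * b')) := by
  rw [tmul_coe_mul_coe_tmul 𝒜 ℬ a ⟨b, hb⟩ ⟨a', ha⟩ b', sgn, Int.cast_smul_eq_zsmul,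
    Units.smul_def, Int.negOnePow_def]

/-- Induction for graded tensor products: it is enough to consider `a ⊗ b`, where `a` and `b` are
homogeneous. -/
theorem tensor_induction {p : 𝒜 ᵍ⊗[k] ℬ → Prop} (x : 𝒜 ᵍ⊗[k] ℬ) (zero : p 0)
    (tmul : ∀ i j, ∀ a ∈ 𝒜 i, ∀ b ∈ ℬ j, p (a ᵍ⊗ₜ[k] b))
    (add : ∀ x y, p x → p y → p (x + y)) : p x := by
  induction x using TensorProduct.induction_on with
  | zero => exact zero
  | add x y hx hy => exact add x y hx hy
  | tmul a b =>
    change p (a ᵍ⊗ₜ[k] b)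
    induction a using DirectSum.Decomposition.inductionOn 𝒜 with
    | zero => simpa [GradedTensorProduct.tmul] using zero
    | add x y hx hy =>
      simpa [GradedTensorProduct.tmul, TensorProduct.add_tmul] using add _ _ hx hy
    | homogeneous a =>
      induction b using DirectSum.Decomposition.inductionOn ℬ with
      | zero => simpa [GradedTensorProduct.tmul] using zero
      | add x y hx hy =>
        simpa [GradedTensorProduct.tmul, TensorProduct.tmul_add] using add _ _ hx hy
      | homogeneous b => exact tmul _ _ _ a.2 _ b.2

/-- The part of total degree `n` of a graded tensor product. -/
def tdeg (n : ℤ) : Submodule k (𝒜 ᵍ⊗[k] ℬ) :=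
  Submodule.span k {z | ∃ i j : ℤ, i + j = n ∧ ∃ a ∈ 𝒜 i, ∃ b ∈ ℬ j, a ᵍ⊗ₜ[k] b = z}

variable {𝒜 ℬ} in
theorem tmul_mem_tdeg {i j n : ℤ} (h : i + j = n) {a : A} (ha : a ∈ 𝒜 i) {b : B} (hb : b ∈ ℬ j) :
    (a ᵍ⊗ₜ[k] b : 𝒜 ᵍ⊗[k] ℬ) ∈ tdeg 𝒜 ℬ n :=
  Submodule.subset_span ⟨i, j, h, a, ha, b, hb, rfl⟩

instance : SetLike.GradedMonoid (tdeg 𝒜 ℬ) where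
  one_mem := tmul_mem_tdeg (add_zero 0) SetLike.GradedOne.one_mem SetLike.GradedOne.one_mem
  mul_mem := by
    intro i j x y hx hy
    induction hx using Submodule.span_induction with
    | zero => rw [zero_mul]; exact zero_mem _
    | add x y _ _ hx hy => rw [add_mul]; exact add_mem hx hy
    | smul c x _ hx =>
      have h : c • x * y = c • (x * y) := smul_mul_assoc c x y
      exact (congrArg (· ∈ tdeg 𝒜 ℬ (i + j)) h).mpr (Submodule.smul_mem _ _ hx)
    | mem x hx =>
    induction hy using Submodule.span_induction with
    | zero => rw [mul_zero]; exact zero_mem _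
    | add x y _ _ hx hy => rw [mul_add]; exact add_mem hx hy
    | smul c y _ hy =>
      have h : x * c • y = c • (x * y) := mul_smul_comm c x y
      exact (congrArg (· ∈ tdeg 𝒜 ℬ (i + j)) h).mpr (Submodule.smul_mem _ _ hy)
    | mem y hy =>
    obtain ⟨i₁, i₂, rfl, a, ha, b, hb, rfl⟩ := hx
    obtain ⟨j₁, j₂, rfl, a', ha', b', hb', rfl⟩ := hy
    rw [tmul_mul_tmul 𝒜 ℬ a hb ha' b']
    have hbb := SetLike.GradedMul.mul_mem hb hb'
    have haa := SetLike.GradedMul.mul_mem ha ha'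
    exact Submodule.smul_mem _ _ (tmul_mem_tdeg (by ring) haa hbb)

/-- A linear map into the external direct sum of the pieces of total degree `n` -/
def decomposeTensor : 𝒜 ᵍ⊗[k] ℬ →ₗ[k] ⨁ n, tdeg 𝒜 ℬ n :=
  TensorProduct.lift
    (LinearMap.compl₁₂
      (DirectSum.toModule k ℤ _ fun i => LinearMap.flip <| DirectSum.toModule k ℤ _ fun j =>
        LinearMap.flip <| LinearMap.mk₂ k
          (fun (a : 𝒜 i) (b : ℬ j) => DirectSum.of (fun n => tdeg 𝒜 ℬ n) (i + j)
            ⟨(a : A) ᵍ⊗ₜ[k] (b : B), tmul_mem_tdeg rfl a.2 b.2⟩)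
          (fun a a' b => by
            rw [← map_add]; congr 1; ext1; simp [GradedTensorProduct.tmul, TensorProduct.add_tmul])
          (fun c a b => by
            simp only [← DirectSum.lof_eq_of k]
            rw [← map_smul]; congr 1)
          (fun a b b' => by
            rw [← map_add]; congr 1; ext1; simp [GradedTensorProduct.tmul, TensorProduct.tmul_add])
          (fun c a b => by
            simp only [← DirectSum.lof_eq_of k]
            rw [← map_smul]; congr 1; ext1
            simp [GradedTensorProduct.tmul]))
      (DirectSum.decomposeLinearEquiv 𝒜).toLinearMap
      (DirectSum.decomposeLinearEquiv ℬ).toLinearMap) ∘ₗ (of k 𝒜 ℬ).symm.toLinearMap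

variable {𝒜 ℬ} in
theorem decomposeTensor_tmul {i j n : ℤ} (h : i + j = n) {a : A} (ha : a ∈ 𝒜 i) {b : B}
    (hb : b ∈ ℬ j) : decomposeTensor 𝒜 ℬ (a ᵍ⊗ₜ[k] b) =
      DirectSum.of (fun n => tdeg 𝒜 ℬ n) n ⟨a ᵍ⊗ₜ[k] b, tmul_mem_tdeg h ha hb⟩ := by
  subst h
  have h₁ : DirectSum.decompose 𝒜 a = DirectSum.lof k ℤ (fun i => 𝒜 i) i ⟨a, ha⟩ :=
    DirectSum.decompose_of_mem _ ha
  have h₂ : DirectSum.decompose ℬ b = DirectSum.lof k ℤ (fun i => ℬ i) j ⟨b, hb⟩ :=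
    DirectSum.decompose_of_mem _ hb
  simp only [decomposeTensor, LinearMap.comp_apply, LinearEquiv.coe_coe, of_symm_of,
    TensorProduct.lift.tmul, LinearMap.compl₁₂_apply, DirectSum.decomposeLinearEquiv_apply, h₁, h₂,
    DirectSum.toModule_lof, LinearMap.flip_apply, LinearMap.mk₂_apply]

/-- A graded tensor product is graded by the total degree. -/
instance : GradedAlgebra (tdeg 𝒜 ℬ) where
  toDecomposition := DirectSum.Decomposition.ofLinearMap _ (decomposeTensor 𝒜 ℬ)
    (by
      refine LinearMap.ext fun x => ?_
      induction x using tensor_induction 𝒜 ℬ with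
      | zero => simp
      | add x y hx hy => rw [map_add, map_add, hx, hy]
      | tmul i j a ha b hb =>
        rw [LinearMap.comp_apply, decomposeTensor_tmul rfl ha hb, ← DirectSum.lof_eq_of k,
          DirectSum.coeLinearMap_lof]
        rfl)
    (by
      ext n ⟨x, hx⟩ : 2
      simp only [LinearMap.comp_apply, DirectSum.coeLinearMap_lof, LinearMap.id_apply]
      induction hx using Submodule.span_induction with
      | mem x h =>
        obtain ⟨i, j, h, a, ha, b, hb, rfl⟩ := h
        exact decomposeTensor_tmul h ha hb
      | zero => rw [map_zero]; exact (map_zero _).symm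
      | add x y hx hy ihx ihy => rw [map_add, ihx, ihy, ← map_add]; rfl
      | smul a x hx ih => rw [map_smul, ih, ← map_smul]; rfl)

end Sign

end

end BInfty

/-! ### Maps between graded tensor products, their derivations and kernels -/

namespace BInfty

noncomputable section

open GradedTensorProduct

section Tensor

variable {k : Type*} [Field k]
variable {A B C A' B' : Type*} [Ring A] [Ring B] [Ring C] [Ring A'] [Ring B']
variable [Algebra k A] [Algebra k B] [Algebra k C] [Algebra k A'] [Algebra k B']
variable (𝒜 : ℤ → Submodule k A) (ℬ : ℤ → Submodule k B) (𝒞 : ℤ → Submodule k C)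
variable (𝒜' : ℤ → Submodule k A') (ℬ' : ℤ → Submodule k B')
variable [GradedAlgebra 𝒜'] [GradedAlgebra ℬ'] [GradedAlgebra 𝒜] [GradedAlgebra ℬ] [GradedAlgebra 𝒞]

/-- A linear map between tensor products, seen on graded tensor products. -/
def tmap (f : A →ₗ[k] A') (g : B →ₗ[k] B') : 𝒜 ᵍ⊗[k] ℬ →ₗ[k] 𝒜' ᵍ⊗[k] ℬ' :=
  (of k 𝒜' ℬ').toLinearMap ∘ₗ TensorProduct.map f g ∘ₗ (of k 𝒜 ℬ).symm.toLinearMap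

@[simp]
theorem tmap_tmul (f : A →ₗ[k] A') (g : B →ₗ[k] B') (a : A) (b : B) :
    tmap 𝒜 ℬ 𝒜' ℬ' f g (a ᵍ⊗ₜ[k] b) = f a ᵍ⊗ₜ[k] g b := rfl

theorem smul_tmul_left (c : k) (a : A) (b : B) :
    ((c • a) ᵍ⊗ₜ[k] b : 𝒜 ᵍ⊗[k] ℬ) = c • (a ᵍ⊗ₜ[k] b) := rfl

theorem smul_tmul_right (c : k) (a : A) (b : B) :
    (a ᵍ⊗ₜ[k] (c • b) : 𝒜 ᵍ⊗[k] ℬ) = c • (a ᵍ⊗ₜ[k] b) := by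
  simp [GradedTensorProduct.tmul]

theorem add_tmul_left (a a' : A) (b : B) :
    ((a + a') ᵍ⊗ₜ[k] b : 𝒜 ᵍ⊗[k] ℬ) = a ᵍ⊗ₜ[k] b + a' ᵍ⊗ₜ[k] b := by
  simp [GradedTensorProduct.tmul, TensorProduct.add_tmul]

theorem add_tmul_right (a : A) (b b' : B) :
    (a ᵍ⊗ₜ[k] (b + b') : 𝒜 ᵍ⊗[k] ℬ) = a ᵍ⊗ₜ[k] b + a ᵍ⊗ₜ[k] b' := by
  simp [GradedTensorProduct.tmul, TensorProduct.tmul_add]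

/-- To compare two biadditive expressions on graded tensor products, it is enough to consider
pairs of products of homogeneous elements. -/
theorem tensor_induction₂ {p : 𝒜 ᵍ⊗[k] ℬ → 𝒜 ᵍ⊗[k] ℬ → Prop} (x y : 𝒜 ᵍ⊗[k] ℬ)
    (zero_left : ∀ y, p 0 y) (zero_right : ∀ x, p x 0)
    (tmul : ∀ i j, ∀ a ∈ 𝒜 i, ∀ b ∈ ℬ j, ∀ i' j', ∀ a' ∈ 𝒜 i', ∀ b' ∈ ℬ j',
      p (a ᵍ⊗ₜ[k] b) (a' ᵍ⊗ₜ[k] b'))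
    (add_left : ∀ x x' y, p x y → p x' y → p (x + x') y)
    (add_right : ∀ x y y', p x y → p x y' → p x (y + y')) : p x y := by
  induction x using tensor_induction 𝒜 ℬ with
  | zero => exact zero_left y
  | add x x' hx hx' => exact add_left x x' y hx hx'
  | tmul i j a ha b hb =>
    induction y using tensor_induction 𝒜 ℬ with
    | zero => exact zero_right _
    | add y y' hy hy' => exact add_right _ y y' hy hy'
    | tmul i₁ j₁ a₁ ha₁ b₁ hb₁ => exact tmul i j a ha b hb i₁ j₁ a₁ ha₁ b₁ hb₁

/-- The algebra map `f ⊗ g` of graded tensor products. -/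
def gmap (f : A →ₐ[k] A') (g : B →ₐ[k] B') (hf : ∀ n, ∀ x ∈ 𝒜 n, f x ∈ 𝒜' n)
    (hg : ∀ n, ∀ x ∈ ℬ n, g x ∈ ℬ' n) : 𝒜 ᵍ⊗[k] ℬ →ₐ[k] 𝒜' ᵍ⊗[k] ℬ' :=
  AlgHom.ofLinearMap (tmap 𝒜 ℬ 𝒜' ℬ' f.toLinearMap g.toLinearMap)
    (by
      change tmap 𝒜 ℬ 𝒜' ℬ' f.toLinearMap g.toLinearMap (1 ᵍ⊗ₜ[k] 1) = 1 ᵍ⊗ₜ[k] 1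
      rw [tmap_tmul]; simp)
    (by
      intro x y
      induction x, y using tensor_induction₂ 𝒜 ℬ with
      | zero_left => simp
      | zero_right => simp
      | add_left x x' y hx hx' => simp only [add_mul, map_add, hx, hx']
      | add_right x y y' hy hy' => simp only [mul_add, map_add, hy, hy']
      | tmul i j a ha b hb i' j' a' ha' b' hb' =>
        rw [tmul_mul_tmul 𝒜 ℬ a hb ha' b', map_smul, tmap_tmul, tmap_tmul, tmap_tmul,
          tmul_mul_tmul 𝒜' ℬ' (f.toLinearMap a) (b := g.toLinearMap b) (a' := f.toLinearMap a')
            (hg _ _ hb) (hf _ _ ha')]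
        simp)

theorem tmap_mem_tdeg (f : A →ₗ[k] A') (g : B →ₗ[k] B') {r s : ℤ}
    (hf : ∀ n, ∀ x ∈ 𝒜 n, f x ∈ 𝒜' (n + r)) (hg : ∀ n, ∀ x ∈ ℬ n, g x ∈ ℬ' (n + s)) {n : ℤ}
    {x : 𝒜 ᵍ⊗[k] ℬ} (hx : x ∈ tdeg 𝒜 ℬ n) :
    tmap 𝒜 ℬ 𝒜' ℬ' f g x ∈ tdeg 𝒜' ℬ' (n + (r + s)) := by
  induction hx using Submodule.span_induction with
  | zero => rw [map_zero]; exact zero_mem _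
  | add x y _ _ hx hy => rw [map_add]; exact add_mem hx hy
  | smul c x _ hx => rw [map_smul]; exact Submodule.smul_mem _ _ hx
  | mem x hx =>
    obtain ⟨i, j, rfl, a, ha, b, hb, rfl⟩ := hx
    exact tmul_mem_tdeg (by ring) (hf _ _ ha) (hg _ _ hb)

/-- The sign of a total degree is the product of the two signs. As `tmap` inserts no Koszul sign, σ
⊗ σ is the parity, and 1 ⊗ D with its sign is written as σ ⊗ D. -/
theorem parity_tdeg (x : 𝒜 ᵍ⊗[k] ℬ) :
    parity (tdeg 𝒜 ℬ) x = tmap 𝒜 ℬ 𝒜 ℬ (parity 𝒜) (parity ℬ) x := by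
  induction x using tensor_induction 𝒜 ℬ with
  | zero => simp
  | add x y hx hy => rw [map_add, map_add, hx, hy]
  | tmul i j a ha b hb =>
    rw [parity_of_mem _ (tmul_mem_tdeg rfl ha hb), tmap_tmul, parity_of_mem 𝒜 ha,
      parity_of_mem ℬ hb, smul_tmul_left, smul_tmul_right, smul_smul, sgn_add]

/-! ### Odd derivations -/

/-- Odd derivations with values in an algebra, along two algebra maps. -/
theorem map_one_of_leibniz {R : Type*} [Ring R] [Algebra k R] {φ : A →ₗ[k] R} {F G : A →ₐ[k] R}
    (h : ∀ x y, φ (x * y) = φ x * G y + F x * φ y) : φ 1 = 0 := by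
  have := h 1 1
  simpa using this

variable {ℬ} in
/-- `D ⊗ 1` is an odd derivation. -/
theorem tmap_deriv_left {D : A →ₗ[k] A} (hD : ∀ n, ∀ x ∈ 𝒜 n, D x ∈ 𝒜 (n + 1))
    (hmul : ∀ x y, D (x * y) = D x * y + parity 𝒜 x * D y) (x y : 𝒜 ᵍ⊗[k] ℬ) :
    tmap 𝒜 ℬ 𝒜 ℬ D LinearMap.id (x * y) = tmap 𝒜 ℬ 𝒜 ℬ D LinearMap.id x * y +
      parity (tdeg 𝒜 ℬ) x * tmap 𝒜 ℬ 𝒜 ℬ D LinearMap.id y := by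
  induction x, y using tensor_induction₂ 𝒜 ℬ with
  | zero_left => simp
  | zero_right => simp
  | add_left x x' y hx hx' => simp only [add_mul, map_add, hx, hx']; abel
  | add_right x y y' hy hy' => simp only [mul_add, map_add, hy, hy']; abel
  | tmul i j a ha b hb i' j' a' ha' b' hb' =>
    rw [tmul_mul_tmul 𝒜 ℬ a hb ha' b', map_smul, parity_tdeg, tmap_tmul, tmap_tmul, tmap_tmul,
      tmap_tmul, LinearMap.id_apply, LinearMap.id_apply, LinearMap.id_apply,
      tmul_mul_tmul 𝒜 ℬ _ hb ha', tmul_mul_tmul 𝒜 ℬ _ (parity_mem ℬ hb) (hD _ _ ha'),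
      hmul, parity_of_mem ℬ hb, add_tmul_left, smul_add]
    simp only [smul_mul_assoc, smul_tmul_right, smul_smul]
    -- Passing `b` across `D a'` costs (-1)^{j(i'+1)}; the sign (-1)^j from the parity of `b` turns
    -- this back into (-1)^{ji'}.
    rw [mul_add, mul_one, sgn_add, mul_assoc, sgn_mul_self, mul_one]

variable {𝒜} in
/-- `1 ⊗ D` is an odd derivation. -/
theorem tmap_deriv_right {D : B →ₗ[k] B} (hD : ∀ n, ∀ x ∈ ℬ n, D x ∈ ℬ (n + 1))
    (hmul : ∀ x y, D (x * y) = D x * y + parity ℬ x * D y) (x y : 𝒜 ᵍ⊗[k] ℬ) :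
    tmap 𝒜 ℬ 𝒜 ℬ (parity 𝒜) D (x * y) = tmap 𝒜 ℬ 𝒜 ℬ (parity 𝒜) D x * y +
      parity (tdeg 𝒜 ℬ) x * tmap 𝒜 ℬ 𝒜 ℬ (parity 𝒜) D y := by
  induction x, y using tensor_induction₂ 𝒜 ℬ with
  | zero_left => simp
  | zero_right => simp
  | add_left x x' y hx hx' => simp only [add_mul, map_add, hx, hx']; abel
  | add_right x y y' hy hy' => simp only [mul_add, map_add, hy, hy']; abel
  | tmul i j a ha b hb i' j' a' ha' b' hb' =>
    rw [tmul_mul_tmul 𝒜 ℬ a hb ha' b', map_smul, parity_tdeg, tmap_tmul, tmap_tmul, tmap_tmul,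
      tmap_tmul, tmul_mul_tmul 𝒜 ℬ _ (hD _ _ hb) ha',
      tmul_mul_tmul 𝒜 ℬ _ (parity_mem ℬ hb) (parity_mem 𝒜 ha'),
      hmul, parity_mul, add_tmul_right, smul_add, parity_of_mem 𝒜 ha']
    simp only [mul_smul_comm, smul_tmul_left, smul_smul]
    rw [add_mul, one_mul, sgn_add]

/-! ### Kernels of tensor products of maps -/

/-- By right exactness ker(f ⊗ g) = A ⊗ ker g + ker f ⊗ B. As the kernels are homogeneous, the
generators can be split into homogeneous tensors with one factor in a kernel; on these the Koszul
product is explicit. -/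
theorem mem_span_of_map_eq_zero {M N : Type*} [AddCommGroup M] [Module k M] [AddCommGroup N]
    [Module k N] (f : A →ₗ[k] M) (g : B →ₗ[k] N) (hf : Function.Surjective f)
    (hg : Function.Surjective g) (hhf : IsHomog 𝒜 (LinearMap.ker f))
    (hhg : IsHomog ℬ (LinearMap.ker g)) {x : 𝒜 ᵍ⊗[k] ℬ}
    (hx : TensorProduct.map f g ((of k 𝒜 ℬ).symm x) = 0) :
    x ∈ Submodule.span k {z : 𝒜 ᵍ⊗[k] ℬ | ∃ i j, ∃ a ∈ 𝒜 i, ∃ b ∈ ℬ j, (f a = 0 ∨ g b = 0) ∧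
      a ᵍ⊗ₜ[k] b = z} := by
  classical
  set S := Submodule.span k {z : 𝒜 ᵍ⊗[k] ℬ | ∃ i j, ∃ a ∈ 𝒜 i, ∃ b ∈ ℬ j, (f a = 0 ∨ g b = 0) ∧
      a ᵍ⊗ₜ[k] b = z} with hS
  have key : ∀ a b, (f a = 0 ∨ g b = 0) → (a ᵍ⊗ₜ[k] b : 𝒜 ᵍ⊗[k] ℬ) ∈ S := by
    intro a b hab
    have h : (a ᵍ⊗ₜ[k] b : 𝒜 ᵍ⊗[k] ℬ) = ∑ i ∈ (DirectSum.decompose 𝒜 a).support,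
        ∑ j ∈ (DirectSum.decompose ℬ b).support,
          (DirectSum.decompose 𝒜 a i : A) ᵍ⊗ₜ[k] (DirectSum.decompose ℬ b j : B) := by
      conv_lhs => rw [← DirectSum.sum_support_decompose 𝒜 a, ← DirectSum.sum_support_decompose ℬ b]
      simp only [GradedTensorProduct.tmul, TensorProduct.sum_tmul, TensorProduct.tmul_sum, map_sum]
      exact Finset.sum_comm
    rw [h]
    refine Submodule.sum_mem _ fun i _ => Submodule.sum_mem _ fun j _ => Submodule.subset_span
      ⟨i, j, _, SetLike.coe_mem _, _, SetLike.coe_mem _, ?_, rfl⟩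
    exact hab.imp (fun h => hhf a h i) (fun h => hhg b h j)
  have hker := TensorProduct.map_ker (f := (LinearMap.ker f).subtype) (g := f)
    (f' := (LinearMap.ker g).subtype) (g' := g) (by
      rw [LinearMap.exact_iff, Submodule.range_subtype]) hf (by
      rw [LinearMap.exact_iff, Submodule.range_subtype]) hg
  have hx' : (of k 𝒜 ℬ).symm x ∈ LinearMap.ker (TensorProduct.map f g) := hx
  rw [hker, Submodule.mem_sup] at hx'
  obtain ⟨_, ⟨y, rfl⟩, _, ⟨z, rfl⟩, hyz⟩ := hx'
  have hxe : x = of k 𝒜 ℬ (LinearMap.lTensor A (LinearMap.ker g).subtype y) +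
      of k 𝒜 ℬ (LinearMap.rTensor B (LinearMap.ker f).subtype z) := hyz.symm
  rw [hxe]
  refine add_mem ?_ ?_
  · clear hyz hxe
    induction y using TensorProduct.induction_on with
    | zero => rw [map_zero, map_zero]; exact zero_mem _
    | add y y' hy hy' => rw [map_add, map_add]; exact add_mem hy hy'
    | tmul a b => exact key _ _ (Or.inr b.2)
  · clear hyz hxe
    induction z using TensorProduct.induction_on with
    | zero => rw [map_zero, map_zero]; exact zero_mem _
    | add y y' hy hy' => rw [map_add, map_add]; exact add_mem hy hy'
    | tmul a b => exact key _ _ (Or.inl a.2)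

/-- A product of homogeneous tensors is, up to sign, the tensor of the products, and a factor in a
kernel stays there. This makes (A/I) ⊗ (A/J) a quotient algebra for homogeneous ideals, so that
congruences in tensor squares can be checked on generators. -/
theorem isIdeal_ker_map {M N : Type*} [AddCommGroup M] [Module k M] [AddCommGroup N]
    [Module k N] (f : A →ₗ[k] M) (g : B →ₗ[k] N) (hf : Function.Surjective f)
    (hg : Function.Surjective g) (hhf : IsHomog 𝒜 (LinearMap.ker f))
    (hhg : IsHomog ℬ (LinearMap.ker g)) (hif : IsIdeal (LinearMap.ker f))
    (hig : IsIdeal (LinearMap.ker g)) :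
    IsIdeal (LinearMap.ker (TensorProduct.map f g ∘ₗ (of k 𝒜 ℬ).symm.toLinearMap)) := by
  intro y x hx
  have hx' := mem_span_of_map_eq_zero 𝒜 ℬ f g hf hg hhf hhg hx
  clear hx
  induction hx' using Submodule.span_induction with
  | zero => rw [mul_zero, zero_mul]; exact ⟨zero_mem _, zero_mem _⟩
  | add x x' _ _ hx hx' =>
    rw [mul_add, add_mul]; exact ⟨add_mem hx.1 hx'.1, add_mem hx.2 hx'.2⟩
  | smul c x _ hx =>
    have h₁ : y * c • x = c • (y * x) := mul_smul_comm c y x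
    have h₂ : c • x * y = c • (x * y) := smul_mul_assoc c x y
    exact ⟨h₁ ▸ Submodule.smul_mem _ c hx.1, h₂ ▸ Submodule.smul_mem _ c hx.2⟩
  | mem x hx =>
    obtain ⟨i, j, a, ha, b, hb, hab, rfl⟩ := hx
    induction y using tensor_induction 𝒜 ℬ with
    | zero => rw [mul_zero, zero_mul]; exact ⟨zero_mem _, zero_mem _⟩
    | add x x' hx hx' =>
      rw [mul_add, add_mul]; exact ⟨add_mem hx.1 hx'.1, add_mem hx.2 hx'.2⟩
    | tmul i' j' a' ha' b' hb' =>
      rw [tmul_mul_tmul 𝒜 ℬ a' hb' ha b, tmul_mul_tmul 𝒜 ℬ a hb ha' b']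
      have key : ∀ a b, (f a = 0 ∨ g b = 0) → (a ᵍ⊗ₜ[k] b : 𝒜 ᵍ⊗[k] ℬ) ∈
          LinearMap.ker (TensorProduct.map f g ∘ₗ (of k 𝒜 ℬ).symm.toLinearMap) := by
        intro a b h
        rw [LinearMap.mem_ker]
        change TensorProduct.map f g (a ⊗ₜ[k] b) = 0
        rcases h with h | h <;> simp [h]
      exact ⟨Submodule.smul_mem _ _ (key _ _ (hab.imp (fun h => (hif a' a h).1)
          fun h => (hig b' b h).1)), Submodule.smul_mem _ _ (key _ _ (hab.imp
            (fun h => (hif a' a h).2) fun h => (hig b' b h).2))⟩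

/-- The generators found in `mem_span_of_map_eq_zero` are homogeneous for the total degree. This
allows a second application of `isIdeal_ker_map`, to triple tensor products. -/
theorem isHomog_ker_map {M N : Type*} [AddCommGroup M] [Module k M] [AddCommGroup N]
    [Module k N] (f : A →ₗ[k] M) (g : B →ₗ[k] N) (hf : Function.Surjective f)
    (hg : Function.Surjective g) (hhf : IsHomog 𝒜 (LinearMap.ker f))
    (hhg : IsHomog ℬ (LinearMap.ker g)) :
    IsHomog (tdeg 𝒜 ℬ)
      (LinearMap.ker (TensorProduct.map f g ∘ₗ (of k 𝒜 ℬ).symm.toLinearMap)) := by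
  intro x hx n
  have hx' := mem_span_of_map_eq_zero 𝒜 ℬ f g hf hg hhf hhg hx
  clear hx
  induction hx' using Submodule.span_induction with
  | zero => rw [DirectSum.decompose_zero]; exact zero_mem _
  | add x x' _ _ hx hx' => rw [DirectSum.decompose_add]; exact add_mem hx hx'
  | smul c x _ hx => rw [DirectSum.decompose_smul]; exact Submodule.smul_mem _ _ hx
  | mem x hx =>
    obtain ⟨i, j, a, ha, b, hb, hab, rfl⟩ := hx
    by_cases hn : i + j = n
    · rw [DirectSum.decompose_of_mem_same _ (tmul_mem_tdeg hn ha hb), LinearMap.mem_ker]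
      change TensorProduct.map f g (a ⊗ₜ[k] b) = 0
      rcases hab with h | h <;> simp [h]
    · rw [DirectSum.decompose_of_mem_ne _ (tmul_mem_tdeg rfl ha hb) hn]
      exact zero_mem _

/-! ### Associativity -/

/-- The associativity isomorphism, as a linear map of graded tensor products. -/
def gassocLin : tdeg 𝒜 ℬ ᵍ⊗[k] 𝒞 →ₗ[k] 𝒜 ᵍ⊗[k] tdeg ℬ 𝒞 :=
  (of k 𝒜 (tdeg ℬ 𝒞)).toLinearMap ∘ₗ
    TensorProduct.map LinearMap.id (of k ℬ 𝒞).toLinearMap ∘ₗ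
    (TensorProduct.assoc k A B C).toLinearMap ∘ₗ
    TensorProduct.map (of k 𝒜 ℬ).symm.toLinearMap LinearMap.id ∘ₗ
    (of k (tdeg 𝒜 ℬ) 𝒞).symm.toLinearMap

theorem gassocLin_tmul (a : A) (b : B) (c : C) :
    gassocLin 𝒜 ℬ 𝒞 ((a ᵍ⊗ₜ[k] b) ᵍ⊗ₜ[k] c) = a ᵍ⊗ₜ[k] (b ᵍ⊗ₜ[k] c) := rfl

theorem tensor_induction₃ {p : tdeg 𝒜 ℬ ᵍ⊗[k] 𝒞 → Prop} (x : tdeg 𝒜 ℬ ᵍ⊗[k] 𝒞) (zero : p 0)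
    (tmul : ∀ i j l, ∀ a ∈ 𝒜 i, ∀ b ∈ ℬ j, ∀ c ∈ 𝒞 l, p ((a ᵍ⊗ₜ[k] b) ᵍ⊗ₜ[k] c))
    (add : ∀ x y, p x → p y → p (x + y)) : p x := by
  induction x using tensor_induction (tdeg 𝒜 ℬ) 𝒞 with
  | zero => exact zero
  | add x y hx hy => exact add x y hx hy
  | tmul i l z hz c hc =>
    clear hz
    induction z using tensor_induction 𝒜 ℬ with
    | zero => simpa [GradedTensorProduct.tmul] using zero
    | add x y hx hy => rw [add_tmul_left]; exact add _ _ hx hy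
    | tmul i j a ha b hb => exact tmul _ _ _ a ha b hb c hc

/-- The associativity isomorphism is an algebra map. -/
def gassoc : tdeg 𝒜 ℬ ᵍ⊗[k] 𝒞 →ₐ[k] 𝒜 ᵍ⊗[k] tdeg ℬ 𝒞 :=
  AlgHom.ofLinearMap (gassocLin 𝒜 ℬ 𝒞) rfl (by
    intro x y
    induction x using tensor_induction₃ 𝒜 ℬ 𝒞 with
    | zero => simp
    | add x x' hx hx' => simp only [add_mul, map_add, hx, hx']
    | tmul i j l a ha b hb c hc =>
      induction y using tensor_induction₃ 𝒜 ℬ 𝒞 with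
      | zero => simp
      | add x x' hx hx' => simp only [mul_add, map_add, hx, hx']
      | tmul i' j' l' a' ha' b' hb' c' hc' =>
        rw [tmul_mul_tmul (tdeg 𝒜 ℬ) 𝒞 _ hc (tmul_mem_tdeg rfl ha' hb'),
          tmul_mul_tmul 𝒜 ℬ _ hb ha', map_smul, smul_tmul_left, map_smul, gassocLin_tmul,
          gassocLin_tmul, gassocLin_tmul,
          tmul_mul_tmul 𝒜 (tdeg ℬ 𝒞) _ (tmul_mem_tdeg rfl hb hc) ha',
          tmul_mul_tmul ℬ 𝒞 _ hc hb', smul_tmul_right, smul_smul, smul_smul, ← sgn_add, ← sgn_add]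
        -- Both sides carry the sign (-1)^{li' + lj' + ji'}.
        congr 2
        ring)

end Tensor

/-! ### Maps out of the tensor algebra -/

section TensorAlgebra

variable {k : Type*} [Field k] {M : Type*} [AddCommGroup M] [Module k M]
variable {R : Type*} [Ring R] [Algebra k R]

/-- A derivation along two algebra maps which sends the generators into an ideal takes its values in
this ideal. -/
theorem mem_of_leibniz {φ : TensorAlgebra k M →ₗ[k] R} {F G : TensorAlgebra k M →ₐ[k] R}
    (h : ∀ x y, φ (x * y) = φ x * G y + F x * φ y) {I : Submodule k R} (hI : IsIdeal I)
    (hφ : ∀ x, φ (TensorAlgebra.ι k x) ∈ I) (t : TensorAlgebra k M) : φ t ∈ I := by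
  induction t using TensorAlgebra.induction with
  | algebraMap r =>
    rw [Algebra.algebraMap_eq_smul_one, map_smul, map_one_of_leibniz h, smul_zero]
    exact zero_mem _
  | ι x => exact hφ x
  | mul x y hx hy => rw [h]; exact add_mem (hI _ _ hx).2 (hI _ _ hy).1
  | add x y hx hy => rw [map_add]; exact add_mem hx hy

/-- Two algebra maps which agree on the generators modulo an ideal agree modulo this ideal. -/
theorem sub_mem_of_ideal (F G : TensorAlgebra k M →ₐ[k] R) {I : Submodule k R} (hI : IsIdeal I)
    (h : ∀ x, F (TensorAlgebra.ι k x) - G (TensorAlgebra.ι k x) ∈ I) (t : TensorAlgebra k M) :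
    F t - G t ∈ I :=
  -- F(xy) - G(xy) = (F - G)(x) F(y) + G(x) (F - G)(y), so the difference is a derivation along `G`
  -- and `F`.
  mem_of_leibniz (φ := F.toLinearMap - G.toLinearMap) (F := G) (G := F)
    (fun x y => by simp; noncomm_ring) hI h t

theorem isIdeal_bot : IsIdeal (⊥ : Submodule k R) := by
  intro a x hx
  rw [Submodule.mem_bot] at hx
  subst hx
  simp

end TensorAlgebra

end

end BInfty

namespace BInfty

noncomputable section

open GradedTensorProduct

/-! ### The tensor algebra and its length grading -/

theorem decompose_map {k : Type*} [Field k] {M N : Type*} [AddCommGroup M] [Module k M]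
    [AddCommGroup N] [Module k N] (ℳ : ℤ → Submodule k M) [DirectSum.Decomposition ℳ]
    (𝒩 : ℤ → Submodule k N) [DirectSum.Decomposition 𝒩] (f : M →ₗ[k] N)
    (hf : ∀ n, ∀ x ∈ ℳ n, f x ∈ 𝒩 n) (x : M) (n : ℤ) :
    (DirectSum.decompose 𝒩 (f x) n : N) = f (DirectSum.decompose ℳ x n) := by
  induction x using DirectSum.Decomposition.inductionOn ℳ with
  | zero => simp
  | @homogeneous i x =>
    by_cases h : i = n
    · subst h
      rw [DirectSum.decompose_of_mem_same _ (hf _ _ x.2), DirectSum.decompose_of_mem_same _ x.2]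
    · rw [DirectSum.decompose_of_mem_ne _ (hf _ _ x.2) h, DirectSum.decompose_of_mem_ne _ x.2 h,
        map_zero]
  | add x y hx hy => simp [hx, hy]

variable {k : Type u} [Field k] {U : GrMod.{u, v} k}

instance (U : GrMod.{u, v} k) : GradedAlgebra (Ten.len U) :=
  inferInstanceAs (GradedAlgebra
    ((LinearMap.range (TensorAlgebra.ι k : U →ₗ[k] TensorAlgebra k U) ^ ·) : ℕ → Submodule k _))

/-- The projection `TU → TʳU`. -/
def Ten.proj (r : ℕ) : Ten U →ₗ[k] Ten U := GradedAlgebra.proj (Ten.len U) r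

theorem Ten.proj_mem (r : ℕ) (x : Ten U) : Ten.proj r x ∈ Ten.len U r := SetLike.coe_mem _

theorem Ten.proj_of_mem {r : ℕ} {x : Ten U} (hx : x ∈ Ten.len U r) : Ten.proj r x = x :=
  DirectSum.decompose_of_mem_same _ hx

theorem Ten.proj_of_mem_ne {r q : ℕ} {x : Ten U} (hx : x ∈ Ten.len U r) (h : r ≠ q) :
    Ten.proj q x = 0 :=
  DirectSum.decompose_of_mem_ne _ hx h

theorem Ten.proj_proj (r : ℕ) (x : Ten U) : Ten.proj r (Ten.proj r x) = Ten.proj r x :=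
  Ten.proj_of_mem (Ten.proj_mem r x)

theorem Ten.one_mem_len : (1 : Ten U) ∈ Ten.len U 0 := SetLike.GradedOne.one_mem

theorem Ten.mul_mem_len {a b : ℕ} {x y : Ten U} (hx : x ∈ Ten.len U a) (hy : y ∈ Ten.len U b) :
    x * y ∈ Ten.len U (a + b) := SetLike.GradedMul.mul_mem hx hy

theorem Ten.ι_mem_len (x : U) : TensorAlgebra.ι k x ∈ Ten.len U 1 := by
  rw [Ten.len, pow_one]; exact ⟨x, rfl⟩

theorem Ten.proj_ι (r : ℕ) (x : U) : Ten.proj r (TensorAlgebra.ι k x : Ten U) =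
    if r = 1 then TensorAlgebra.ι k x else 0 := by
  split_ifs with h
  · subst h; exact Ten.proj_of_mem (Ten.ι_mem_len x)
  · exact Ten.proj_of_mem_ne (Ten.ι_mem_len x) (Ne.symm h)

theorem Ten.proj_mul_of_mem {a r : ℕ} {x : Ten U} (hx : x ∈ Ten.len U a) (y : Ten U) :
    Ten.proj r (x * y) = if a ≤ r then x * Ten.proj (r - a) y else 0 := by
  split_ifs with h
  · exact DirectSum.coe_decompose_mul_of_left_mem_of_le (Ten.len U) hx h
  · exact DirectSum.coe_decompose_mul_of_left_mem_of_not_le (Ten.len U) hx h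

/-- Induction on words. -/
theorem Ten.word_induction {p : Ten U → Prop} (t : Ten U) (one : p 1)
    (ι_mul : ∀ x t, p t → p (TensorAlgebra.ι k x * t)) (add : ∀ x y, p x → p y → p (x + y))
    (smul : ∀ (c : k) x, p x → p (c • x)) : p t := by
  have hlen : ∀ r, ∀ t ∈ Ten.len U r, p t := by
    intro r t ht
    induction ht using Submodule.pow_induction_on_left' with
    | algebraMap c => rw [Algebra.algebraMap_eq_smul_one]; exact smul c _ one
    | add x y _ _ _ hx hy => exact add x y hx hy
    | mem_mul m hm _ x _ hx => obtain ⟨u, rfl⟩ := hm; exact ι_mul u x hx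
  induction t using DirectSum.Decomposition.inductionOn (Ten.len U) with
  | zero => simpa using smul 0 _ one
  | homogeneous x => exact hlen _ _ x.2
  | add x y hx hy => exact add x y hx hy

/-- The length grading and the internal grading are compatible because the latter is spanned by
words, each of which has a single length. -/
theorem Ten.proj_mem_deg {n : ℤ} (r : ℕ) {x : Ten U} (hx : x ∈ Ten.deg U n) :
    Ten.proj r x ∈ Ten.deg U n := by
  induction hx using Submodule.span_induction with
  | zero => rw [map_zero]; exact zero_mem _
  | add x y _ _ hx hy => rw [map_add]; exact add_mem hx hy
  | smul c x _ hx => rw [map_smul]; exact Submodule.smul_mem _ _ hx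
  | mem x hx =>
    have hx' := hx
    obtain ⟨l, hl, rfl, rfl⟩ := hx
    have h : (l.map fun p => (TensorAlgebra.ι k p.2 : Ten U)).prod ∈ Ten.len U l.length := by
      clear hx' hl
      induction l with
      | nil => exact Ten.one_mem_len
      | cons p l ih =>
        rw [List.map_cons, List.prod_cons, List.length_cons, add_comm]
        exact Ten.mul_mem_len (Ten.ι_mem_len _) ih
    by_cases hr : l.length = r
    · subst hr; rw [Ten.proj_of_mem h]; exact Submodule.subset_span hx'
    · rw [Ten.proj_of_mem_ne h hr]; exact zero_mem _

theorem Ten.proj_mem_piece {n : ℤ} (r : ℕ) {x : Ten U} (hx : x ∈ Ten.deg U n) :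
    Ten.proj r x ∈ Ten.piece U r n := ⟨Ten.proj_mem r x, Ten.proj_mem_deg r hx⟩

theorem Ten.ι_injective : Function.Injective (TensorAlgebra.ι k : U →ₗ[k] Ten U) :=
  TensorAlgebra.ι_leftInverse.injective

/-- The inclusion preserves degrees and is injective, so the components of `x` outside degree `n`
vanish. It serves to recover the degree of the differential of V from that of `m 1`. -/
theorem Ten.mem_gr_of_ι_mem {n : ℤ} {x : U} (hx : TensorAlgebra.ι k x ∈ Ten.deg U n) :
    x ∈ U.gr n := by
  have h : DirectSum.decompose U.gr x = DirectSum.of (fun i => U.gr i) n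
      (DirectSum.decompose U.gr x n) := by
    refine DFinsupp.ext fun i => ?_
    by_cases hi : n = i
    · subst hi; exact (DirectSum.of_eq_same (β := fun i => U.gr i) _ _).symm
    · rw [DirectSum.of_eq_of_ne _ _ _ (Ne.symm hi)]
      refine Subtype.ext (Ten.ι_injective ?_)
      rw [← decompose_map U.gr (Ten.deg U) (TensorAlgebra.ι k) (fun _ _ h => Ten.ι_mem_deg U h),
        DirectSum.decompose_of_mem_ne _ hx hi]
      simp
  have h' := congrArg (DirectSum.decompose U.gr).symm h
  rw [Equiv.symm_apply_apply, DirectSum.decompose_symm_of] at h'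
  rw [h']; exact SetLike.coe_mem _

/-- The ideal `⨁_{r ≥ N} TʳU`. -/
def Ten.fil (U : GrMod.{u, v} k) (N : ℕ) : Submodule k (Ten U) where
  carrier := {x | ∀ r < N, Ten.proj r x = 0}
  add_mem' hf hg r hr := by rw [map_add, hf r hr, hg r hr, add_zero]
  zero_mem' r _ := map_zero _
  smul_mem' a f hf r hr := by rw [map_smul, hf r hr, smul_zero]

theorem Ten.mem_fil {N : ℕ} {x : Ten U} : x ∈ Ten.fil U N ↔ ∀ r < N, Ten.proj r x = 0 := Iff.rfl

theorem Ten.fil_anti {N M : ℕ} (h : N ≤ M) : Ten.fil U M ≤ Ten.fil U N :=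
  fun _ hx r hr => hx r (hr.trans_le h)

theorem Ten.len_le_fil {N r : ℕ} (h : N ≤ r) : Ten.len U r ≤ Ten.fil U N :=
  fun _ hx _ hq => Ten.proj_of_mem_ne hx (by omega)

theorem Ten.sub_proj_mem (N : ℕ) (x : Ten U) :
    x - ∑ r ∈ Finset.range N, Ten.proj r x ∈ Ten.fil U N := by
  intro q hq
  rw [map_sub, map_sum, Finset.sum_eq_single q, Ten.proj_proj, sub_self]
  · intro r _ hr; exact Ten.proj_of_mem_ne (Ten.proj_mem r x) hr
  · intro h; exact absurd (Finset.mem_range.2 hq) h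

/-- Induction on the elements of `⨁_{r ≥ N} TʳU`. -/
theorem Ten.fil_induction {N : ℕ} {p : Ten U → Prop} {x : Ten U} (hx : x ∈ Ten.fil U N)
    (zero : p 0) (len : ∀ r ≥ N, ∀ x ∈ Ten.len U r, p x) (add : ∀ x y, p x → p y → p (x + y)) :
    p x := by
  classical
  rw [← DirectSum.sum_support_decompose (Ten.len U) x]
  refine Finset.sum_induction _ p add zero fun r hr => len r ?_ _ (SetLike.coe_mem _)
  by_contra h
  rw [DFinsupp.mem_support_iff] at hr
  exact hr (Subtype.ext (hx r (by omega)))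

theorem Ten.fil_mul_mem {a b : ℕ} {x y : Ten U} (hx : x ∈ Ten.fil U a) (hy : y ∈ Ten.fil U b) :
    x * y ∈ Ten.fil U (a + b) := by
  refine Ten.fil_induction (p := fun x => x * y ∈ _) hx (by rw [zero_mul]; exact zero_mem _)
    (fun r hr x hx => ?_) fun x x' hx hx' => by rw [add_mul]; exact add_mem hx hx'
  refine Ten.fil_induction (p := fun y => x * y ∈ _) hy (by rw [mul_zero]; exact zero_mem _)
    (fun q hq y hy => ?_) fun x x' hx hx' => by rw [mul_add]; exact add_mem hx hx'
  exact Ten.len_le_fil (by omega) (Ten.mul_mem_len hx hy)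

theorem Ten.mem_fil_zero (x : Ten U) : x ∈ Ten.fil U 0 := fun _ h => absurd h (by omega)

theorem Ten.isIdeal_fil (N : ℕ) : IsIdeal (Ten.fil U N) := fun a x hx =>
  ⟨by simpa using Ten.fil_mul_mem (Ten.mem_fil_zero a) hx,
    by simpa using Ten.fil_mul_mem hx (Ten.mem_fil_zero a)⟩

theorem Ten.isHomog_fil (N : ℕ) : IsHomog (Ten.deg U) (Ten.fil U N) := by
  intro x hx n r hr
  rw [← decompose_map (Ten.deg U) (Ten.deg U) (Ten.proj r) (fun _ _ h => Ten.proj_mem_deg r h),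
    hx r hr]
  simp

theorem Ten.proj_parity (r : ℕ) (x : Ten U) :
    Ten.proj r (parity (Ten.deg U) x) = parity (Ten.deg U) (Ten.proj r x) :=
  map_parity _ _ _ (fun _ _ h => Ten.proj_mem_deg r h) x

theorem Ten.parity_mem_len {r : ℕ} {x : Ten U} (hx : x ∈ Ten.len U r) :
    parity (Ten.deg U) x ∈ Ten.len U r := by
  rw [← Ten.proj_of_mem hx, ← Ten.proj_parity]; exact Ten.proj_mem _ _

theorem Ten.map_ι {W : GrMod.{u, v} k} (f : GrHom U W) (x : U) :
    Ten.map f (TensorAlgebra.ι k x) = TensorAlgebra.ι k (f.toLin x) := by simp [Ten.map]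

theorem Ten.map_mem_len {W : GrMod.{u, v} k} (f : GrHom U W) {r : ℕ} {x : Ten U}
    (hx : x ∈ Ten.len U r) : Ten.map f x ∈ Ten.len W r := by
  induction hx using Submodule.pow_induction_on_left' with
  | algebraMap c =>
    rw [AlgHom.commutes, Algebra.algebraMap_eq_smul_one]
    exact Submodule.smul_mem _ _ Ten.one_mem_len
  | add x y _ _ _ hx hy => rw [map_add]; exact add_mem hx hy
  | mem_mul m hm i x _ hx =>
    obtain ⟨u, rfl⟩ := hm
    rw [map_mul, Ten.map_ι, Nat.succ_eq_add_one, add_comm i]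
    exact Ten.mul_mem_len (Ten.ι_mem_len _) hx

theorem Ten.map_mem_deg {W : GrMod.{u, v} k} (f : GrHom U W) (n : ℤ) (x : Ten U)
    (hx : x ∈ Ten.deg U n) : Ten.map f x ∈ Ten.deg W n := by
  induction hx using Submodule.span_induction with
  | zero => rw [map_zero]; exact zero_mem _
  | add x y _ _ hx hy => rw [map_add]; exact add_mem hx hy
  | smul c x _ hx => rw [map_smul]; exact Submodule.smul_mem _ _ hx
  | mem x hx =>
    obtain ⟨l, hl, rfl, rfl⟩ := hx
    refine Submodule.subset_span ⟨l.map fun p => (p.1, f.toLin p.2), ?_, ?_, ?_⟩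
    · intro p hp
      obtain ⟨q, hq, rfl⟩ := List.mem_map.1 hp
      exact f.map_gr _ _ (hl q hq)
    · simp [Function.comp_def]
    · simp [map_list_prod, Function.comp_def, Ten.map]

theorem Ten.proj_map {W : GrMod.{u, v} k} (f : GrHom U W) (r : ℕ) (x : Ten U) :
    Ten.proj r (Ten.map f x) = Ten.map f (Ten.proj r x) := by
  induction x using DirectSum.Decomposition.inductionOn (Ten.len U) with
  | zero => simp
  | @homogeneous i x =>
    by_cases h : i = r
    · subst h; rw [Ten.proj_of_mem x.2, Ten.proj_of_mem (Ten.map_mem_len f x.2)]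
    · rw [Ten.proj_of_mem_ne x.2 h, Ten.proj_of_mem_ne (Ten.map_mem_len f x.2) h, map_zero]
  | add x y hx hy => simp only [map_add, hx, hy]

/-- The counit of the tensor algebra is the projection to `T⁰U = k`. -/
theorem Ten.algebraMap_algebraMapInv (x : Ten U) :
    algebraMap k (Ten U) (TensorAlgebra.algebraMapInv x) = Ten.proj 0 x := by
  induction x using Ten.word_induction with
  | one => rw [map_one, map_one, Ten.proj_of_mem Ten.one_mem_len]
  | ι_mul x t _ =>
    rw [map_mul, Ten.proj_mul_of_mem (Ten.ι_mem_len x)]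
    simp [TensorAlgebra.algebraMapInv]
  | add x y hx hy => simp only [map_add, hx, hy]
  | smul c x hx =>
    rw [map_smul (Ten.proj 0), ← hx, map_smul, smul_eq_mul, map_mul, ← Algebra.smul_def]

/-! ### Derivations of the tensor algebra -/

section Deriv

variable (m : U →ₗ[k] Ten U)

/-- The diagonal entries are multiplicative and the lower left entry stays zero, so they are
determined by the generators. The upper right entry of a product is then the Leibniz rule, which
gives `derivExt_mul`. -/
theorem derivMatrix_apply (x : Ten U) :
    derivMatrix m x = !![parity (Ten.deg U) x, derivExt m x; 0, x] := by
  have h : derivMatrix m x 0 0 = parity (Ten.deg U) x ∧ derivMatrix m x 1 0 = 0 ∧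
      derivMatrix m x 1 1 = x := by
    induction x using TensorAlgebra.induction with
    | algebraMap r =>
      rw [AlgHom.commutes, Algebra.algebraMap_eq_smul_one, Algebra.algebraMap_eq_smul_one, map_smul,
        parity_one]
      simp
    | ι x => simp [derivMatrix]
    | mul x y hx hy =>
      rw [map_mul, parity_mul]
      simp [Matrix.mul_apply, Fin.sum_univ_two, hx, hy]
    | add x y hx hy => simp [hx, hy]
  ext i j
  fin_cases i <;> fin_cases j
  · exact h.1
  · rfl
  · exact h.2.1
  · exact h.2.2

@[simp]
theorem derivExt_ι (x : U) : derivExt m (TensorAlgebra.ι k x) = m x := by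
  simp [derivExt, derivMatrix]

theorem derivExt_mul (x y : Ten U) :
    derivExt m (x * y) = derivExt m x * y + parity (Ten.deg U) x * derivExt m y := by
  have h : derivExt m (x * y) = (derivMatrix m x * derivMatrix m y) 0 1 := by
    rw [← map_mul]; rfl
  rw [h, derivMatrix_apply, derivMatrix_apply, Matrix.mul_apply, Fin.sum_univ_two]
  simp [add_comm]

theorem derivExt_one : derivExt m 1 = 0 :=
  map_one_of_leibniz (F := parityHom (Ten.deg U)) (G := AlgHom.id k _) (derivExt_mul m)

variable {m}

theorem derivExt_mem_deg {s : ℤ} (hm : ∀ n, ∀ x ∈ U.gr n, m x ∈ Ten.deg U (n + s)) (n : ℤ)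
    (x : Ten U) (hx : x ∈ Ten.deg U n) : derivExt m x ∈ Ten.deg U (n + s) := by
  induction hx using Submodule.span_induction with
  | zero => rw [map_zero]; exact zero_mem _
  | add x y _ _ hx hy => rw [map_add]; exact add_mem hx hy
  | smul c x _ hx => rw [map_smul]; exact Submodule.smul_mem _ _ hx
  | mem x hx =>
    obtain ⟨l, hl, rfl, rfl⟩ := hx
    induction l with
    | nil => simp only [List.map_nil, List.prod_nil, derivExt_one]; exact zero_mem _
    | cons p l ih =>
      have ih := ih fun q hq => hl q (List.mem_cons_of_mem _ hq)
      have hp := hl p List.mem_cons_self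
      have hl' : (l.map fun p => TensorAlgebra.ι k p.2).prod ∈ Ten.deg U (l.map Prod.fst).sum :=
        Submodule.subset_span ⟨l, fun q hq => hl q (List.mem_cons_of_mem _ hq), rfl, rfl⟩
      simp only [List.map_cons, List.prod_cons, List.sum_cons, derivExt_mul, derivExt_ι]
      refine add_mem ?_ ?_
      · have := SetLike.GradedMul.mul_mem (hm _ _ hp) hl'
        rwa [add_right_comm] at this
      · have := SetLike.GradedMul.mul_mem (parity_mem (Ten.deg U) (Ten.ι_mem_deg U hp)) ih
        rwa [← add_assoc] at this

/-- Each term replaces one letter by r + 1 letters. Writing the length of the values as r + 1 avoids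
a truncated subtraction. -/
theorem derivExt_mem_len {r : ℕ} (hm : ∀ x, m x ∈ Ten.len U (r + 1)) {q : ℕ} {x : Ten U}
    (hx : x ∈ Ten.len U q) : derivExt m x ∈ Ten.len U (q + r) := by
  induction hx using Submodule.pow_induction_on_left' with
  | algebraMap c =>
    rw [Algebra.algebraMap_eq_smul_one, map_smul, derivExt_one, smul_zero]; exact zero_mem _
  | add x y _ _ _ hx hy => rw [map_add]; exact add_mem hx hy
  | mem_mul y hy i x hx ih =>
    obtain ⟨u, rfl⟩ := hy
    rw [derivExt_mul, derivExt_ι]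
    refine add_mem ?_ ?_
    · have := Ten.mul_mem_len (hm u) hx
      rwa [show r + 1 + i = i.succ + r by omega] at this
    · have := Ten.mul_mem_len (Ten.parity_mem_len (Ten.ι_mem_len u)) ih
      rwa [show 1 + (i + r) = i.succ + r by omega] at this

/-- Replacing a letter by at least one letter does not shorten a word. For the cooperations the
hypothesis amounts to m_0 = 0; the conclusion is the source of the continuity of the differential.
-/
theorem derivExt_mem_fil (hm : ∀ x, m x ∈ Ten.fil U 1) {N : ℕ} {x : Ten U}
    (hx : x ∈ Ten.fil U N) : derivExt m x ∈ Ten.fil U N := by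
  refine Ten.fil_induction (p := fun x => derivExt m x ∈ _) hx
    (by rw [map_zero]; exact zero_mem _) (fun r hr x hx => ?_)
    fun x y hx hy => by rw [map_add]; exact add_mem hx hy
  refine Ten.fil_anti hr ?_
  clear hr
  induction hx using Submodule.pow_induction_on_left' with
  | algebraMap c =>
    rw [Algebra.algebraMap_eq_smul_one, map_smul, derivExt_one, smul_zero]; exact zero_mem _
  | add x y _ _ _ hx hy => rw [map_add]; exact add_mem hx hy
  | mem_mul y hy i x hx ih =>
    obtain ⟨u, rfl⟩ := hy
    rw [derivExt_mul, derivExt_ι, Nat.succ_eq_add_one, add_comm i]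
    exact add_mem (Ten.fil_mul_mem (hm u) (Ten.len_le_fil le_rfl hx))
      (Ten.fil_mul_mem (Ten.len_le_fil le_rfl (Ten.parity_mem_len (Ten.ι_mem_len u))) ih)

/-- The difference of two derivations along the same maps is again such a derivation, so
`mem_of_leibniz` applies. -/
theorem derivExt_sub_mem_fil {m' : U →ₗ[k] Ten U} {N : ℕ} (h : ∀ x, m x - m' x ∈ Ten.fil U N)
    (x : Ten U) : derivExt m x - derivExt m' x ∈ Ten.fil U N :=
  mem_of_leibniz (φ := derivExt m - derivExt m') (F := parityHom (Ten.deg U))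
    (G := AlgHom.id k _) (fun x y => by simp [derivExt_mul]; noncomm_ring) (Ten.isIdeal_fil N)
    (fun x => by simpa using h x) x

theorem derivExt_sum {ι : Type*} (s : Finset ι) (m : ι → U →ₗ[k] Ten U) (x : Ten U) :
    derivExt (∑ i ∈ s, m i) x = ∑ i ∈ s, derivExt (m i) x := by
  have := mem_of_leibniz (φ := derivExt (∑ i ∈ s, m i) - ∑ i ∈ s, derivExt (m i))
    (F := parityHom (Ten.deg U)) (G := AlgHom.id k _) (fun x y => by
      simp [derivExt_mul, Finset.sum_add_distrib, Finset.sum_mul, Finset.mul_sum, sub_mul, mul_sub]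
      abel) isIdeal_bot (fun x => by simp) x
  simpa [sub_eq_zero] using this

theorem derivExt_zero (x : Ten U) : derivExt (0 : U →ₗ[k] Ten U) x = 0 := by
  simpa using derivExt_sum (∅ : Finset ℕ) (fun _ => (0 : U →ₗ[k] Ten U)) x

end Deriv

/-! ### Components of the tensor square -/

/-- `TᵃU ⊗ TᵇU`, as the span of the tensor products of homogeneous elements. -/
def Ten.len₂ (U : GrMod.{u, v} k) (a b : ℕ) : Submodule k (Ten U ⊗[k] Ten U) :=
  Submodule.span k {z | ∃ i j : ℤ, ∃ x ∈ Ten.piece U a i, ∃ y ∈ Ten.piece U b j, x ⊗ₜ[k] y = z}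

theorem Ten.piece₂_le_len₂ (a b : ℕ) (n : ℤ) : Ten.piece₂ U a b n ≤ Ten.len₂ U a b :=
  Submodule.span_mono fun _ ⟨i, j, _, h⟩ => ⟨i, j, h⟩

/-- Two linear maps which agree on `TᵃU` and on `TᵇU` have the same tensor product on
`TᵃU ⊗ TᵇU`. -/
theorem Ten.map_congr_of_mem_len₂ {M N : Type*} [AddCommGroup M] [Module k M] [AddCommGroup N]
    [Module k N] {f f' : Ten U →ₗ[k] M} {g g' : Ten U →ₗ[k] N} {a b : ℕ}
    (hf : ∀ x ∈ Ten.len U a, f x = f' x) (hg : ∀ x ∈ Ten.len U b, g x = g' x)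
    {z : Ten U ⊗[k] Ten U} (hz : z ∈ Ten.len₂ U a b) :
    TensorProduct.map f g z = TensorProduct.map f' g' z := by
  induction hz using Submodule.span_induction with
  | zero => simp
  | add x y _ _ hx hy => simp only [map_add, hx, hy]
  | smul c x _ hx => simp only [map_smul, hx]
  | mem z hz =>
    obtain ⟨i, j, x, hx, y, hy, rfl⟩ := hz
    rw [TensorProduct.map_tmul, TensorProduct.map_tmul, hf x hx.1, hg y hy.1]

theorem Ten.map_eq_zero_of_mem_len₂ {M N : Type*} [AddCommGroup M] [Module k M] [AddCommGroup N]
    [Module k N] {f : Ten U →ₗ[k] M} {g : Ten U →ₗ[k] N} {a b : ℕ}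
    (h : (∀ x ∈ Ten.len U a, f x = 0) ∨ ∀ x ∈ Ten.len U b, g x = 0)
    {z : Ten U ⊗[k] Ten U} (hz : z ∈ Ten.len₂ U a b) : TensorProduct.map f g z = 0 := by
  rcases h with h | h
  · rw [Ten.map_congr_of_mem_len₂ (f' := 0) (g' := g) h (fun _ _ => rfl) hz]; simp
  · rw [Ten.map_congr_of_mem_len₂ (f' := f) (g' := 0) (fun _ _ => rfl) h hz]; simp

/-- Left multiplication by an element of bilength (a₁, b₁) shifts bilengths. The length projections
preserve degrees, so the Koszul signs on both sides agree. It yields the recursion over the first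
letter in `Coop.comulExt_eq`. -/
theorem Ten.map_proj_mul_of_mem_len₂ {a₁ b₁ : ℕ} {z : Ten U ⊗[k] Ten U}
    (hz : z ∈ Ten.len₂ U a₁ b₁) (w : Ten.Sq U) (a b : ℕ) :
    TensorProduct.map (Ten.proj a) (Ten.proj b)
      ((of k (Ten.deg U) (Ten.deg U)).symm (of k (Ten.deg U) (Ten.deg U) z * w)) =
    if a₁ ≤ a ∧ b₁ ≤ b then (of k (Ten.deg U) (Ten.deg U)).symm
      (of k (Ten.deg U) (Ten.deg U) z * of k (Ten.deg U) (Ten.deg U)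
        (TensorProduct.map (Ten.proj (a - a₁)) (Ten.proj (b - b₁))
          ((of k (Ten.deg U) (Ten.deg U)).symm w))) else 0 := by
  induction hz using Submodule.span_induction with
  | zero => simp
  | add x y _ _ hx hy =>
    simp only [map_add, add_mul, hx, hy]; split_ifs <;> simp
  | smul c x _ hx =>
    have h : ∀ w : Ten.Sq U, of k (Ten.deg U) (Ten.deg U) (c • x) * w =
      c • (of k (Ten.deg U) (Ten.deg U) x * w) := fun w => by
        rw [map_smul]; exact smul_mul_assoc c _ w
    refine (congrArg (fun q => TensorProduct.map (Ten.proj a) (Ten.proj b)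
      ((of k (Ten.deg U) (Ten.deg U)).symm q)) (h w)).trans ?_
    refine (map_smul (TensorProduct.map (Ten.proj a) (Ten.proj b) ∘ₗ
      (of k (Ten.deg U) (Ten.deg U)).symm.toLinearMap) c _).trans ?_
    refine (congrArg (c • ·) hx).trans ?_
    split_ifs
    · exact (congrArg (of k (Ten.deg U) (Ten.deg U)).symm (h _)).symm
    · exact smul_zero c
  | mem z hz =>
    obtain ⟨i, j, x, hx, y, hy, rfl⟩ := hz
    induction w using tensor_induction (Ten.deg U) (Ten.deg U) with
    | zero => simp
    | add x y hx hy => simp only [map_add, mul_add, hx, hy]; split_ifs <;> simp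
    | tmul i' j' x' hx' y' hy' =>
      have h₁ := tmul_mul_tmul (Ten.deg U) (Ten.deg U) x hy.2 hx' y'
      have h₂ := tmul_mul_tmul (Ten.deg U) (Ten.deg U) x hy.2 (Ten.proj_mem_deg (a - a₁) hx')
        (Ten.proj (b - b₁) y')
      rw [h₁, of_symm_of, TensorProduct.map_tmul, h₂, map_smul, map_smul, map_smul, of_symm_of,
        of_symm_of, TensorProduct.map_tmul, Ten.proj_mul_of_mem hx.1, Ten.proj_mul_of_mem hy.1]
      by_cases h₁ : a₁ ≤ a <;> by_cases h₂ : b₁ ≤ b <;> simp [h₁, h₂]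

/-- Elements of `TU ⊗ TU` whose components in `TᵃU ⊗ TᵇU` vanish for `a, b < N`. -/
theorem Ten.tproj_eq_zero_iff {N : ℕ} {z : Ten U ⊗[k] Ten U} :
    tproj (Ten.fil U N) (Ten.fil U N) z = 0 ↔
      ∀ a < N, ∀ b < N, TensorProduct.map (Ten.proj a) (Ten.proj b) z = 0 := by
  constructor
  · intro h a ha b hb
    have hle : ∀ a < N, Ten.fil U N ≤ LinearMap.ker (Ten.proj a) := fun a ha x hx => hx a ha
    have := congrArg (TensorProduct.map ((Ten.fil U N).liftQ (Ten.proj a) (hle a ha))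
      ((Ten.fil U N).liftQ (Ten.proj b) (hle b hb))) h
    rw [tproj, ← LinearMap.comp_apply, ← TensorProduct.map_comp, Submodule.liftQ_mkQ,
      Submodule.liftQ_mkQ, map_zero] at this
    exact this
  · intro h
    -- Modulo `fil N` an element equals the sum of its components of length less than N.
    have e : (Ten.fil U N).mkQ = (Ten.fil U N).mkQ ∘ₗ ∑ r ∈ Finset.range N, Ten.proj r := by
      ext x : 1
      rw [LinearMap.comp_apply, LinearMap.sum_apply, ← sub_eq_zero, ← map_sub, Submodule.mkQ_apply,
        Submodule.Quotient.mk_eq_zero]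
      exact Ten.sub_proj_mem N x
    rw [tproj, e, TensorProduct.map_comp, LinearMap.comp_apply]
    have : TensorProduct.map (∑ r ∈ Finset.range N, Ten.proj r)
        (∑ r ∈ Finset.range N, Ten.proj r) z = 0 := by
      rw [← TensorProduct.mapBilinear_apply]
      simp only [map_sum, LinearMap.sum_apply, TensorProduct.mapBilinear_apply]
      refine Finset.sum_eq_zero fun a ha => Finset.sum_eq_zero fun b hb => ?_
      apply h <;> simp_all
    rw [this, map_zero]

end

end BInfty

namespace BInfty

noncomputable section

open GradedTensorProduct

/-! ### Families of cooperations -/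

/-- Families of cooperations on `U` of the degrees of those of a `B_∞`-coalgebra, normalized as
these, which are not required to satisfy any identities. -/
structure Coop {k : Type u} [Field k] (U : GrMod.{u, v} k) where
  m : ℕ → U →ₗ[k] Ten U
  m_mem : ∀ r n, ∀ x ∈ U.gr n, m r x ∈ Ten.piece U r (n + 1)
  m_zero : ∀ x, m 0 x = 0
  c : ℕ → ℕ → U →ₗ[k] Ten U ⊗[k] Ten U
  c_mem : ∀ a b n, ∀ x ∈ U.gr n, c a b x ∈ Ten.piece₂ U a b n
  c_zero_left : ∀ b x, c 0 b x = if b = 1 then 1 ⊗ₜ[k] TensorAlgebra.ι k x else 0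
  c_zero_right : ∀ a x, c a 0 x = if a = 1 then TensorAlgebra.ι k x ⊗ₜ[k] 1 else 0

variable {k : Type u} [Field k] {U : GrMod.{u, v} k}

theorem GrMod.mem_of_homogeneous {M : Type*} [AddCommGroup M] [Module k M] (f : U →ₗ[k] M)
    {S : Submodule k M} (h : ∀ n, ∀ x ∈ U.gr n, f x ∈ S) (x : U) : f x ∈ S := by
  induction x using DirectSum.Decomposition.inductionOn U.gr with
  | zero => rw [map_zero]; exact zero_mem _
  | homogeneous x => exact h _ _ x.2
  | add x y hx hy => rw [map_add]; exact add_mem hx hy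

namespace Coop

variable (S : Coop U)

theorem m_mem_len (r : ℕ) (x : U) : S.m r x ∈ Ten.len U r :=
  GrMod.mem_of_homogeneous (S.m r) (fun n x hx => (S.m_mem r n x hx).1) x

theorem m_zero' : S.m 0 = 0 := LinearMap.ext S.m_zero

theorem c_mem_len₂ (a b : ℕ) (x : U) : S.c a b x ∈ Ten.len₂ U a b :=
  GrMod.mem_of_homogeneous (S.c a b)
    (fun n x hx => Ten.piece₂_le_len₂ a b n (S.c_mem a b n x hx)) x

/-! ### The derivation -/

/-- The derivation of `TU` which extends `∑_{r < N} m r`. -/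
def D (N : ℕ) : Ten U →ₗ[k] Ten U := derivExt (∑ r ∈ Finset.range N, S.m r)

theorem D_ι (N : ℕ) (x : U) : S.D N (TensorAlgebra.ι k x) = ∑ r ∈ Finset.range N, S.m r x := by
  simp [D]

theorem D_mul (N : ℕ) (x y : Ten U) :
    S.D N (x * y) = S.D N x * y + parity (Ten.deg U) x * S.D N y := derivExt_mul _ x y

theorem D_mem_deg (N : ℕ) (n : ℤ) (x : Ten U) (hx : x ∈ Ten.deg U n) :
    S.D N x ∈ Ten.deg U (n + 1) :=
  derivExt_mem_deg (fun n x hx => by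
    rw [LinearMap.sum_apply]
    exact Submodule.sum_mem _ fun r _ => (S.m_mem r n x hx).2) n x hx

theorem m_mem_fil_one (r : ℕ) (x : U) : S.m r x ∈ Ten.fil U 1 := by
  rcases Nat.eq_zero_or_pos r with rfl | hr
  · rw [S.m_zero]; exact zero_mem _
  · exact Ten.len_le_fil hr (S.m_mem_len r x)

theorem D_mem_fil (N : ℕ) {q : ℕ} {x : Ten U} (hx : x ∈ Ten.fil U q) : S.D N x ∈ Ten.fil U q :=
  derivExt_mem_fil (fun x => by
    rw [LinearMap.sum_apply]
    exact Submodule.sum_mem _ fun r _ => S.m_mem_fil_one r x) hx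

/-- The additional m_r have r ≥ N, so their values on generators lie in the ideal `fil N`. Hence the
derivations `D N` stabilize modulo words of any given length. -/
theorem D_sub_mem {N M : ℕ} (h : N ≤ M) (x : Ten U) : S.D M x - S.D N x ∈ Ten.fil U N :=
  derivExt_sub_mem_fil (fun x => by
    rw [LinearMap.sum_apply, LinearMap.sum_apply, ← Finset.sum_sdiff (Finset.range_mono h),
      add_sub_cancel_right]
    refine Submodule.sum_mem _ fun r hr => Ten.len_le_fil ?_ (S.m_mem_len r x)
    simp at hr
    omega) x

/-- The derivation extending m_r changes the length by r - 1, so only r = n + 1 - q leads from TqU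
to TnU; this is the map D^q_n of the identities. The bound on `n` ensures that this r occurs in the
truncated sum. -/
theorem proj_D {N q n : ℕ} (hn : n + 1 < N) {x : Ten U} (hx : x ∈ Ten.len U q) :
    Ten.proj n (S.D N x) = if q ≤ n + 1 then derivExt (S.m (n + 1 - q)) x else 0 := by
  have key : ∀ r, Ten.proj n (derivExt (S.m r) x) =
      if q + r = n + 1 then derivExt (S.m r) x else 0 := by
    -- The operation m_0 would shorten words, a case outside `derivExt_mem_len`; it is zero.
    rintro (_ | r)
    · rw [S.m_zero', derivExt_zero]; simp
    · have h := derivExt_mem_len (S.m_mem_len (r + 1)) hx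
      split_ifs with hr
      · rw [Ten.proj_of_mem]; rwa [show n = q + r by omega]
      · exact Ten.proj_of_mem_ne h (by omega)
  rw [D, derivExt_sum, map_sum]
  simp only [key]
  split_ifs with h
  · rw [Finset.sum_eq_single (n + 1 - q)]
    · rw [if_pos (by omega)]
    · intro r _ hr; rw [if_neg (by omega)]
    · intro hr; simp at hr; omega
  · exact Finset.sum_eq_zero fun r _ => if_neg (by omega)

/-- A term m_p followed by the extension of m_q has length p + q - 1. So the component of D² in
length n is the quadratic relation of index n + 1. -/
theorem proj_D_D (n N : ℕ) (hn : n + 1 < N) (x : U) :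
    Ten.proj n (S.D N (S.D N (TensorAlgebra.ι k x))) =
      ∑ p ∈ Finset.HasAntidiagonal.antidiagonal (n + 1), derivExt (S.m p.2) (S.m p.1 x) := by
  rw [D_ι, map_sum, map_sum, Finset.Nat.sum_antidiagonal_eq_sum_range_succ_mk]
  have h : ∀ r ∈ Finset.range N, Ten.proj n (S.D N (S.m r x)) =
      if r ≤ n + 1 then derivExt (S.m (n + 1 - r)) (S.m r x) else 0 :=
    fun r _ => S.proj_D hn (S.m_mem_len r x)
  rw [Finset.sum_congr rfl h, ← Finset.sum_filter]
  refine Finset.sum_congr ?_ fun _ _ => rfl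
  ext r
  simp
  omega

/-- `D² = 0` up to terms of large length. -/
theorem D_D_mem_fil (h : ∀ n x, ∑ p ∈ Finset.HasAntidiagonal.antidiagonal n,
    derivExt (S.m p.2) (S.m p.1 x) = 0) {N M : ℕ} (hM : N + 1 ≤ M) (t : Ten U) :
    S.D M (S.D M t) ∈ Ten.fil U N := by
  refine mem_of_leibniz (φ := S.D M ∘ₗ S.D M) (F := AlgHom.id k _) (G := AlgHom.id k _)
    (fun x y => ?_) (Ten.isIdeal_fil N) (fun x n hn => ?_) t
  -- The two mixed terms of D²(xy) cancel because D anticommutes with the parity; thus D² is an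
  -- ordinary derivation.
  · simp only [LinearMap.comp_apply, D_mul, map_add, parity_parity,
      map_parity_of_odd _ _ _ (S.D_mem_deg M), AlgHom.id_apply]
    noncomm_ring
  · rw [LinearMap.comp_apply, S.proj_D_D n M (by omega), h]

/-! ### The coproduct -/

/-- The multiplicative extension of `∑_{a, b < N} c a b`. -/
def comul (N : ℕ) : Ten U →ₐ[k] Ten.Sq U :=
  TensorAlgebra.lift k (∑ a ∈ Finset.range N, ∑ b ∈ Finset.range N,
    (of k (Ten.deg U) (Ten.deg U)).toLinearMap ∘ₗ S.c a b)

/-- `comul` as a linear map into the tensor square. -/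
def cm (N : ℕ) : Ten U →ₗ[k] Ten U ⊗[k] Ten U :=
  (of k (Ten.deg U) (Ten.deg U)).symm.toLinearMap ∘ₗ (S.comul N).toLinearMap

theorem cm_apply (N : ℕ) (t : Ten U) :
    S.cm N t = (of k (Ten.deg U) (Ten.deg U)).symm (S.comul N t) := rfl

theorem comul_ι (N : ℕ) (x : U) : S.comul N (TensorAlgebra.ι k x) =
    ∑ a ∈ Finset.range N, ∑ b ∈ Finset.range N, of k (Ten.deg U) (Ten.deg U) (S.c a b x) := by
  simp [comul]

theorem cm_ι (N : ℕ) (x : U) : S.cm N (TensorAlgebra.ι k x) =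
    ∑ a ∈ Finset.range N, ∑ b ∈ Finset.range N, S.c a b x := by
  simp [cm_apply, comul_ι]

theorem comulExt_one (a b : ℕ) :
    comulExt S.c a b 1 = if a = 0 ∧ b = 0 then 1 ⊗ₜ[k] 1 else 0 := by
  simp only [comulExt, LinearMap.coe_mk, AddHom.coe_mk, map_one, PowerSeries.coeff_one]
  by_cases hb : b = 0
  · by_cases ha : a = 0
    · simp [ha, hb, PowerSeries.coeff_one]; rfl
    · simp [ha, hb, PowerSeries.coeff_one]
  · simp [hb]

theorem comulExt_ι_mul (a b : ℕ) (x : U) (t : Ten U) :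
    comulExt S.c a b (TensorAlgebra.ι k x * t) =
      ∑ q ∈ Finset.HasAntidiagonal.antidiagonal b, ∑ p ∈ Finset.HasAntidiagonal.antidiagonal a,
        (of k (Ten.deg U) (Ten.deg U)).symm (of k (Ten.deg U) (Ten.deg U) (S.c p.1 q.1 x) *
          of k (Ten.deg U) (Ten.deg U) (comulExt S.c p.2 q.2 t)) := by
  simp only [comulExt, LinearMap.coe_mk, AddHom.coe_mk, map_mul, PowerSeries.coeff_mul, map_sum,
    symm_of_of]
  refine Finset.sum_congr rfl fun q _ => Finset.sum_congr rfl fun p _ => ?_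
  simp [comulSeries]

/-- A product with bilength (a, b) involves only c_{a',b'} with a' ≤ a and b' ≤ b, so truncation at
N loses nothing in this component. It links the power series that define the multiplicative
extension with an algebra map into TU ⊗ TU, to which the arguments on generators apply. -/
theorem comulExt_eq {N a b : ℕ} (ha : a < N) (hb : b < N) (t : Ten U) :
    TensorProduct.map (Ten.proj a) (Ten.proj b) (S.cm N t) = comulExt S.c a b t := by
  induction t using Ten.word_induction generalizing a b with
  | one =>
    have : S.cm N 1 = 1 ⊗ₜ[k] 1 := by rw [cm_apply, map_one]; rfl
    rw [comulExt_one, this, TensorProduct.map_tmul]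
    have h : ∀ r, Ten.proj r (1 : Ten U) = if r = 0 then 1 else 0 := by
      intro r
      split_ifs with h
      · subst h; exact Ten.proj_of_mem Ten.one_mem_len
      · exact Ten.proj_of_mem_ne Ten.one_mem_len (Ne.symm h)
    rw [h, h]
    by_cases h₁ : a = 0 <;> by_cases h₂ : b = 0 <;> simp [h₁, h₂]
  | add x y hx hy => simp only [map_add, hx ha hb, hy ha hb]
  | smul c x hx => simp only [map_smul, hx ha hb]
  | ι_mul x t ih =>
    have h₀ : S.cm N (TensorAlgebra.ι k x * t) = ∑ a ∈ Finset.range N, ∑ b ∈ Finset.range N,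
        (of k (Ten.deg U) (Ten.deg U)).symm
          (of k (Ten.deg U) (Ten.deg U) (S.c a b x) * S.comul N t) := by
      rw [cm_apply, map_mul, comul_ι, Finset.sum_mul, map_sum]
      refine Finset.sum_congr rfl fun a _ => ?_
      rw [Finset.sum_mul, map_sum]
    rw [h₀, comulExt_ι_mul]
    simp only [map_sum]
    simp only [Ten.map_proj_mul_of_mem_len₂ (S.c_mem_len₂ _ _ x) (S.comul N t), ← cm_apply]
    -- The recursion of `comulExt` sums over a₁ ≤ a and b₁ ≤ b; the other terms with a₁, b₁ < N are
    -- zero by length.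
    rw [Finset.sum_comm, Finset.Nat.sum_antidiagonal_eq_sum_range_succ_mk]
    rw [← Finset.sum_subset (Finset.range_mono (show b + 1 ≤ N from hb))]
    · refine Finset.sum_congr rfl fun b₁ hb₁ => ?_
      rw [Finset.mem_range] at hb₁
      rw [Finset.Nat.sum_antidiagonal_eq_sum_range_succ_mk,
        ← Finset.sum_subset (Finset.range_mono (show a + 1 ≤ N from ha))]
      · refine Finset.sum_congr rfl fun a₁ ha₁ => ?_
        rw [Finset.mem_range] at ha₁
        rw [if_pos ⟨by omega, by omega⟩, ih (by omega) (by omega)]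
      · intro a₁ _ h
        rw [Finset.mem_range] at h
        exact if_neg (by omega)
    · intro b₁ _ h
      rw [Finset.mem_range] at h
      exact Finset.sum_eq_zero fun a₁ _ => if_neg (by omega)

/-- As c_{0,0} = 0, each of the r letters contributes at least 1 to a + b. This is why the sums in
the identities are finite and why the coproduct is continuous. -/
theorem comulExt_eq_zero {a b r : ℕ} (h : a + b < r) {t : Ten U} (ht : t ∈ Ten.len U r) :
    comulExt S.c a b t = 0 := by
  induction ht using Submodule.pow_induction_on_left' generalizing a b with
  | algebraMap c => omega
  | add x y _ _ _ hx hy => rw [map_add, hx h, hy h, add_zero]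
  | mem_mul y hy i x hx ih =>
    obtain ⟨u, rfl⟩ := hy
    rw [comulExt_ι_mul]
    refine Finset.sum_eq_zero fun q hq => Finset.sum_eq_zero fun p hp => ?_
    rw [Finset.HasAntidiagonal.mem_antidiagonal] at hp hq
    by_cases h' : p.1 = 0 ∧ q.1 = 0
    · rw [h'.1, h'.2, S.c_zero_left]; simp
    · rw [ih (by omega)]; simp

/-- Bilength (0, b) forces every letter to contribute through some c_{0,b'}, that is, as 1 ⊗ u. This
is the counit axiom in components. -/
theorem comulExt_zero_left (b : ℕ) (t : Ten U) :
    comulExt S.c 0 b t = 1 ⊗ₜ[k] Ten.proj b t := by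
  induction t using Ten.word_induction generalizing b with
  | one =>
    rw [comulExt_one]
    split_ifs with h
    · obtain ⟨_, rfl⟩ := h; rw [Ten.proj_of_mem Ten.one_mem_len]
    · rw [Ten.proj_of_mem_ne Ten.one_mem_len (by omega), TensorProduct.tmul_zero]
  | add x y hx hy => simp only [map_add, hx, hy, TensorProduct.tmul_add]
  | smul c x hx => simp only [map_smul, hx, TensorProduct.tmul_smul]
  | ι_mul x t ih =>
    rw [comulExt_ι_mul, Ten.proj_mul_of_mem (Ten.ι_mem_len x)]
    simp only [Finset.Nat.antidiagonal_zero, Finset.sum_singleton, S.c_zero_left, ih]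
    split_ifs with h
    · rw [Finset.sum_eq_single (1, b - 1)]
      · simp only [if_true]
        -- There is no sign, since the inclusion of the right factor is an algebra map.
        exact ((includeRight (Ten.deg U) (Ten.deg U)).map_mul (TensorAlgebra.ι k x)
          (Ten.proj (b - 1) t)).symm
      · intro p hp hne
        rw [Finset.HasAntidiagonal.mem_antidiagonal] at hp
        rw [if_neg fun h => hne (Prod.ext h (by simp; omega))]; simp
      · intro h'; simp at h'; omega
    · refine (Finset.sum_eq_zero fun p hp => ?_).trans (by simp)
      rw [Finset.HasAntidiagonal.mem_antidiagonal] at hp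
      rw [if_neg (by omega)]; simp

theorem comulExt_zero_right (a : ℕ) (t : Ten U) :
    comulExt S.c a 0 t = Ten.proj a t ⊗ₜ[k] 1 := by
  induction t using Ten.word_induction generalizing a with
  | one =>
    rw [comulExt_one]
    split_ifs with h
    · obtain ⟨rfl, _⟩ := h; rw [Ten.proj_of_mem Ten.one_mem_len]
    · rw [Ten.proj_of_mem_ne Ten.one_mem_len (by omega), TensorProduct.zero_tmul]
  | add x y hx hy => simp only [map_add, hx, hy, TensorProduct.add_tmul]
  | smul c x hx => simp only [map_smul, hx, TensorProduct.smul_tmul']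
  | ι_mul x t ih =>
    rw [comulExt_ι_mul, Ten.proj_mul_of_mem (Ten.ι_mem_len x)]
    simp only [Finset.Nat.antidiagonal_zero, Finset.sum_singleton, S.c_zero_right, ih]
    split_ifs with h
    · rw [Finset.sum_eq_single (1, a - 1)]
      · simp only [if_true]
        exact ((includeLeft (Ten.deg U) (Ten.deg U)).map_mul (TensorAlgebra.ι k x)
          (Ten.proj (a - 1) t)).symm
      · intro p hp hne
        rw [Finset.HasAntidiagonal.mem_antidiagonal] at hp
        rw [if_neg fun h => hne (Prod.ext h (by simp; omega))]; simp
      · intro h'; simp at h'; omega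
    · refine (Finset.sum_eq_zero fun p hp => ?_).trans (by simp)
      rw [Finset.HasAntidiagonal.mem_antidiagonal] at hp
      rw [if_neg (by omega)]; simp

theorem comul_mem_tdeg (N : ℕ) (n : ℤ) (t : Ten U) (ht : t ∈ Ten.deg U n) :
    S.comul N t ∈ tdeg (Ten.deg U) (Ten.deg U) n := by
  induction ht using Submodule.span_induction with
  | zero => rw [map_zero]; exact zero_mem _
  | add x y _ _ hx hy => rw [map_add]; exact add_mem hx hy
  | smul c x _ hx => rw [map_smul]; exact Submodule.smul_mem _ _ hx
  | mem x hx =>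
    obtain ⟨l, hl, rfl, rfl⟩ := hx
    induction l with
    | nil => simp only [List.map_nil, List.prod_nil, map_one]; exact SetLike.GradedOne.one_mem
    | cons p l ih =>
      have ih := ih fun q hq => hl q (List.mem_cons_of_mem _ hq)
      simp only [List.map_cons, List.prod_cons, List.sum_cons, map_mul]
      refine SetLike.GradedMul.mul_mem ?_ ih
      rw [comul_ι]
      refine Submodule.sum_mem _ fun a _ => Submodule.sum_mem _ fun b _ => ?_
      have h := S.c_mem a b _ _ (hl p List.mem_cons_self)
      generalize S.c a b p.2 = z at h
      induction h using Submodule.span_induction with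
      | zero => rw [map_zero]; exact zero_mem _
      | add x y _ _ hx hy => rw [map_add]; exact add_mem hx hy
      | smul c x _ hx => rw [map_smul]; exact Submodule.smul_mem _ _ hx
      | mem z hz =>
        obtain ⟨i, j, h, x, hx, y, hy, rfl⟩ := hz
        exact tmul_mem_tdeg h hx.2 hy.2

/-- Components with both lengths below N do not see the truncation level, by `comulExt_eq`. -/
theorem tproj_cm_eq {N M M' : ℕ} (hM : N ≤ M) (hM' : N ≤ M') (t : Ten U) :
    tproj (Ten.fil U N) (Ten.fil U N) (S.cm M t) =
      tproj (Ten.fil U N) (Ten.fil U N) (S.cm M' t) := by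
  rw [← sub_eq_zero, ← map_sub, Ten.tproj_eq_zero_iff]
  intro a ha b hb
  rw [map_sub, S.comulExt_eq (by omega) (by omega), S.comulExt_eq (by omega) (by omega), sub_self]

/-- If a, b < N then a + b < 2N, and `comulExt_eq_zero` applies. All later truncations at 2N stem
from this bound. -/
theorem tproj_cm_eq_zero {N M : ℕ} (hM : N ≤ M) {t : Ten U} (ht : t ∈ Ten.fil U (2 * N)) :
    tproj (Ten.fil U N) (Ten.fil U N) (S.cm M t) = 0 := by
  rw [Ten.tproj_eq_zero_iff]
  intro a ha b hb
  rw [S.comulExt_eq (by omega) (by omega)]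
  exact Ten.fil_induction (p := fun t => comulExt S.c a b t = 0) ht (map_zero _)
    (fun r hr x hx => S.comulExt_eq_zero (by omega) hx)
    fun x y hx hy => by rw [map_add, hx, hy, add_zero]

end Coop

end

end BInfty

/-! ### The identities for the truncated coproduct and differential -/

namespace BInfty

noncomputable section

open GradedTensorProduct

variable {k : Type u} [Field k] {U : GrMod.{u, v} k}

namespace Coop

variable (S : Coop U)

/-- Since `f` kills words longer than K, the sum up to N that defines `cm N` collapses to one over r
≤ K. This and its mirror image turn components of composites into the finite sums of the identities.
-/
theorem map_proj_right_cm_ι {M : Type*} [AddCommGroup M] [Module k M] (f : Ten U →ₗ[k] M)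
    {K N e : ℕ} (hK : K < N) (he : e < N) (hf : ∀ r > K, ∀ x ∈ Ten.len U r, f x = 0) (x : U) :
    TensorProduct.map f (Ten.proj e) (S.cm N (TensorAlgebra.ι k x)) =
      ∑ r ∈ Finset.range (K + 1), TensorProduct.map f LinearMap.id (S.c r e x) := by
  rw [cm_ι, map_sum, ← Finset.sum_subset (Finset.range_mono (show K + 1 ≤ N from hK))]
  · refine Finset.sum_congr rfl fun r _ => ?_
    rw [map_sum, Finset.sum_eq_single e]
    · exact Ten.map_congr_of_mem_len₂ (fun _ _ => rfl) (fun _ h => Ten.proj_of_mem h)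
        (S.c_mem_len₂ r e x)
    · intro b _ hb
      exact Ten.map_eq_zero_of_mem_len₂ (Or.inr fun _ h => Ten.proj_of_mem_ne h hb)
        (S.c_mem_len₂ r b x)
    · intro h; exact absurd (Finset.mem_range.2 he) h
  · intro r _ hr
    rw [Finset.mem_range] at hr
    rw [map_sum]
    exact Finset.sum_eq_zero fun b _ => Ten.map_eq_zero_of_mem_len₂ (Or.inl (hf r (by omega)))
      (S.c_mem_len₂ r b x)

theorem map_proj_left_cm_ι {M : Type*} [AddCommGroup M] [Module k M] (g : Ten U →ₗ[k] M)
    {K N a : ℕ} (hK : K < N) (ha : a < N) (hg : ∀ r > K, ∀ x ∈ Ten.len U r, g x = 0) (x : U) :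
    TensorProduct.map (Ten.proj a) g (S.cm N (TensorAlgebra.ι k x)) =
      ∑ r ∈ Finset.range (K + 1), TensorProduct.map LinearMap.id g (S.c a r x) := by
  rw [cm_ι, Finset.sum_comm, map_sum,
    ← Finset.sum_subset (Finset.range_mono (show K + 1 ≤ N from hK))]
  · refine Finset.sum_congr rfl fun r _ => ?_
    rw [map_sum, Finset.sum_eq_single a]
    · exact Ten.map_congr_of_mem_len₂ (fun _ h => Ten.proj_of_mem h) (fun _ _ => rfl)
        (S.c_mem_len₂ a r x)
    · intro b _ hb
      exact Ten.map_eq_zero_of_mem_len₂ (Or.inl fun _ h => Ten.proj_of_mem_ne h hb)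
        (S.c_mem_len₂ b r x)
    · intro h; exact absurd (Finset.mem_range.2 ha) h
  · intro r _ hr
    rw [Finset.mem_range] at hr
    rw [map_sum]
    exact Finset.sum_eq_zero fun b _ => Ten.map_eq_zero_of_mem_len₂ (Or.inr (hg r (by omega)))
      (S.c_mem_len₂ b r x)

theorem map_proj_cm_ι {N a b : ℕ} (ha : a < N) (hb : b < N) (x : U) :
    TensorProduct.map (Ten.proj a) (Ten.proj b) (S.cm N (TensorAlgebra.ι k x)) = S.c a b x := by
  rw [S.map_proj_left_cm_ι _ hb ha (fun r hr x hx => Ten.proj_of_mem_ne hx (by omega)),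
    Finset.sum_eq_single b]
  · rw [Ten.map_congr_of_mem_len₂ (f' := LinearMap.id) (g' := LinearMap.id) (fun _ _ => rfl)
      (fun _ h => Ten.proj_of_mem h) (S.c_mem_len₂ a b x), TensorProduct.map_id]
    rfl
  · intro r _ hr
    exact Ten.map_eq_zero_of_mem_len₂ (Or.inr fun _ h => Ten.proj_of_mem_ne h hr)
        (S.c_mem_len₂ a r x)
  · intro h; simp at h

/-! ### Coassociativity -/

/-- On words longer than a + b the component (a, b) of the coproduct vanishes. So the truncation at
N contains all terms c_{r,e} that enter the left side of coassociativity. -/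
theorem assoc_cm_cm_component {N a b e : ℕ} (hab : a + b < N) (he : e < N) (x : U) :
    TensorProduct.map (Ten.proj a) (TensorProduct.map (Ten.proj b) (Ten.proj e))
      (TensorProduct.assoc k _ _ _ (TensorProduct.map (S.cm N) LinearMap.id
        (S.cm N (TensorAlgebra.ι k x)))) =
    TensorProduct.assoc k _ _ _ (∑ r ∈ Finset.range (a + b + 1),
      TensorProduct.map (comulExt S.c a b) LinearMap.id (S.c r e x)) := by
  rw [← S.map_proj_right_cm_ι _ hab he (fun r hr x hx => S.comulExt_eq_zero hr hx)]
  have h : comulExt S.c a b = TensorProduct.map (Ten.proj a) (Ten.proj b) ∘ₗ S.cm N :=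
    LinearMap.ext fun t => (S.comulExt_eq (by omega) (by omega) t).symm
  rw [h, TensorProduct.map_map_assoc, ← LinearMap.comp_apply (TensorProduct.map _ _),
    ← TensorProduct.map_comp, LinearMap.comp_id]

theorem cm_cm_component {N a b e : ℕ} (ha : a < N) (hbe : b + e < N) (x : U) :
    TensorProduct.map (Ten.proj a) (TensorProduct.map (Ten.proj b) (Ten.proj e))
      (TensorProduct.map LinearMap.id (S.cm N) (S.cm N (TensorAlgebra.ι k x))) =
    ∑ r ∈ Finset.range (b + e + 1),
      TensorProduct.map LinearMap.id (comulExt S.c b e) (S.c a r x) := by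
  rw [← S.map_proj_left_cm_ι _ hbe ha (fun r hr x hx => S.comulExt_eq_zero hr hx)]
  have h : comulExt S.c b e = TensorProduct.map (Ten.proj b) (Ten.proj e) ∘ₗ S.cm N :=
    LinearMap.ext fun t => (S.comulExt_eq (by omega) (by omega) t).symm
  rw [h, ← LinearMap.comp_apply (TensorProduct.map _ _), ← TensorProduct.map_comp,
    LinearMap.comp_id]

/-- An element of `TU ⊗ TU ⊗ TU` vanishes modulo terms of large length if its components do. -/
theorem map_mkQ_tproj_eq_zero {N : ℕ} {z : Ten U ⊗[k] (Ten U ⊗[k] Ten U)}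
    (h : ∀ a < N, ∀ b < N, ∀ e < N,
      TensorProduct.map (Ten.proj a) (TensorProduct.map (Ten.proj b) (Ten.proj e)) z = 0) :
    TensorProduct.map (Ten.fil U N).mkQ (tproj (Ten.fil U N) (Ten.fil U N)) z = 0 := by
  have e : (Ten.fil U N).mkQ = (Ten.fil U N).mkQ ∘ₗ ∑ r ∈ Finset.range N, Ten.proj r := by
    ext x : 1
    rw [LinearMap.comp_apply, LinearMap.sum_apply, ← sub_eq_zero, ← map_sub, Submodule.mkQ_apply,
      Submodule.Quotient.mk_eq_zero]
    exact Ten.sub_proj_mem N x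
  rw [tproj, e, TensorProduct.map_comp, TensorProduct.map_comp, LinearMap.comp_apply]
  have : TensorProduct.map (∑ r ∈ Finset.range N, Ten.proj r)
      (TensorProduct.map (∑ r ∈ Finset.range N, Ten.proj r)
        (∑ r ∈ Finset.range N, Ten.proj r)) z = 0 := by
    simp only [← TensorProduct.mapBilinear_apply, map_sum, LinearMap.sum_apply]
    simp only [TensorProduct.mapBilinear_apply]
    refine Finset.sum_eq_zero fun a ha => Finset.sum_eq_zero fun b hb =>
      Finset.sum_eq_zero fun e he => ?_
    apply h <;> simp_all
  rw [this, map_zero]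

/-- Coassociativity up to terms of large length. -/
theorem map_mkQ_tproj_coassoc (h : ∀ a b e x,
    TensorProduct.assoc k _ _ _ (∑ r ∈ Finset.range (a + b + 1),
      TensorProduct.map (comulExt S.c a b) LinearMap.id (S.c r e x)) =
    ∑ r ∈ Finset.range (b + e + 1), TensorProduct.map LinearMap.id (comulExt S.c b e) (S.c a r x))
    {N M : ℕ} (hM : 2 * N ≤ M) (t : Ten U) :
    TensorProduct.map (Ten.fil U N).mkQ (tproj (Ten.fil U N) (Ten.fil U N))
      (TensorProduct.assoc k _ _ _ (TensorProduct.map (S.cm M) LinearMap.id (S.cm M t))) =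
    TensorProduct.map (Ten.fil U N).mkQ (tproj (Ten.fil U N) (Ten.fil U N))
      (TensorProduct.map LinearMap.id (S.cm M) (S.cm M t)) := by
  -- The two composites are algebra maps into TU ⊗ (TU ⊗ TU), where the inner square is graded by
  -- total degree, so it suffices to compare them on generators modulo the ideal `I`. The bound 2N ≤
  -- M covers a + b and b + e for a, b, e < N.
  let F : Ten U →ₐ[k] Ten.deg U ᵍ⊗[k] tdeg (Ten.deg U) (Ten.deg U) :=
    (gassoc (Ten.deg U) (Ten.deg U) (Ten.deg U)).comp
      ((gmap (Ten.deg U) (Ten.deg U) (tdeg (Ten.deg U) (Ten.deg U)) (Ten.deg U) (S.comul M)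
        (AlgHom.id k _) (S.comul_mem_tdeg M) fun _ _ h => h).comp (S.comul M))
  let G : Ten U →ₐ[k] Ten.deg U ᵍ⊗[k] tdeg (Ten.deg U) (Ten.deg U) :=
    (gmap (Ten.deg U) (Ten.deg U) (Ten.deg U) (tdeg (Ten.deg U) (Ten.deg U)) (AlgHom.id k _)
      (S.comul M) (fun _ _ h => h) (S.comul_mem_tdeg M)).comp (S.comul M)
  let q : Ten.Sq U →ₗ[k] _ := tproj (Ten.fil U N) (Ten.fil U N) ∘ₗ
    (of k (Ten.deg U) (Ten.deg U)).symm.toLinearMap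
  let I : Submodule k (Ten.deg U ᵍ⊗[k] tdeg (Ten.deg U) (Ten.deg U)) :=
    LinearMap.ker (TensorProduct.map (Ten.fil U N).mkQ q ∘ₗ
      (of k (Ten.deg U) (tdeg (Ten.deg U) (Ten.deg U))).symm.toLinearMap)
  have hs := (Ten.fil U N).mkQ_surjective
  have hh : IsHomog (Ten.deg U) (LinearMap.ker (Ten.fil U N).mkQ) := by
    rw [Submodule.ker_mkQ]; exact Ten.isHomog_fil N
  have hi : IsIdeal (LinearMap.ker (Ten.fil U N).mkQ) := by
    rw [Submodule.ker_mkQ]; exact Ten.isIdeal_fil N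
  have hI : IsIdeal I := by
    -- The kernel of `q`, for the inner square, is a homogeneous ideal by the same lemmas.
    refine isIdeal_ker_map _ _ _ q hs ?_ hh ?_ hi ?_
    · exact (TensorProduct.map_surjective hs hs).comp
        (of k (Ten.deg U) (Ten.deg U)).symm.surjective
    · exact isHomog_ker_map _ _ _ _ hs hs hh hh
    · exact isIdeal_ker_map _ _ _ _ hs hs hh hh hi hi
  -- Graded and ordinary tensor products have the same underlying module; only identifications by
  -- `of` have to be removed.
  have hF : ∀ t, TensorProduct.assoc k _ _ _ (TensorProduct.map (S.cm M) LinearMap.id (S.cm M t)) =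
      (of k (Ten.deg U) (tdeg (Ten.deg U) (Ten.deg U))).symm (F t) := fun t => by
    have h₁ : ∀ z : Ten U ⊗[k] (Ten U ⊗[k] Ten U), TensorProduct.map LinearMap.id
        (of k (Ten.deg U) (Ten.deg U)).toLinearMap z = z :=
      fun z => LinearMap.congr_fun TensorProduct.map_id z
    have h₂ : ∀ z : (Ten U ⊗[k] Ten U) ⊗[k] Ten U, TensorProduct.map
        (of k (Ten.deg U) (Ten.deg U)).symm.toLinearMap LinearMap.id z = z :=
      fun z => LinearMap.congr_fun TensorProduct.map_id z
    exact ((h₁ _).trans (congrArg (TensorProduct.assoc k _ _ _) (h₂ _))).symm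
  have hG : ∀ t, TensorProduct.map LinearMap.id (S.cm M) (S.cm M t) =
      (of k (Ten.deg U) (tdeg (Ten.deg U) (Ten.deg U))).symm (G t) := fun t => rfl
  have hmem : ∀ t, F t - G t ∈ I ↔
      TensorProduct.map (Ten.fil U N).mkQ (tproj (Ten.fil U N) (Ten.fil U N))
        (TensorProduct.assoc k _ _ _ (TensorProduct.map (S.cm M) LinearMap.id (S.cm M t)) -
          TensorProduct.map LinearMap.id (S.cm M) (S.cm M t)) = 0 := fun t => by
    rw [hF, hG]; exact Iff.rfl
  have := sub_mem_of_ideal F G hI (fun x => ?_) t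
  · rwa [hmem, map_sub, sub_eq_zero] at this
  · rw [hmem]
    refine map_mkQ_tproj_eq_zero fun a ha b hb e he => ?_
    rw [map_sub, S.assoc_cm_cm_component (by omega) (by omega),
      S.cm_cm_component (by omega) (by omega), h, sub_self]

/-! ### The coproduct and the differential -/

/-- The differential `D ⊗ 1 + 1 ⊗ D` of `TU ⊗ TU`. -/
def D₂ (N : ℕ) : Ten U ⊗[k] Ten U →ₗ[k] Ten U ⊗[k] Ten U :=
  TensorProduct.map (S.D N) LinearMap.id + TensorProduct.map (parity (Ten.deg U)) (S.D N)

theorem cm_D_component {N a b : ℕ} (hN : a + b < N) (x : U) :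
    TensorProduct.map (Ten.proj a) (Ten.proj b) (S.cm N (S.D N (TensorAlgebra.ι k x))) =
      ∑ r ∈ Finset.range (a + b + 1), comulExt S.c a b (S.m r x) := by
  rw [S.comulExt_eq (by omega) (by omega), D_ι, map_sum,
    ← Finset.sum_subset (Finset.range_mono (show a + b + 1 ≤ N from hN))]
  intro r _ hr
  rw [Finset.mem_range] at hr
  exact S.comulExt_eq_zero (by omega) (S.m_mem_len r x)

/-- By `proj_D`, the length a part of D on TrU is the extension of m_{a+1-r} and is zero for r > a +
1. The sum over r ≤ a + 1 is the antidiagonal of a + 1, and similarly for b. -/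
theorem D₂_cm_component {N a b : ℕ} (hN : a + b + 1 < N) (x : U) :
    TensorProduct.map (Ten.proj a) (Ten.proj b) (S.D₂ N (S.cm N (TensorAlgebra.ι k x))) =
      ∑ p ∈ Finset.HasAntidiagonal.antidiagonal (a + 1),
        TensorProduct.map (derivExt (S.m p.2)) LinearMap.id (S.c p.1 b x) +
      ∑ p ∈ Finset.HasAntidiagonal.antidiagonal (b + 1),
        TensorProduct.map (parity (Ten.deg U)) (derivExt (S.m p.2)) (S.c a p.1 x) := by
  have hD : ∀ n, n + 1 < N → ∀ r > n + 1, ∀ x ∈ Ten.len U r, (Ten.proj n ∘ₗ S.D N) x = 0 := by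
    intro n hn r hr x hx
    rw [LinearMap.comp_apply, S.proj_D hn hx, if_neg (by omega)]
  have hσ : (Ten.proj a : Ten U →ₗ[k] _) ∘ₗ parity (Ten.deg U) = parity (Ten.deg U) ∘ₗ Ten.proj a :=
    LinearMap.ext (Ten.proj_parity a)
  rw [D₂, LinearMap.add_apply, map_add, TensorProduct.map_map, TensorProduct.map_map,
    LinearMap.comp_id, hσ,
    S.map_proj_right_cm_ι (Ten.proj a ∘ₗ S.D N) (K := a + 1) (by omega) (by omega)
      (hD a (by omega)),
    ← LinearMap.id_comp (Ten.proj b ∘ₗ S.D N), TensorProduct.map_comp, LinearMap.comp_apply,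
    S.map_proj_left_cm_ι (Ten.proj b ∘ₗ S.D N) (K := b + 1) (by omega) (by omega)
      (hD b (by omega)), Finset.Nat.sum_antidiagonal_eq_sum_range_succ_mk,
    Finset.Nat.sum_antidiagonal_eq_sum_range_succ_mk, map_sum]
  congr 1
  · refine Finset.sum_congr rfl fun r hr => ?_
    rw [Finset.mem_range] at hr
    refine Ten.map_congr_of_mem_len₂ (fun y hy => ?_) (fun _ _ => rfl) (S.c_mem_len₂ r b x)
    rw [LinearMap.comp_apply, S.proj_D (by omega) hy, if_pos (by omega)]
  · refine Finset.sum_congr rfl fun r hr => ?_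
    rw [Finset.mem_range] at hr
    rw [TensorProduct.map_map, LinearMap.comp_id, LinearMap.id_comp]
    refine Ten.map_congr_of_mem_len₂ (fun _ _ => rfl) (fun y hy => ?_) (S.c_mem_len₂ a r x)
    rw [LinearMap.comp_apply, S.proj_D (by omega) hy, if_pos (by omega)]

/-- The coproduct commutes with the differential up to terms of large length. -/
theorem tproj_cm_D (h : ∀ a b x,
    ∑ r ∈ Finset.range (a + b + 1), comulExt S.c a b (S.m r x) =
    ∑ p ∈ Finset.HasAntidiagonal.antidiagonal (a + 1),
      TensorProduct.map (derivExt (S.m p.2)) LinearMap.id (S.c p.1 b x) +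
    ∑ p ∈ Finset.HasAntidiagonal.antidiagonal (b + 1),
      TensorProduct.map (parity (Ten.deg U)) (derivExt (S.m p.2)) (S.c a p.1 x))
    {N M : ℕ} (hM : 2 * N ≤ M) (t : Ten U) :
    tproj (Ten.fil U N) (Ten.fil U N) (S.cm M (S.D M t)) =
      tproj (Ten.fil U N) (Ten.fil U N) (S.D₂ M (S.cm M t)) := by
  have hs := (Ten.fil U N).mkQ_surjective
  have hh : IsHomog (Ten.deg U) (LinearMap.ker (Ten.fil U N).mkQ) := by
    rw [Submodule.ker_mkQ]; exact Ten.isHomog_fil N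
  have hi : IsIdeal (LinearMap.ker (Ten.fil U N).mkQ) := by
    rw [Submodule.ker_mkQ]; exact Ten.isIdeal_fil N
  let dd : Ten.Sq U →ₗ[k] Ten.Sq U :=
    tmap (Ten.deg U) (Ten.deg U) (Ten.deg U) (Ten.deg U) (S.D M) LinearMap.id +
    tmap (Ten.deg U) (Ten.deg U) (Ten.deg U) (Ten.deg U) (parity (Ten.deg U)) (S.D M)
  have hd : ∀ x y, dd (x * y) = dd x * y + parity (tdeg (Ten.deg U) (Ten.deg U)) x * dd y := by
    intro x y
    simp only [dd, LinearMap.add_apply]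
    rw [tmap_deriv_left (Ten.deg U) (S.D_mem_deg M) (S.D_mul M),
      tmap_deriv_right (Ten.deg U) (S.D_mem_deg M) (S.D_mul M)]
    noncomm_ring
  -- The defect of compatibility is a derivation along the coproduct followed by the parity and the
  -- coproduct itself.
  let φ : Ten U →ₗ[k] Ten.Sq U :=
    (S.comul M).toLinearMap ∘ₗ S.D M - dd ∘ₗ (S.comul M).toLinearMap
  have hmem : ∀ t, φ t ∈ LinearMap.ker (TensorProduct.map (Ten.fil U N).mkQ (Ten.fil U N).mkQ ∘ₗ
      (of k (Ten.deg U) (Ten.deg U)).symm.toLinearMap) ↔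
      tproj (Ten.fil U N) (Ten.fil U N) (S.cm M (S.D M t) - S.D₂ M (S.cm M t)) = 0 :=
    fun t => Iff.rfl
  have := mem_of_leibniz (φ := φ) (F := (parityHom (tdeg (Ten.deg U) (Ten.deg U))).comp (S.comul M))
    (G := S.comul M) (fun x y => ?_) (isIdeal_ker_map (Ten.deg U) (Ten.deg U) _ _ hs hs hh hh hi hi)
    (fun x => ?_) t
  · rwa [hmem, map_sub, sub_eq_zero] at this
  · have hσ : S.comul M (parity (Ten.deg U) x) = parity (tdeg (Ten.deg U) (Ten.deg U))
        (S.comul M x) := map_parity _ _ (S.comul M).toLinearMap (S.comul_mem_tdeg M) x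
    simp only [φ, LinearMap.sub_apply, LinearMap.comp_apply, AlgHom.toLinearMap_apply, D_mul,
      map_mul, map_add, hd, AlgHom.comp_apply, parityHom_apply, hσ, sub_mul, mul_sub]
    abel
  · rw [hmem, Ten.tproj_eq_zero_iff]
    intro a ha b hb
    rw [map_sub, S.cm_D_component (by omega), S.D₂_cm_component (by omega), h, sub_self]

end Coop

end

end BInfty

namespace BInfty

noncomputable section

open GradedTensorProduct

variable {k : Type u} [Field k] {U : GrMod.{u, v} k}

/-! ### The algebra `ΠTU` -/

theorem PiT.coeff_one (r : ℕ) : PiT.coeff r (1 : PiT U) = if r = 0 then 1 else 0 :=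
  PowerSeries.coeff_one r

theorem PiT.coeff_mul (r : ℕ) (x y : PiT U) : PiT.coeff r (x * y) =
    ∑ p ∈ Finset.HasAntidiagonal.antidiagonal r, PiT.coeff p.1 x * PiT.coeff p.2 y :=
  PowerSeries.coeff_mul r x.1 y.1

theorem PiT.mk_mem_sub {n : ℤ} {f : PowerSeries (Ten U)}
    (hf : ∀ r, PowerSeries.coeff r f ∈ Ten.piece U r n) : f ∈ PiT.sub U := by
  refine ⟨DirectSum.of (fun n => PiT.deg₀ U n) n ⟨f, hf⟩, ?_⟩
  change DirectSum.coeAlgHom _ _ = _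
  rw [DirectSum.coeAlgHom_of]

instance (U : GrMod.{u, v} k) : SetLike.GradedMonoid (PiT.deg U) where
  one_mem r := by
    have h : SetLike.GradedMonoid (PiT.deg₀ U) := inferInstance
    exact h.one_mem r
  mul_mem i j f g hf hg r := by
    have h : SetLike.GradedMonoid (PiT.deg₀ U) := inferInstance
    exact h.mul_mem (gi := f.1) (gj := g.1) hf hg r

/-- Homogeneous parts can be read off coefficient by coefficient. So the sum of the `PiT.deg` is
direct although each of them is an infinite product. -/
theorem PiT.decompose_coeff (y : ⨁ n, PiT.deg U n) (r : ℕ) (n : ℤ) :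
    (DirectSum.decompose (Ten.deg U) (PiT.coeff r (DirectSum.coeLinearMap (PiT.deg U) y)) n :
      Ten U) = PiT.coeff r (y n : PiT U) := by
  induction y using DirectSum.induction_on with
  | zero => simp
  | add x y hx hy => simp [hx, hy]
  | of i x =>
    rw [← DirectSum.lof_eq_of k, DirectSum.coeLinearMap_lof]
    by_cases h : i = n
    · subst h
      rw [DirectSum.decompose_of_mem_same _ (x.2 r).2, DirectSum.lof_apply]
    · rw [DirectSum.decompose_of_mem_ne _ (x.2 r).2 h, DirectSum.lof_eq_of,
        DirectSum.of_eq_of_ne _ _ _ (Ne.symm h)]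
      simp

/-- Injectivity is seen on coefficients. Surjectivity holds because `PiT.sub` is by definition the
range of the direct sum. -/
theorem PiT.isInternal (U : GrMod.{u, v} k) : DirectSum.IsInternal (PiT.deg U) := by
  constructor
  · intro y z h
    refine DFinsupp.ext fun n => Subtype.ext (PiT.ext fun r => ?_)
    have h' : DirectSum.coeLinearMap (PiT.deg U) y = DirectSum.coeLinearMap (PiT.deg U) z := h
    rw [← PiT.decompose_coeff y, ← PiT.decompose_coeff z, h']
  · rintro ⟨_, y, rfl⟩
    induction y using DirectSum.induction_on with
    | zero => exact ⟨0, Subtype.ext (by rw [map_zero]; exact (map_zero _).symm)⟩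
    | add x y hx hy =>
      obtain ⟨x', hx'⟩ := hx
      obtain ⟨y', hy'⟩ := hy
      refine ⟨x' + y', ?_⟩
      rw [map_add, hx', hy']
      exact Subtype.ext (map_add _ _ _).symm
    | of n x =>
      have hx : DirectSum.coeAlgHom (PiT.deg₀ U)
          (DirectSum.of (fun n => PiT.deg₀ U n) n x) = x.1 :=
        DirectSum.coeAlgHom_of _ _ _
      refine ⟨DirectSum.of (fun n => PiT.deg U n) n ⟨⟨x.1, PiT.mk_mem_sub x.2⟩, x.2⟩, ?_⟩
      rw [DirectSum.coeAddMonoidHom_of]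
      exact Subtype.ext hx.symm

instance (U : GrMod.{u, v} k) : DirectSum.Decomposition (PiT.deg U) :=
  (PiT.isInternal U).chooseDecomposition

/-- `ΠTU` is a graded algebra. -/
instance (U : GrMod.{u, v} k) : GradedAlgebra (PiT.deg U) where

theorem PiT.coeff_mem_len (r : ℕ) (x : PiT U) : PiT.coeff r x ∈ Ten.len U r := by
  induction x using DirectSum.Decomposition.inductionOn (PiT.deg U) with
  | zero => rw [map_zero]; exact zero_mem _
  | homogeneous x => exact (x.2 r).1
  | add x y hx hy => rw [map_add]; exact add_mem hx hy

/-- A linear map of degree `s` into `ΠTU` is given by its components. -/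
def PiT.mkLin {M : Type*} [AddCommGroup M] [Module k M] (ℳ : ℤ → Submodule k M)
    [DirectSum.Decomposition ℳ] (s : ℤ) (φ : ℕ → M →ₗ[k] Ten U)
    (h : ∀ r n, ∀ x ∈ ℳ n, φ r x ∈ Ten.piece U r (n + s)) : M →ₗ[k] PiT U where
  toFun x := ⟨PowerSeries.mk fun r => φ r x, by
    induction x using DirectSum.Decomposition.inductionOn ℳ with
    | zero =>
      have : (PowerSeries.mk fun r => φ r 0) = 0 := by ext; simp
      rw [this]; exact zero_mem _
    | homogeneous x =>
      exact PiT.mk_mem_sub fun r => by rw [PowerSeries.coeff_mk]; exact h r _ _ x.2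
    | add x y hx hy =>
      have : (PowerSeries.mk fun r => φ r (x + y)) =
          (PowerSeries.mk fun r => φ r x) + PowerSeries.mk fun r => φ r y := by ext; simp
      rw [this]; exact add_mem hx hy⟩
  map_add' x y := Subtype.ext (by
    change _ = (PowerSeries.mk fun r => φ r x) + PowerSeries.mk fun r => φ r y
    ext; simp)
  map_smul' c x := Subtype.ext (by
    change _ = c • (PowerSeries.mk fun r => φ r x)
    ext; simp)

theorem PiT.coeff_mkLin {M : Type*} [AddCommGroup M] [Module k M] (ℳ : ℤ → Submodule k M)
    [DirectSum.Decomposition ℳ] (s : ℤ) (φ : ℕ → M →ₗ[k] Ten U)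
    (h : ∀ r n, ∀ x ∈ ℳ n, φ r x ∈ Ten.piece U r (n + s)) (r : ℕ) (x : M) :
    PiT.coeff r (PiT.mkLin ℳ s φ h x) = φ r x :=
  PowerSeries.coeff_mk r fun r => φ r x

theorem Ten.proj_mul (r : ℕ) (x y : Ten U) : Ten.proj r (x * y) =
    ∑ p ∈ Finset.HasAntidiagonal.antidiagonal r, Ten.proj p.1 x * Ten.proj p.2 y := by
  induction x using DirectSum.Decomposition.inductionOn (Ten.len U) with
  | zero => simp
  | add x y hx hy => simp only [add_mul, map_add, hx, hy, Finset.sum_add_distrib]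
  | @homogeneous a x =>
    rw [Ten.proj_mul_of_mem x.2]
    split_ifs with h
    · rw [Finset.sum_eq_single (a, r - a)]
      · rw [Ten.proj_of_mem x.2]
      · intro p hp hne
        rw [Finset.HasAntidiagonal.mem_antidiagonal] at hp
        rw [Ten.proj_of_mem_ne x.2 fun h => hne (Prod.ext h.symm (by simp; omega)), zero_mul]
      · intro h'; simp at h'; omega
    · refine (Finset.sum_eq_zero fun p hp => ?_).symm
      rw [Finset.HasAntidiagonal.mem_antidiagonal] at hp
      rw [Ten.proj_of_mem_ne x.2 (by omega), zero_mul]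

/-- The inclusion `TU → ΠTU`. -/
def PiT.incl (U : GrMod.{u, v} k) : Ten U →ₐ[k] PiT U :=
  AlgHom.ofLinearMap (PiT.mkLin (Ten.deg U) 0 Ten.proj fun r n x hx => by
      rw [add_zero]; exact Ten.proj_mem_piece r hx)
    (PiT.ext fun r => by
      rw [PiT.coeff_mkLin, PiT.coeff_one]
      split_ifs with h
      · subst h; exact Ten.proj_of_mem Ten.one_mem_len
      · exact Ten.proj_of_mem_ne Ten.one_mem_len (Ne.symm h))
    (fun x y => PiT.ext fun r => by
      rw [PiT.coeff_mul, PiT.coeff_mkLin, Ten.proj_mul]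
      simp only [PiT.coeff_mkLin])

theorem PiT.coeff_incl (r : ℕ) (t : Ten U) : PiT.coeff r (PiT.incl U t) = Ten.proj r t :=
  PiT.coeff_mkLin (Ten.deg U) 0 Ten.proj
    (fun r n x hx => by rw [add_zero]; exact Ten.proj_mem_piece r hx) r t

theorem PiT.fil_anti {N M : ℕ} (h : N ≤ M) : PiT.fil U M ≤ PiT.fil U N :=
  fun _ hx r hr => hx r (hr.trans_le h)

theorem PiT.isOpen_fil (N : ℕ) : IsOpen (PiT.fil U N : Set (PiT U)) :=
  fun _ hx => ⟨N, fun _ hy => add_mem hx hy⟩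

theorem PiT.exists_fil_le {I : Submodule k (PiT U)} (hI : IsOpen (I : Set (PiT U))) :
    ∃ N, PiT.fil U N ≤ I := by
  obtain ⟨N, hN⟩ := hI 0 (zero_mem I)
  exact ⟨N, fun x hx => by simpa using hN x hx⟩

theorem PiT.continuous_of_fil {W : GrMod.{u, v} k} (f : PiT U →ₗ[k] PiT W)
    (h : ∀ N, ∃ M, ∀ x ∈ PiT.fil U M, f x ∈ PiT.fil W N) : Continuous f := by
  refine ⟨fun s hs x hx => ?_⟩
  obtain ⟨N, hN⟩ := hs (f x) hx
  obtain ⟨M, hM⟩ := h N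
  refine ⟨M, fun y hy => ?_⟩
  rw [Set.mem_preimage, map_add]
  exact hN _ (hM y hy)

theorem PiT.isOpen_coset (N : ℕ) (x : PiT U) : IsOpen {y | y - x ∈ PiT.fil U N} := by
  intro y hy
  refine ⟨N, fun z hz => ?_⟩
  have : y + z - x = (y - x) + z := by abel
  rw [Set.mem_ofPred_eq, this]
  exact add_mem hy hz

instance (U : GrMod.{u, v} k) : IsTopologicalAddGroup (PiT U) where
  continuous_add := by
    refine ⟨fun s hs => isOpen_prod_iff.2 fun x y hxy => ?_⟩
    obtain ⟨N, hN⟩ := hs (x + y) hxy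
    refine ⟨_, _, PiT.isOpen_coset N x, PiT.isOpen_coset N y, by simp, by simp, ?_⟩
    rintro ⟨x', y'⟩ ⟨hx, hy⟩
    have := hN _ (add_mem (show x' - x ∈ PiT.fil U N from hx) (show y' - y ∈ PiT.fil U N from hy))
    rw [Set.mem_preimage]
    convert this using 1
    abel
  continuous_neg := by
    refine ⟨fun s hs x hx => ?_⟩
    obtain ⟨N, hN⟩ := hs (-x) hx
    refine ⟨N, fun y hy => ?_⟩
    rw [Set.mem_preimage, neg_add]
    exact hN _ (neg_mem hy)

theorem PiT.isIdeal_fil (N : ℕ) : IsIdeal (PiT.fil U N) := by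
  intro a x hx
  constructor <;> intro r hr <;> rw [PiT.coeff_mul] <;> refine Finset.sum_eq_zero fun p hp => ?_ <;>
    rw [Finset.HasAntidiagonal.mem_antidiagonal] at hp
  · rw [hx p.2 (by omega), mul_zero]
  · rw [hx p.1 (by omega), zero_mul]

/-! ### Presentations of topological algebras -/

/-- An isomorphism of `ΠTU` with a topological graded algebra. -/
structure Chart (U : GrMod.{u, v} k) {A : Type*} [Ring A] [Algebra k A] [TopologicalSpace A]
    (gr : ℤ → Submodule k A) where
  e : PiT U ≃ₐ[k] A
  cont : Continuous e
  symm_cont : Continuous e.symm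
  mem_gr : ∀ n x, e x ∈ gr n ↔ x ∈ PiT.deg U n

/-- The identical presentation of `ΠTU`. -/
def Chart.refl (U : GrMod.{u, v} k) : Chart U (PiT.deg U) where
  e := AlgEquiv.refl
  cont := continuous_id
  symm_cont := continuous_id
  mem_gr _ _ := Iff.rfl

namespace Chart

variable {A : Type*} [Ring A] [Algebra k A] [TopologicalSpace A] {gr : ℤ → Submodule k A}
variable (Φ : Chart U gr)

/-- The map `TU → A`. -/
def j : Ten U →ₐ[k] A := Φ.e.toAlgHom.comp (PiT.incl U)

/-- The component of an element of `A` in `TʳU`. -/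
def cf (r : ℕ) : A →ₗ[k] Ten U := PiT.coeff r ∘ₗ Φ.e.symm.toLinearMap

/-- The open ideals of `A` that correspond to `∏_{r ≥ N} TʳU`. -/
def fil (N : ℕ) : OpenSub k A :=
  ⟨(PiT.fil U N).comap Φ.e.symm.toLinearMap, (PiT.isOpen_fil N).preimage Φ.symm_cont⟩

/-- The sum of the components of length less than `N`. -/
def trunc (N : ℕ) : A →ₗ[k] Ten U := ∑ r ∈ Finset.range N, Φ.cf r

theorem cf_e (r : ℕ) (x : PiT U) : Φ.cf r (Φ.e x) = PiT.coeff r x := by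
  change PiT.coeff r (Φ.e.symm (Φ.e x)) = _
  rw [AlgEquiv.symm_apply_apply]

theorem cf_j (r : ℕ) (t : Ten U) : Φ.cf r (Φ.j t) = Ten.proj r t := by
  rw [← PiT.coeff_incl]; exact Φ.cf_e r _

theorem cf_mem_len (r : ℕ) (x : A) : Φ.cf r x ∈ Ten.len U r := PiT.coeff_mem_len r _

theorem mem_fil {N : ℕ} {x : A} : x ∈ (Φ.fil N).1 ↔ ∀ r < N, Φ.cf r x = 0 := Iff.rfl

theorem ext {x y : A} (h : ∀ r, Φ.cf r x = Φ.cf r y) : x = y :=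
  Φ.e.symm.injective (PiT.ext h)

theorem fil_anti {N M : ℕ} (h : N ≤ M) : (Φ.fil M).1 ≤ (Φ.fil N).1 :=
  fun _ hx => PiT.fil_anti h hx

theorem exists_fil_le (I : OpenSub k A) : ∃ N, (Φ.fil N).1 ≤ I.1 := by
  obtain ⟨N, hN⟩ := PiT.exists_fil_le (I := I.1.comap Φ.e.toLinearMap) (I.2.preimage Φ.cont)
  refine ⟨N, fun x hx => ?_⟩
  have := hN hx
  simpa using this

theorem exists_fil_le_inf (n : ℕ)
    (I J : OpenSub k A) : ∃ N ≥ n, (Φ.fil N).1 ≤ I.1 ∧ (Φ.fil N).1 ≤ J.1 := by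
  obtain ⟨N₁, h₁⟩ := Φ.exists_fil_le I
  obtain ⟨N₂, h₂⟩ := Φ.exists_fil_le J
  exact ⟨max n (max N₁ N₂), le_max_left _ _,
    (Φ.fil_anti ((le_max_left _ _).trans (le_max_right _ _))).trans h₁,
    (Φ.fil_anti ((le_max_right _ _).trans (le_max_right _ _))).trans h₂⟩

theorem isIdeal_fil (N : ℕ) : IsIdeal (Φ.fil N).1 := by
  intro a x hx
  have := PiT.isIdeal_fil N (Φ.e.symm a) (Φ.e.symm x) hx
  rwa [← map_mul, ← map_mul] at this

theorem cf_j_trunc {N r : ℕ} (hr : r < N) (x : A) : Φ.cf r (Φ.j (Φ.trunc N x)) = Φ.cf r x := by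
  rw [cf_j, trunc, LinearMap.sum_apply, map_sum, Finset.sum_eq_single r]
  · exact Ten.proj_of_mem (Φ.cf_mem_len r x)
  · intro q _ hq; exact Ten.proj_of_mem_ne (Φ.cf_mem_len q x) hq
  · intro h; exact absurd (Finset.mem_range.2 hr) h

/-- A quantitative form of the density of TU; it allows every statement modulo an open subspace to
be checked on TU. -/
theorem sub_j_trunc_mem (N : ℕ) (x : A) : x - Φ.j (Φ.trunc N x) ∈ (Φ.fil N).1 := by
  rw [mem_fil]
  intro r hr
  rw [map_sub, Φ.cf_j_trunc hr, sub_self]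

theorem j_mem_fil {N : ℕ} {t : Ten U} : Φ.j t ∈ (Φ.fil N).1 ↔ t ∈ Ten.fil U N := by
  simp only [mem_fil, cf_j, Ten.mem_fil]

theorem mem_gr_iff {n : ℤ} {x : A} : x ∈ gr n ↔ ∀ r, Φ.cf r x ∈ Ten.piece U r n := by
  have := Φ.mem_gr n (Φ.e.symm x)
  rw [AlgEquiv.apply_symm_apply] at this
  exact this

theorem j_mem_gr (n : ℤ) (t : Ten U) (ht : t ∈ Ten.deg U n) : Φ.j t ∈ gr n := by
  rw [Φ.mem_gr_iff]
  intro r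
  rw [cf_j]; exact Ten.proj_mem_piece r ht

theorem trunc_mem_deg (N : ℕ) {n : ℤ} {x : A} (hx : x ∈ gr n) : Φ.trunc N x ∈ Ten.deg U n := by
  rw [trunc, LinearMap.sum_apply]
  exact Submodule.sum_mem _ fun r _ => (Φ.mem_gr_iff.1 hx r).2

/-- The truncations of `x` and of `y` agree up to terms of large length if `x` and `y` do. -/
theorem trunc_sub_mem {N M M' : ℕ} (hM : N ≤ M) (hM' : N ≤ M') {x y : A}
    (h : x - y ∈ (Φ.fil N).1) : Φ.trunc M x - Φ.trunc M' y ∈ Ten.fil U N := by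
  rw [← Φ.j_mem_fil, map_sub]
  have h₁ := Φ.fil_anti hM (Φ.sub_j_trunc_mem M x)
  have h₂ := Φ.fil_anti hM' (Φ.sub_j_trunc_mem M' y)
  have := add_mem (sub_mem h h₁) h₂
  convert this using 1
  abel

/-- Two linear maps that agree on `TU` and vanish on a neighbourhood of `0` agree. -/
theorem eq_of_fil {M : Type*} [AddCommGroup M] [Module k M] {f g : A →ₗ[k] M} (N : ℕ)
    (hf : ∀ x ∈ (Φ.fil N).1, f x = 0) (hg : ∀ x ∈ (Φ.fil N).1, g x = 0)
    (h : ∀ t, f (Φ.j t) = g (Φ.j t)) (x : A) : f x = g x := by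
  have h₁ := hf _ (Φ.sub_j_trunc_mem N x)
  have h₂ := hg _ (Φ.sub_j_trunc_mem N x)
  rw [map_sub, sub_eq_zero] at h₁ h₂
  rw [h₁, h₂, h]

section Homog

variable [GradedAlgebra gr]

theorem cf_decompose (r : ℕ) (x : A) (n : ℤ) : Φ.cf r (DirectSum.decompose gr x n : A) =
    DirectSum.decompose (Ten.deg U) (Φ.cf r x) n :=
  (decompose_map gr (Ten.deg U) (Φ.cf r) (fun _ _ h => (Φ.mem_gr_iff.1 h r).2) x n).symm

theorem isHomog_fil (N : ℕ) : IsHomog gr (Φ.fil N).1 := by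
  intro x hx n
  rw [mem_fil] at hx ⊢
  intro r hr
  rw [cf_decompose, hx r hr]
  simp

theorem j_parity (t : Ten U) : Φ.j (parity (Ten.deg U) t) = parity gr (Φ.j t) :=
  map_parity (Ten.deg U) gr Φ.j.toLinearMap Φ.j_mem_gr t

/-- The algebra map `TU ⊗ TU → A ⊗ A`. -/
def j₂ : Ten.Sq U →ₐ[k] gr ᵍ⊗[k] gr :=
  gmap (Ten.deg U) (Ten.deg U) gr gr Φ.j Φ.j Φ.j_mem_gr Φ.j_mem_gr

end Homog

theorem mkQ_comp_j {N : ℕ} {I : OpenSub k A} (hI : (Φ.fil N).1 ≤ I.1) :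
    I.1.mkQ ∘ₗ Φ.j.toLinearMap = (Ten.fil U N).liftQ (I.1.mkQ ∘ₗ Φ.j.toLinearMap) (fun t ht => by
      rw [LinearMap.mem_ker, LinearMap.comp_apply, Submodule.mkQ_apply,
        Submodule.Quotient.mk_eq_zero]
      exact hI (Φ.j_mem_fil.2 ht)) ∘ₗ (Ten.fil U N).mkQ := by
  rw [Submodule.liftQ_mkQ]

/-- Elements of `TU ⊗ TU` which agree up to terms of large length have the same image in
`(A/I) ⊗ (A/J)`. -/
theorem tproj_j_congr {N : ℕ} {I J : OpenSub k A} (hI : (Φ.fil N).1 ≤ I.1) (hJ : (Φ.fil N).1 ≤ J.1)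
    {z w : Ten U ⊗[k] Ten U}
    (h : tproj (Ten.fil U N) (Ten.fil U N) z = tproj (Ten.fil U N) (Ten.fil U N) w) :
    tproj I.1 J.1 (TensorProduct.map Φ.j.toLinearMap Φ.j.toLinearMap z) =
      tproj I.1 J.1 (TensorProduct.map Φ.j.toLinearMap Φ.j.toLinearMap w) := by
  rw [tproj, TensorProduct.map_map, TensorProduct.map_map, Φ.mkQ_comp_j hI, Φ.mkQ_comp_j hJ,
    TensorProduct.map_comp, LinearMap.comp_apply, LinearMap.comp_apply]
  exact congrArg _ h

/-- The analogue of `tproj_j_congr` for three factors, needed for coassociativity. -/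
theorem map_mkQ_j_congr {N : ℕ} {I J K : OpenSub k A} (hI : (Φ.fil N).1 ≤ I.1)
    (hJ : (Φ.fil N).1 ≤ J.1) (hK : (Φ.fil N).1 ≤ K.1) {z w : Ten U ⊗[k] (Ten U ⊗[k] Ten U)}
    (h : TensorProduct.map (Ten.fil U N).mkQ (tproj (Ten.fil U N) (Ten.fil U N)) z =
      TensorProduct.map (Ten.fil U N).mkQ (tproj (Ten.fil U N) (Ten.fil U N)) w) :
    TensorProduct.map (I.1.mkQ ∘ₗ Φ.j.toLinearMap) (TensorProduct.map
      (J.1.mkQ ∘ₗ Φ.j.toLinearMap) (K.1.mkQ ∘ₗ Φ.j.toLinearMap)) z =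
    TensorProduct.map (I.1.mkQ ∘ₗ Φ.j.toLinearMap) (TensorProduct.map
      (J.1.mkQ ∘ₗ Φ.j.toLinearMap) (K.1.mkQ ∘ₗ Φ.j.toLinearMap)) w := by
  rw [Φ.mkQ_comp_j hI, Φ.mkQ_comp_j hJ, Φ.mkQ_comp_j hK, TensorProduct.map_comp,
    TensorProduct.map_comp, LinearMap.comp_apply, LinearMap.comp_apply]
  exact congrArg _ h

/-- The component map `A/I → TᵃU`, where `I = ∏_{r ≥ N} TʳU` and `a < N`. -/
def cfQ {N a : ℕ} (ha : a < N) : (A ⧸ (Φ.fil N).1) →ₗ[k] Ten U :=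
  (Φ.fil N).1.liftQ (Φ.cf a) fun _ hx => Φ.mem_fil.1 hx a ha

theorem cfQ_mkQ {N a : ℕ} (ha : a < N) : Φ.cfQ ha ∘ₗ (Φ.fil N).1.mkQ = Φ.cf a :=
  Submodule.liftQ_mkQ _ _ _

theorem cf_comp_j (a : ℕ) : Φ.cf a ∘ₗ Φ.j.toLinearMap = Ten.proj a :=
  LinearMap.ext (Φ.cf_j a)

theorem map_cfQ_tproj {N a b : ℕ} (ha : a < N) (hb : b < N) (x : A ⊗[k] A) :
    TensorProduct.map (Φ.cfQ ha) (Φ.cfQ hb) (tproj (Φ.fil N).1 (Φ.fil N).1 x) =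
      TensorProduct.map (Φ.cf a) (Φ.cf b) x := by
  rw [tproj, TensorProduct.map_map, cfQ_mkQ, cfQ_mkQ]

theorem map_cfQ_tproj_j {N a b : ℕ} (ha : a < N) (hb : b < N) (z : Ten U ⊗[k] Ten U) :
    TensorProduct.map (Φ.cfQ ha) (Φ.cfQ hb) (tproj (Φ.fil N).1 (Φ.fil N).1
      (TensorProduct.map Φ.j.toLinearMap Φ.j.toLinearMap z)) =
      TensorProduct.map (Ten.proj a) (Ten.proj b) z := by
  rw [map_cfQ_tproj, TensorProduct.map_map, cf_comp_j, cf_comp_j]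

/-- Elements of `(A/I) ⊗ (A/I)`, where `I = ∏_{r ≥ N} TʳU`, are determined by their components. -/
theorem eq_of_map_cfQ {N : ℕ} {x y : (A ⧸ (Φ.fil N).1) ⊗[k] (A ⧸ (Φ.fil N).1)}
    (h : ∀ a (ha : a < N) b (hb : b < N), TensorProduct.map (Φ.cfQ ha) (Φ.cfQ hb) x =
      TensorProduct.map (Φ.cfQ ha) (Φ.cfQ hb) y) : x = y := by
  -- The identity of the quotient is the finite sum of its component projections, so an element of
  -- the tensor square is a sum of lifts of its components.
  have hid : (LinearMap.id : (A ⧸ (Φ.fil N).1) →ₗ[k] _) =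
      ∑ a : Fin N, (Φ.fil N).1.mkQ ∘ₗ Φ.j.toLinearMap ∘ₗ Φ.cfQ a.2 := by
    refine Submodule.linearMap_qext _ (LinearMap.ext fun x => ?_)
    have := Φ.sub_j_trunc_mem N x
    rw [← Submodule.Quotient.mk_eq_zero, Submodule.Quotient.mk_sub, sub_eq_zero] at this
    rw [LinearMap.id_comp, Submodule.mkQ_apply, this, trunc, ← Fin.sum_univ_eq_sum_range]
    simp only [LinearMap.sum_apply, map_sum, LinearMap.comp_apply, cfQ, ← Submodule.mkQ_apply]
    rfl
  have hz : ∀ z : (A ⧸ (Φ.fil N).1) ⊗[k] (A ⧸ (Φ.fil N).1), z = ∑ a : Fin N, ∑ b : Fin N,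
      TensorProduct.map ((Φ.fil N).1.mkQ ∘ₗ Φ.j.toLinearMap) ((Φ.fil N).1.mkQ ∘ₗ Φ.j.toLinearMap)
        (TensorProduct.map (Φ.cfQ a.2) (Φ.cfQ b.2) z) := by
    intro z
    have : z = TensorProduct.map LinearMap.id LinearMap.id z := by
      rw [TensorProduct.map_id]; rfl
    rw [hid, ← TensorProduct.mapBilinear_apply] at this
    simp only [map_sum, LinearMap.sum_apply, TensorProduct.mapBilinear_apply] at this
    simp only [TensorProduct.map_map]
    exact this.trans (Finset.sum_comm.trans rfl)
  rw [hz x, hz y]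
  simp only [h]

end Chart

end

end BInfty

namespace BInfty

noncomputable section

open GradedTensorProduct

variable {k : Type u} [Field k] {U : GrMod.{u, v} k}

/-! ### Coproducts with values in the completed tensor square -/

section CTensor

variable {A : Type*} [Ring A] [Algebra k A] [TopologicalSpace A] {gr : ℤ → Submodule k A}

/-- The component `A → (A/I) ⊗ (A/J)` of a coproduct. -/
abbrev compΔ (Δ : A →ₗ[k] CTensor k A) (I J : OpenSub k A) :
    A →ₗ[k] (A ⧸ I.1) ⊗[k] (A ⧸ J.1) :=
  LinearMap.proj J ∘ₗ LinearMap.proj I ∘ₗ (CTensor k A).subtype ∘ₗ Δ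

theorem factor_compΔ (Δ : A →ₗ[k] CTensor k A) {I I' J J' : OpenSub k A} (hI : I.1 ≤ I'.1)
    (hJ : J.1 ≤ J'.1) (a : A) :
    TensorProduct.map (Submodule.factor hI) (Submodule.factor hJ) (compΔ Δ I J a) =
      compΔ Δ I' J' a := (Δ a).2 I I' J J' hI hJ

theorem factor_tproj {A : Type*} [AddCommGroup A] [Module k A] {I I' J J' : Submodule k A}
    (hI : I ≤ I') (hJ : J ≤ J') (x : A ⊗[k] A) :
    TensorProduct.map (Submodule.factor hI) (Submodule.factor hJ) (tproj I J x) =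
      tproj I' J' x := by
  rw [tproj, TensorProduct.map_map]; rfl

namespace Chart

variable (Φ : Chart U gr) (S : Coop U)

/-- The coproduct `Δ` is given by the cooperations `S`. -/
def HasComul (Δ : A →ₗ[k] CTensor k A) : Prop :=
  ∀ (N : ℕ) (I J : OpenSub k A), (Φ.fil N).1 ≤ I.1 → (Φ.fil N).1 ≤ J.1 → ∀ t,
    compΔ Δ I J (Φ.j t) =
      tproj I.1 J.1 (TensorProduct.map Φ.j.toLinearMap Φ.j.toLinearMap (S.cm N t))

/-- The differential `d` is given by the cooperations `S`. -/
def HasDeriv (d : A →ₗ[k] A) : Prop := ∀ N t, d (Φ.j t) - Φ.j (S.D N t) ∈ (Φ.fil N).1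

variable {Φ S}

theorem HasDeriv.mkQ_comp {d : A →ₗ[k] A} (hd : Φ.HasDeriv S d) {N : ℕ} {I : OpenSub k A}
    (hI : (Φ.fil N).1 ≤ I.1) :
    I.1.mkQ ∘ₗ d ∘ₗ Φ.j.toLinearMap = I.1.mkQ ∘ₗ Φ.j.toLinearMap ∘ₗ S.D N := by
  refine LinearMap.ext fun t => ?_
  rw [← sub_eq_zero]
  simp only [LinearMap.comp_apply]
  rw [← map_sub, Submodule.mkQ_apply, Submodule.Quotient.mk_eq_zero]
  exact hI (hd N t)

/-- On TU, d and `D N` agree modulo `I` and `J`, and the inclusion of TU commutes with the parity.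
-/
theorem HasDeriv.tproj_D₂ [GradedAlgebra gr] {d : A →ₗ[k] A} (hd : Φ.HasDeriv S d) {N : ℕ}
    {I J : OpenSub k A} (hI : (Φ.fil N).1 ≤ I.1) (hJ : (Φ.fil N).1 ≤ J.1)
    (z : Ten U ⊗[k] Ten U) :
    tproj I.1 J.1 (TensorProduct.map d LinearMap.id
      (TensorProduct.map Φ.j.toLinearMap Φ.j.toLinearMap z) + TensorProduct.map (parity gr) d
      (TensorProduct.map Φ.j.toLinearMap Φ.j.toLinearMap z)) =
    tproj I.1 J.1 (TensorProduct.map Φ.j.toLinearMap Φ.j.toLinearMap (S.D₂ N z)) := by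
  have hσ : parity gr ∘ₗ Φ.j.toLinearMap = Φ.j.toLinearMap ∘ₗ parity (Ten.deg U) :=
    LinearMap.ext fun t => (Φ.j_parity t).symm
  rw [Coop.D₂, LinearMap.add_apply, map_add, map_add, map_add, tproj]
  simp only [TensorProduct.map_map]
  rw [hd.mkQ_comp hI, hd.mkQ_comp hJ, hσ]
  rfl

/-- For N so large that `fil N` also lies in the kernel `L` of the inner coproduct, both coproducts
may be replaced by `cm N`. The equation for `L` fits any proof that this kernel is open. -/
theorem HasComul.coassoc_left {Δ : A →ₗ[k] CTensor k A} (hΔ : Φ.HasComul S Δ)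
    {I J K L : OpenSub k A} (hL : L.1 = LinearMap.ker (compΔ Δ I J)) {N : ℕ}
    (hI : (Φ.fil N).1 ≤ I.1) (hJ : (Φ.fil N).1 ≤ J.1) (hK : (Φ.fil N).1 ≤ K.1)
    (hN : (Φ.fil N).1 ≤ L.1) (t : Ten U) :
    TensorProduct.assoc k _ _ _ (TensorProduct.map (Submodule.liftQ _ (compΔ Δ I J) hL.le)
      LinearMap.id (compΔ Δ L K (Φ.j t))) =
    TensorProduct.map (I.1.mkQ ∘ₗ Φ.j.toLinearMap) (TensorProduct.map
      (J.1.mkQ ∘ₗ Φ.j.toLinearMap) (K.1.mkQ ∘ₗ Φ.j.toLinearMap))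
      (TensorProduct.assoc k _ _ _ (TensorProduct.map (S.cm N) LinearMap.id (S.cm N t))) := by
  have hc : compΔ Δ I J ∘ₗ Φ.j.toLinearMap = TensorProduct.map (I.1.mkQ ∘ₗ Φ.j.toLinearMap)
      (J.1.mkQ ∘ₗ Φ.j.toLinearMap) ∘ₗ S.cm N := by
    refine LinearMap.ext fun t => (hΔ N I J hI hJ t).trans ?_
    rw [tproj, TensorProduct.map_map]; rfl
  rw [hΔ N L K hN hK, tproj, TensorProduct.map_map, TensorProduct.map_map, Submodule.liftQ_mkQ,
    LinearMap.id_comp, hc, TensorProduct.map_map_assoc, TensorProduct.map_map, LinearMap.comp_id]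

theorem HasComul.coassoc_right {Δ : A →ₗ[k] CTensor k A} (hΔ : Φ.HasComul S Δ)
    {I J K L : OpenSub k A} (hL : L.1 = LinearMap.ker (compΔ Δ J K)) {N : ℕ}
    (hI : (Φ.fil N).1 ≤ I.1) (hJ : (Φ.fil N).1 ≤ J.1) (hK : (Φ.fil N).1 ≤ K.1)
    (hN : (Φ.fil N).1 ≤ L.1) (t : Ten U) :
    TensorProduct.map LinearMap.id (Submodule.liftQ _ (compΔ Δ J K) hL.le)
      (compΔ Δ I L (Φ.j t)) =
    TensorProduct.map (I.1.mkQ ∘ₗ Φ.j.toLinearMap) (TensorProduct.map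
      (J.1.mkQ ∘ₗ Φ.j.toLinearMap) (K.1.mkQ ∘ₗ Φ.j.toLinearMap))
      (TensorProduct.map LinearMap.id (S.cm N) (S.cm N t)) := by
  have hc : compΔ Δ J K ∘ₗ Φ.j.toLinearMap = TensorProduct.map (J.1.mkQ ∘ₗ Φ.j.toLinearMap)
      (K.1.mkQ ∘ₗ Φ.j.toLinearMap) ∘ₗ S.cm N := by
    refine LinearMap.ext fun t => (hΔ N J K hJ hK t).trans ?_
    rw [tproj, TensorProduct.map_map]; rfl
  rw [hΔ N I L hI hN, tproj, TensorProduct.map_map, TensorProduct.map_map, Submodule.liftQ_mkQ,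
    LinearMap.id_comp, hc, TensorProduct.map_map, LinearMap.comp_id]

theorem cfQ_factor (Φ : Chart U gr) {N M a : ℕ} (ha : a < N) (h : N ≤ M) :
    Φ.cfQ ha ∘ₗ Submodule.factor (Φ.fil_anti h) = Φ.cfQ (ha.trans_le h) :=
  Submodule.linearMap_qext _ (LinearMap.ext fun _ => rfl)

theorem map_cfQ_compΔ (Φ : Chart U gr) (Δ : A →ₗ[k] CTensor k A) {N M a b : ℕ} (ha : a < N)
    (hb : b < N) (h : N ≤ M) (x : A) :
    TensorProduct.map (Φ.cfQ (ha.trans_le h)) (Φ.cfQ (hb.trans_le h))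
      (compΔ Δ (Φ.fil M) (Φ.fil M) x) =
    TensorProduct.map (Φ.cfQ ha) (Φ.cfQ hb) (compΔ Δ (Φ.fil N) (Φ.fil N) x) := by
  rw [← factor_compΔ Δ (Φ.fil_anti h) (Φ.fil_anti h), TensorProduct.map_map,
    Φ.cfQ_factor ha h, Φ.cfQ_factor hb h]

end Chart

end CTensor

/-! ### The cooperations of a bialgebra -/

namespace Chart

variable {B : TopDGBialg.{u, w} k} (Φ : Chart U B.gr)

/-- The component of the differential in `TʳU`. -/
def opM (r : ℕ) : U →ₗ[k] Ten U := Φ.cf r ∘ₗ B.d ∘ₗ Φ.j.toLinearMap ∘ₗ TensorAlgebra.ι k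

/-- The component of the coproduct in `TᵃU ⊗ TᵇU`. -/
def opC (a b : ℕ) : U →ₗ[k] Ten U ⊗[k] Ten U :=
  TensorProduct.map (Φ.cfQ (show a < a + b + 1 by omega)) (Φ.cfQ (show b < a + b + 1 by omega)) ∘ₗ
    compΔ B.Δ (Φ.fil (a + b + 1)) (Φ.fil (a + b + 1)) ∘ₗ Φ.j.toLinearMap ∘ₗ TensorAlgebra.ι k

/-- The level a + b + 1 in `opC` is only a choice: the components at any two levels are those at
their maximum. -/
theorem map_cfQ_Δ {N a b : ℕ} (ha : a < N) (hb : b < N) (x : U) :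
    TensorProduct.map (Φ.cfQ ha) (Φ.cfQ hb)
      (compΔ B.Δ (Φ.fil N) (Φ.fil N) (Φ.j (TensorAlgebra.ι k x))) = Φ.opC a b x := by
  have h₁ := Φ.map_cfQ_compΔ B.Δ ha hb (le_max_left N (a + b + 1)) (Φ.j (TensorAlgebra.ι k x))
  have h₂ := Φ.map_cfQ_compΔ B.Δ (show a < a + b + 1 by omega) (show b < a + b + 1 by omega)
    (le_max_right N (a + b + 1)) (Φ.j (TensorAlgebra.ι k x))
  exact h₁.symm.trans h₂

theorem map_eq_tmul_lid {M N : Type*} [AddCommGroup M] [Module k M] [AddCommGroup N]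
    [Module k N] (f : k →ₗ[k] N) (g : M →ₗ[k] N) (z : k ⊗[k] M) :
    TensorProduct.map f g z = f 1 ⊗ₜ[k] g (TensorProduct.lid k M z) := by
  induction z using TensorProduct.induction_on with
  | zero => simp
  | add x y hx hy => simp only [map_add, TensorProduct.tmul_add, hx, hy]
  | tmul c m =>
    have : f c = c • f 1 := by rw [← map_smul, smul_eq_mul, mul_one]
    simp [this, TensorProduct.smul_tmul']

theorem map_eq_tmul_rid {M N : Type*} [AddCommGroup M] [Module k M] [AddCommGroup N]
    [Module k N] (f : k →ₗ[k] N) (g : M →ₗ[k] N) (z : M ⊗[k] k) :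
    TensorProduct.map g f z = g (TensorProduct.rid k M z) ⊗ₜ[k] f 1 := by
  induction z using TensorProduct.induction_on with
  | zero => simp
  | add x y hx hy => simp only [map_add, TensorProduct.add_tmul, hx, hy]
  | tmul m c =>
    have : f c = c • f 1 := by rw [← map_smul, smul_eq_mul, mul_one]
    simp [this, TensorProduct.smul_tmul']

theorem fil_le_ker_ε (hε : ∀ x, algebraMap k (Ten U) (B.ε x) = Φ.cf 0 x) {N : ℕ} (hN : 0 < N) :
    (Φ.fil N).1 ≤ LinearMap.ker B.ε.toLinearMap := by
  intro x hx
  have h : algebraMap k (Ten U) (B.ε x) = 0 := by rw [hε]; exact Φ.mem_fil.1 hx 0 hN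
  rwa [TensorAlgebra.algebraMap_eq_zero_iff] at h

end Chart

end

end BInfty

/-! ### From a bialgebra to the identities of a coalgebra -/

namespace BInfty

noncomputable section

open GradedTensorProduct

variable {k : Type u} [Field k] {U : GrMod.{u, v} k}

namespace Chart

variable {B : TopDGBialg.{u, w} k} (Φ : Chart U B.gr)

/-- The component in T⁰U is the counit, hence factors through A/ker ε, the quotient in which the
counit axioms are stated. -/
theorem cfQ_zero (hε : ∀ x, algebraMap k (Ten U) (B.ε x) = Φ.cf 0 x) {N : ℕ} (hN : 0 < N) :
    Φ.cfQ hN = (Algebra.linearMap k (Ten U) ∘ₗ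
      (LinearMap.ker B.ε.toLinearMap).liftQ B.ε.toLinearMap le_rfl) ∘ₗ
        Submodule.factor (Φ.fil_le_ker_ε hε hN) :=
  Submodule.linearMap_qext _ (LinearMap.ext fun x => (hε x).symm)

theorem map_ε_left {M : Type*} [AddCommGroup M] [Module k M] (J : OpenSub k B.A)
    (f : k →ₗ[k] M) (g : (B.A ⧸ J.1) →ₗ[k] M) (a : B.A) :
    TensorProduct.map (f ∘ₗ (LinearMap.ker B.ε.toLinearMap).liftQ B.ε.toLinearMap le_rfl) g
      (compΔ B.Δ ⟨_, B.ε_open⟩ J a) = f 1 ⊗ₜ[k] g (J.1.mkQ a) := by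
  rw [← B.ε_left J a, ← map_eq_tmul_lid, TensorProduct.map_map, LinearMap.comp_id]
  rfl

theorem map_ε_right {M : Type*} [AddCommGroup M] [Module k M] (I : OpenSub k B.A)
    (f : k →ₗ[k] M) (g : (B.A ⧸ I.1) →ₗ[k] M) (a : B.A) :
    TensorProduct.map g (f ∘ₗ (LinearMap.ker B.ε.toLinearMap).liftQ B.ε.toLinearMap le_rfl)
      (compΔ B.Δ I ⟨_, B.ε_open⟩ a) = g (I.1.mkQ a) ⊗ₜ[k] f 1 := by
  rw [← B.ε_right I a, ← map_eq_tmul_rid, TensorProduct.map_map, LinearMap.comp_id]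
  rfl

/-- The (0, b) component of Δ is the b component of (ε ⊗ 1)Δ = 1, and a generator has only a
component in length 1. -/
theorem opC_zero_left (hε : ∀ x, algebraMap k (Ten U) (B.ε x) = Φ.cf 0 x) (b : ℕ) (x : U) :
    Φ.opC 0 b x = if b = 1 then 1 ⊗ₜ[k] TensorAlgebra.ι k x else 0 := by
  have hN : 0 < b + 1 := by omega
  have hb : b < b + 1 := by omega
  -- A trivial factor map on the right, so that `factor_compΔ` can replace the left ideal alone by
  -- ker ε.
  have hid : Φ.cfQ hb = Φ.cfQ hb ∘ₗ Submodule.factor (le_refl (Φ.fil (b + 1)).1) :=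
    Submodule.linearMap_qext _ (LinearMap.ext fun _ => rfl)
  rw [← Φ.map_cfQ_Δ hN hb x, Φ.cfQ_zero hε hN, hid, TensorProduct.map_comp, LinearMap.comp_apply,
    factor_compΔ B.Δ (I' := ⟨_, B.ε_open⟩), map_ε_left, ← LinearMap.comp_apply, cfQ_mkQ, cf_j,
    Ten.proj_ι, Algebra.linearMap_apply, map_one]
  split_ifs
  · rfl
  · exact TensorProduct.tmul_zero _ _

theorem opC_zero_right (hε : ∀ x, algebraMap k (Ten U) (B.ε x) = Φ.cf 0 x) (a : ℕ) (x : U) :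
    Φ.opC a 0 x = if a = 1 then TensorAlgebra.ι k x ⊗ₜ[k] 1 else 0 := by
  have hN : 0 < a + 1 := by omega
  have ha : a < a + 1 := by omega
  have hid : Φ.cfQ ha = Φ.cfQ ha ∘ₗ Submodule.factor (le_refl (Φ.fil (a + 1)).1) :=
    Submodule.linearMap_qext _ (LinearMap.ext fun _ => rfl)
  rw [← Φ.map_cfQ_Δ ha hN x, Φ.cfQ_zero hε hN, hid, TensorProduct.map_comp, LinearMap.comp_apply,
    factor_compΔ B.Δ (J' := ⟨_, B.ε_open⟩), map_ε_right, ← LinearMap.comp_apply, cfQ_mkQ, cf_j,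
    Ten.proj_ι, Algebra.linearMap_apply, map_one]
  split_ifs
  · rfl
  · exact TensorProduct.zero_tmul _ _

/-- The cooperations of a topological dg bialgebra with a presentation. -/
def coop (hε : ∀ x, algebraMap k (Ten U) (B.ε x) = Φ.cf 0 x) : Coop U where
  m := Φ.opM
  m_mem r n x hx :=
    Φ.mem_gr_iff.1 (B.d_mem n _ (Φ.j_mem_gr n _ (Ten.ι_mem_deg U hx))) r
  m_zero x := by
    change Φ.cf 0 (B.d _) = 0
    -- The length 0 component of d is εd, which is zero.
    rw [← hε, B.ε_d, map_zero]
  c := Φ.opC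
  c_mem a b n x hx := by
    have ha : a < a + b + 1 := by omega
    have hb : b < a + b + 1 := by omega
    obtain ⟨z, hz, h⟩ := B.Δ_gr n _ (Φ.j_mem_gr n _ (Ten.ι_mem_deg U hx))
      (Φ.fil (a + b + 1)) (Φ.fil (a + b + 1))
    have h' : Φ.opC a b x = TensorProduct.map (Φ.cf a) (Φ.cf b) z := by
      rw [← Φ.map_cfQ_Δ ha hb x, ← Φ.map_cfQ_tproj ha hb, h]; rfl
    rw [h']
    clear h h'
    induction hz using Submodule.span_induction with
    | zero => rw [map_zero]; exact zero_mem _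
    | add x y _ _ hx hy => rw [map_add]; exact add_mem hx hy
    | smul c x _ hx => rw [map_smul]; exact Submodule.smul_mem _ _ hx
    | mem z hz =>
      obtain ⟨i, j, hij, x, hx, y, hy, rfl⟩ := hz
      exact Submodule.subset_span ⟨i, j, hij, _, Φ.mem_gr_iff.1 hx a, _, Φ.mem_gr_iff.1 hy b, rfl⟩
  c_zero_left := Φ.opC_zero_left hε
  c_zero_right := Φ.opC_zero_right hε

variable (hε : ∀ x, algebraMap k (Ten U) (B.ε x) = Φ.cf 0 x)

/-- On TU both d and `D N` are derivations along the parity and the inclusion, and on generators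
they agree in lengths below N by the definition of `opM`. -/
theorem hasDeriv_coop : Φ.HasDeriv (Φ.coop hε) B.d := by
  intro N t
  refine mem_of_leibniz (φ := B.d ∘ₗ Φ.j.toLinearMap - Φ.j.toLinearMap ∘ₗ (Φ.coop hε).D N)
    (F := Φ.j.comp (parityHom (Ten.deg U))) (G := Φ.j) (fun x y => ?_) (Φ.isIdeal_fil N)
    (fun x => ?_) t
  · simp only [LinearMap.sub_apply, LinearMap.comp_apply, AlgHom.toLinearMap_apply, map_mul,
      B.d_mul, Coop.D_mul, map_add, AlgHom.comp_apply, parityHom_apply, Φ.j_parity, sub_mul,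
      mul_sub]
    abel
  · rw [Φ.mem_fil]
    intro r hr
    simp only [LinearMap.sub_apply, LinearMap.comp_apply, AlgHom.toLinearMap_apply, map_sub, cf_j,
      Coop.D_ι, map_sum]
    rw [Finset.sum_eq_single r, Ten.proj_of_mem ((Φ.coop hε).m_mem_len r x), sub_eq_zero]
    · rfl
    · intro q _ hq; exact Ten.proj_of_mem_ne ((Φ.coop hε).m_mem_len q x) hq
    · intro h; exact absurd (Finset.mem_range.2 hr) h

/-- Both sides are multiplicative and agree on generators by components. Multiplicativity of Δ is
expressed through representatives in A ⊗ A; here these are the images of the truncated coproducts.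
-/
theorem compΔ_fil_coop (N : ℕ) (t : Ten U) : compΔ B.Δ (Φ.fil N) (Φ.fil N) (Φ.j t) =
    tproj (Φ.fil N).1 (Φ.fil N).1
      (TensorProduct.map Φ.j.toLinearMap Φ.j.toLinearMap ((Φ.coop hε).cm N t)) := by
  induction t using TensorAlgebra.induction with
  | algebraMap c =>
    have h₁ : (Φ.coop hε).cm N 1 = 1 ⊗ₜ[k] 1 := by rw [Coop.cm_apply, map_one]; rfl
    rw [Algebra.algebraMap_eq_smul_one, map_smul, map_smul, map_smul, map_smul, map_smul, h₁,
      map_one, TensorProduct.map_tmul]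
    simp only [AlgHom.toLinearMap_apply, map_one]
    rw [← B.Δ_one]; rfl
  | ι x =>
    refine Φ.eq_of_map_cfQ fun a ha b hb => ?_
    rw [Φ.map_cfQ_Δ, Φ.map_cfQ_tproj_j, (Φ.coop hε).map_proj_cm_ι ha hb]
    rfl
  | add x y hx hy => simp only [map_add, hx, hy]
  | mul x y hx hy =>
    have h := B.Δ_mul (Φ.fil N) (Φ.fil N) (Φ.isIdeal_fil N) (Φ.isHomog_fil N) (Φ.isIdeal_fil N)
      (Φ.isHomog_fil N) (Φ.j x) (Φ.j y) (Φ.j₂ ((Φ.coop hε).comul N x))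
      (Φ.j₂ ((Φ.coop hε).comul N y)) hx.symm hy.symm
    rw [← map_mul, ← map_mul, ← map_mul] at h
    exact h

theorem hasComul_coop : Φ.HasComul (Φ.coop hε) B.Δ := by
  intro N I J hI hJ t
  rw [← factor_compΔ B.Δ hI hJ, Φ.compΔ_fil_coop hε, factor_tproj]

/-- For index n + 1 this is the length n component of d² = 0 on a generator; index 0 involves only
m_0. -/
theorem coop_m_m (n : ℕ) (x : U) : ∑ p ∈ Finset.HasAntidiagonal.antidiagonal n,
    derivExt ((Φ.coop hε).m p.2) ((Φ.coop hε).m p.1 x) = 0 := by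
  rcases n with _ | n
  · simp [(Φ.coop hε).m_zero]
  -- By continuity d carries `fil M` into `fil (n + 1)`, so the error made by replacing the inner d
  -- by `D M` is harmless.
  · obtain ⟨M, hM, hM₁, -⟩ := Φ.exists_fil_le_inf (n + 2)
      (OpenSub.comap B.d B.d_cont (Φ.fil (n + 1))) (Φ.fil 0)
    rw [← (Φ.coop hε).proj_D_D n M (by omega)]
    have hd := Φ.hasDeriv_coop hε
    have h₁ : B.d (B.d (Φ.j (TensorAlgebra.ι k x)) -
        Φ.j ((Φ.coop hε).D M (TensorAlgebra.ι k x))) ∈ (Φ.fil (n + 1)).1 :=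
      hM₁ (hd M (TensorAlgebra.ι k x))
    have h₂ := Φ.fil_anti (show n + 1 ≤ M by omega) (hd M ((Φ.coop hε).D M (TensorAlgebra.ι k x)))
    have h₃ := add_mem h₁ h₂
    rw [map_sub, B.d_d, zero_sub, neg_add_eq_sub, sub_sub_cancel_left, neg_mem_iff,
      Φ.j_mem_fil] at h₃
    exact h₃ n (by omega)

theorem coop_m_c (a b : ℕ) (x : U) :
    ∑ r ∈ Finset.range (a + b + 1), comulExt (Φ.coop hε).c a b ((Φ.coop hε).m r x) =
    ∑ p ∈ Finset.HasAntidiagonal.antidiagonal (a + 1),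
      TensorProduct.map (derivExt ((Φ.coop hε).m p.2)) LinearMap.id ((Φ.coop hε).c p.1 b x) +
    ∑ p ∈ Finset.HasAntidiagonal.antidiagonal (b + 1),
      TensorProduct.map (parity (Ten.deg U)) (derivExt ((Φ.coop hε).m p.2))
        ((Φ.coop hε).c a p.1 x) := by
  have ha : a < a + b + 1 := by omega
  have hb : b < a + b + 1 := by omega
  have hd := Φ.hasDeriv_coop hε
  have hΔ := Φ.hasComul_coop hε
  let I := Φ.fil (a + b + 1)
  let I' : OpenSub k B.A := ⟨I.1 ⊓ I.1.comap B.d, I.2.inter (I.2.preimage B.d_cont)⟩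
  -- Inside `I'` the differential of the tensor square is defined with values modulo `I`; inside the
  -- kernel of Δ modulo `I`, d may be replaced by `D M` before Δ is applied.
  obtain ⟨M, hM, hM₁, hM₂⟩ := Φ.exists_fil_le_inf (a + b + 2) I' ⟨_, B.Δ_open I I⟩
  have hMI : (Φ.fil M).1 ≤ I.1 := Φ.fil_anti (by omega)
  have h := B.Δ_d I I I' I' (Φ.isHomog_fil _) (Φ.isHomog_fil _) rfl rfl
    (Φ.j (TensorAlgebra.ι k x)) _ (hΔ M I' I' hM₁ hM₁ (TensorAlgebra.ι k x)).symm
  rw [hd.tproj_D₂ hMI hMI] at h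
  have h' : compΔ B.Δ I I (B.d (Φ.j (TensorAlgebra.ι k x))) =
      compΔ B.Δ I I (Φ.j ((Φ.coop hε).D M (TensorAlgebra.ι k x))) := by
    rw [← sub_eq_zero, ← map_sub]
    exact hM₂ (hd M (TensorAlgebra.ι k x))
  rw [hΔ M I I hMI hMI] at h'
  have h'' := congrArg (TensorProduct.map (Φ.cfQ ha) (Φ.cfQ hb)) (h'.symm.trans h)
  rw [Φ.map_cfQ_tproj_j, Φ.map_cfQ_tproj_j, Coop.cm_D_component _ (by omega),
    Coop.D₂_cm_component _ (by omega)] at h''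
  exact h''

theorem coop_coassoc (a b e : ℕ) (x : U) :
    TensorProduct.assoc k _ _ _ (∑ r ∈ Finset.range (a + b + 1),
      TensorProduct.map (comulExt (Φ.coop hε).c a b) LinearMap.id ((Φ.coop hε).c r e x)) =
    ∑ r ∈ Finset.range (b + e + 1),
      TensorProduct.map LinearMap.id (comulExt (Φ.coop hε).c b e) ((Φ.coop hε).c a r x) := by
  have ha : a < a + b + e + 1 := by omega
  have hb : b < a + b + e + 1 := by omega
  have he : e < a + b + e + 1 := by omega
  have hΔ := Φ.hasComul_coop hε
  let I := Φ.fil (a + b + e + 1)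
  obtain ⟨M, hM, hM₁, -⟩ := Φ.exists_fil_le_inf (a + b + e + 1) ⟨_, B.Δ_open I I⟩ I
  have hMI : (Φ.fil M).1 ≤ I.1 := Φ.fil_anti (by omega)
  have h := B.coassoc I I I (Φ.j (TensorAlgebra.ι k x))
  have h' := ((hΔ.coassoc_left (L := ⟨_, B.Δ_open I I⟩) rfl hMI hMI hMI hM₁ _).symm.trans h).trans
    (hΔ.coassoc_right (L := ⟨_, B.Δ_open I I⟩) rfl hMI hMI hMI hM₁ _)
  have h'' := congrArg (TensorProduct.map (Φ.cfQ ha)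
    (TensorProduct.map (Φ.cfQ hb) (Φ.cfQ he))) h'
  rw [TensorProduct.map_map, TensorProduct.map_map, ← TensorProduct.map_comp] at h''
  simp only [← LinearMap.comp_assoc, I, cfQ_mkQ, cf_comp_j] at h''
  rw [Coop.assoc_cm_cm_component _ (by omega) (by omega),
    Coop.cm_cm_component _ (by omega) (by omega)] at h''
  exact h''

end Chart

end

end BInfty

namespace BInfty

noncomputable section

open GradedTensorProduct

variable {k : Type u} [Field k] {U W : GrMod.{u, v} k}

/-! ### Morphisms -/

namespace Coop

variable {S : Coop U} {S' : Coop W} {f : GrHom U W}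

/-- The difference is a derivation along Tf after the parity and Tf, and it vanishes on generators;
with the zero ideal, `mem_of_leibniz` gives equality. -/
theorem map_D (h : ∀ r x, Ten.map f (S.m r x) = S'.m r (f.toLin x)) (N : ℕ) (t : Ten U) :
    Ten.map f (S.D N t) = S'.D N (Ten.map f t) := by
  rw [← sub_eq_zero]
  refine mem_of_leibniz (I := ⊥)
    (φ := (Ten.map f).toLinearMap ∘ₗ S.D N - S'.D N ∘ₗ (Ten.map f).toLinearMap)
    (F := (Ten.map f).comp (parityHom (Ten.deg U))) (G := Ten.map f) (fun x y => ?_) isIdeal_bot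
    (fun x => ?_) t
  · have hp : Ten.map f (parity (Ten.deg U) x) = parity (Ten.deg W) (Ten.map f x) :=
      map_parity (Ten.deg U) (Ten.deg W) (Ten.map f).toLinearMap (Ten.map_mem_deg f) x
    simp only [LinearMap.sub_apply, LinearMap.comp_apply, AlgHom.toLinearMap_apply, map_mul,
      D_mul, map_add, AlgHom.comp_apply, parityHom_apply, hp, sub_mul, mul_sub]
    abel
  · rw [Submodule.mem_bot, LinearMap.sub_apply, sub_eq_zero]
    simp only [LinearMap.comp_apply, AlgHom.toLinearMap_apply, D_ι, map_sum, Ten.map_ι, h]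

theorem map_cm (h : ∀ a b x, TensorProduct.map (Ten.map f).toLinearMap
    (Ten.map f).toLinearMap (S.c a b x) = S'.c a b (f.toLin x)) (N : ℕ) (t : Ten U) :
    TensorProduct.map (Ten.map f).toLinearMap (Ten.map f).toLinearMap (S.cm N t) =
      S'.cm N (Ten.map f t) := by
  have hh : (gmap (Ten.deg U) (Ten.deg U) (Ten.deg W) (Ten.deg W) (Ten.map f) (Ten.map f)
      (Ten.map_mem_deg f) (Ten.map_mem_deg f)).comp (S.comul N) =
      (S'.comul N).comp (Ten.map f) := by
    refine TensorAlgebra.hom_ext (LinearMap.ext fun x => ?_)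
    simp only [LinearMap.comp_apply, AlgHom.toLinearMap_apply, AlgHom.comp_apply, comul_ι,
      Ten.map_ι, map_sum, ← h]
    rfl
  exact congrArg (fun φ : Ten U →ₐ[k] Ten.Sq W => (of k (Ten.deg W) (Ten.deg W)).symm (φ t)) hh

end Coop

namespace Chart

variable {B B' : TopDGBialg.{u, w} k} {Φ : Chart U B.gr} {Φ' : Chart W B'.gr} {f : GrHom U W}
  {F : B.A →ₐ[k] B'.A}

theorem map_j (hF : ∀ r x, Φ'.cf r (F x) = Ten.map f (Φ.cf r x)) (t : Ten U) :
    F (Φ.j t) = Φ'.j (Ten.map f t) :=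
  Φ'.ext fun r => by rw [hF, cf_j, cf_j, Ten.proj_map]

theorem map_mem_fil (hF : ∀ r x, Φ'.cf r (F x) = Ten.map f (Φ.cf r x)) (N : ℕ) :
    (Φ.fil N).1 ≤ (Φ'.fil N).1.comap F.toLinearMap := by
  intro x hx
  rw [Submodule.mem_comap, mem_fil]
  intro r hr
  rw [AlgHom.toLinearMap_apply, hF, Φ.mem_fil.1 hx r hr, map_zero]

theorem continuous_of_cf (hF : ∀ r x, Φ'.cf r (F x) = Ten.map f (Φ.cf r x)) :
    Continuous F.toLinearMap := by
  have h := PiT.continuous_of_fil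
    (Φ'.e.symm.toLinearMap ∘ₗ F.toLinearMap ∘ₗ Φ.e.toLinearMap) fun N => ⟨N, fun x hx => by
      refine Φ.map_mem_fil hF N (x := Φ.e x) ?_
      rw [mem_fil]
      intro r hr
      rw [cf_e]
      exact hx r hr⟩
  have h' := (Φ'.cont.comp h).comp Φ.symm_cont
  convert h' using 1
  funext x
  simp

variable (hε : ∀ x, algebraMap k (Ten U) (B.ε x) = Φ.cf 0 x)
  (hε' : ∀ x, algebraMap k (Ten W) (B'.ε x) = Φ'.cf 0 x)

theorem coop_m_of_isMor (hF : ∀ r x, Φ'.cf r (F x) = Ten.map f (Φ.cf r x)) (h : B.IsMor B' F)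
    (r : ℕ) (x : U) :
    Ten.map f ((Φ.coop hε).m r x) = (Φ'.coop hε').m r (f.toLin x) := by
  change Ten.map f (Φ.cf r (B.d (Φ.j _))) = Φ'.cf r (B'.d (Φ'.j _))
  rw [← Ten.map_ι, ← map_j hF, ← h.map_d, hF]

theorem coop_c_of_isMor (hF : ∀ r x, Φ'.cf r (F x) = Ten.map f (Φ.cf r x)) (h : B.IsMor B' F)
    (a b : ℕ) (x : U) :
    TensorProduct.map (Ten.map f).toLinearMap (Ten.map f).toLinearMap ((Φ.coop hε).c a b x) =
      (Φ'.coop hε').c a b (f.toLin x) := by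
  have ha : a < a + b + 1 := by omega
  have hb : b < a + b + 1 := by omega
  have key : ∀ c (hc : c < a + b + 1), (Φ'.cfQ hc ∘ₗ Submodule.mapQ
      (OpenSub.comap F.toLinearMap h.cont (Φ'.fil (a + b + 1))).1 (Φ'.fil (a + b + 1)).1
        F.toLinearMap le_rfl) ∘ₗ Submodule.factor (Φ.map_mem_fil hF (a + b + 1)) =
      (Ten.map f).toLinearMap ∘ₗ Φ.cfQ hc := fun c hc =>
    Submodule.linearMap_qext _ (LinearMap.ext fun x => hF c x)
  have h₁ := h.map_Δ (Φ'.fil (a + b + 1)) (Φ'.fil (a + b + 1)) (Φ.j (TensorAlgebra.ι k x))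
  rw [map_j hF, Ten.map_ι] at h₁
  have h₂ := congrArg (TensorProduct.map (Φ'.cfQ ha) (Φ'.cfQ hb)) h₁
  have h₃ : TensorProduct.map (Φ'.cfQ ha) (Φ'.cfQ hb) ((B'.Δ
    (Φ'.j (TensorAlgebra.ι k (f.toLin x)))).1 (Φ'.fil (a + b + 1)) (Φ'.fil (a + b + 1))) =
    Φ'.opC a b (f.toLin x) := Φ'.map_cfQ_Δ ha hb _
  rw [h₃, TensorProduct.map_map] at h₂
  refine Eq.trans ?_ h₂
  -- The compatibility with Δ is stated in quotients by preimages under `F`; these contain the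
  -- corresponding `fil` of the source, where the components of Δ are known.
  have h₄ := factor_compΔ B.Δ
    (I' := OpenSub.comap F.toLinearMap h.cont (Φ'.fil (a + b + 1)))
    (J' := OpenSub.comap F.toLinearMap h.cont (Φ'.fil (a + b + 1)))
    (Φ.map_mem_fil hF (a + b + 1)) (Φ.map_mem_fil hF (a + b + 1)) (Φ.j (TensorAlgebra.ι k x))
  have h₅ : (B.Δ (Φ.j (TensorAlgebra.ι k x))).1
      (OpenSub.comap F.toLinearMap h.cont (Φ'.fil (a + b + 1)))
      (OpenSub.comap F.toLinearMap h.cont (Φ'.fil (a + b + 1))) = _ := h₄.symm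
  rw [h₅, TensorProduct.map_map, key a ha, key b hb, TensorProduct.map_comp, LinearMap.comp_apply,
    Φ.map_cfQ_Δ ha hb]
  rfl

/-- In each length both sides vanish near 0 by continuity, so it is enough to compare them on TU,
where d is the truncated derivation and `Coop.map_D` applies. -/
theorem map_d_of_coop (hF : ∀ r x, Φ'.cf r (F x) = Ten.map f (Φ.cf r x))
    (h : ∀ r x, Ten.map f ((Φ.coop hε).m r x) = (Φ'.coop hε').m r (f.toLin x)) (x : B.A) :
    F (B.d x) = B'.d (F x) := by
  refine Φ'.ext fun r => ?_
  have hc := continuous_of_cf hF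
  obtain ⟨M, hM, hM₁, hM₂⟩ := Φ.exists_fil_le_inf 0
    (OpenSub.comap B.d B.d_cont (OpenSub.comap F.toLinearMap hc (Φ'.fil (r + 1))))
    (OpenSub.comap F.toLinearMap hc (OpenSub.comap B'.d B'.d_cont (Φ'.fil (r + 1))))
  refine Φ.eq_of_fil (f := Φ'.cf r ∘ₗ F.toLinearMap ∘ₗ B.d)
    (g := Φ'.cf r ∘ₗ B'.d ∘ₗ F.toLinearMap) M
    (fun x hx => Φ'.mem_fil.1 (hM₁ hx) r (by omega))
    (fun x hx => Φ'.mem_fil.1 (hM₂ hx) r (by omega)) (fun t => ?_) x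
  have h₁ := Φ.mem_fil.1 (Φ.hasDeriv_coop hε (r + 1) t) r (by omega)
  have h₂ := Φ'.mem_fil.1 (Φ'.hasDeriv_coop hε' (r + 1) (Ten.map f t)) r (by omega)
  rw [map_sub, sub_eq_zero, cf_j] at h₁ h₂
  simp only [LinearMap.comp_apply, AlgHom.toLinearMap_apply]
  rw [hF, h₁, map_j hF, h₂, ← Ten.proj_map, Coop.map_D h]

theorem map_Δ_of_coop (hF : ∀ r x, Φ'.cf r (F x) = Ten.map f (Φ.cf r x))
    (h : ∀ a b x, TensorProduct.map (Ten.map f).toLinearMap (Ten.map f).toLinearMap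
      ((Φ.coop hε).c a b x) = (Φ'.coop hε').c a b (f.toLin x)) (hc : Continuous F.toLinearMap)
    (I J : OpenSub k B'.A) (x : B.A) :
    TensorProduct.map
      (Submodule.mapQ (OpenSub.comap F.toLinearMap hc I).1 I.1 F.toLinearMap le_rfl)
      (Submodule.mapQ (OpenSub.comap F.toLinearMap hc J).1 J.1 F.toLinearMap le_rfl)
      (compΔ B.Δ (OpenSub.comap F.toLinearMap hc I) (OpenSub.comap F.toLinearMap hc J) x) =
    compΔ B'.Δ I J (F x) := by
  obtain ⟨M, -, hM₁, hM₂⟩ := Φ.exists_fil_le_inf 0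
    ⟨_, B.Δ_open (OpenSub.comap F.toLinearMap hc I) (OpenSub.comap F.toLinearMap hc J)⟩
    (OpenSub.comap F.toLinearMap hc ⟨_, B'.Δ_open I J⟩)
  obtain ⟨N, -, hI, hJ⟩ := Φ'.exists_fil_le_inf 0 I J
  refine Φ.eq_of_fil (f := TensorProduct.map
      (Submodule.mapQ (OpenSub.comap F.toLinearMap hc I).1 I.1 F.toLinearMap le_rfl)
      (Submodule.mapQ (OpenSub.comap F.toLinearMap hc J).1 J.1 F.toLinearMap le_rfl) ∘ₗ
      compΔ B.Δ (OpenSub.comap F.toLinearMap hc I) (OpenSub.comap F.toLinearMap hc J))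
    (g := compΔ B'.Δ I J ∘ₗ F.toLinearMap) M
    (fun x hx => (congrArg _ (hM₁ hx)).trans (map_zero _)) (fun x hx => hM₂ hx) (fun t => ?_) x
  have hj : F.toLinearMap ∘ₗ Φ.j.toLinearMap = Φ'.j.toLinearMap ∘ₗ (Ten.map f).toLinearMap :=
    LinearMap.ext (map_j hF)
  have hq : ∀ I : OpenSub k B'.A,
      Submodule.mapQ (OpenSub.comap F.toLinearMap hc I).1 I.1 F.toLinearMap le_rfl ∘ₗ
        (OpenSub.comap F.toLinearMap hc I).1.mkQ = I.1.mkQ ∘ₗ F.toLinearMap := fun I => rfl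
  change TensorProduct.map _ _ (compΔ B.Δ _ _ (Φ.j t)) = compΔ B'.Δ I J (F (Φ.j t))
  rw [map_j hF, Φ'.hasComul_coop hε' N I J hI hJ, ← Coop.map_cm h, Φ.hasComul_coop hε N _ _
      ((Φ.map_mem_fil hF N).trans (Submodule.comap_mono hI))
      ((Φ.map_mem_fil hF N).trans (Submodule.comap_mono hJ)), tproj, TensorProduct.map_map, hq, hq,
    TensorProduct.map_map, TensorProduct.map_map, ← hj, tproj, TensorProduct.map_map]
  rfl

/-- For a map that is Tf in every length, continuity and compatibility with degrees and counits are
automatic. What remains concerns d and Δ and is tested on generators. -/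
theorem isMor_iff (hF : ∀ r x, Φ'.cf r (F x) = Ten.map f (Φ.cf r x)) : B.IsMor B' F ↔
    (∀ r x, Ten.map f ((Φ.coop hε).m r x) = (Φ'.coop hε').m r (f.toLin x)) ∧
    ∀ a b x, TensorProduct.map (Ten.map f).toLinearMap (Ten.map f).toLinearMap
      ((Φ.coop hε).c a b x) = (Φ'.coop hε').c a b (f.toLin x) := by
  refine ⟨fun h => ⟨coop_m_of_isMor hε hε' hF h, coop_c_of_isMor hε hε' hF h⟩, fun h => ?_⟩
  exact
    { cont := continuous_of_cf hF
      map_gr := fun n x hx => by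
        rw [Φ'.mem_gr_iff]
        intro r
        have := Φ.mem_gr_iff.1 hx r
        rw [hF]
        exact ⟨Ten.map_mem_len f this.1, Ten.map_mem_deg f n _ this.2⟩
      map_d := map_d_of_coop hε hε' hF h.1
      map_ε := fun x => by
        refine (algebraMap k (Ten W)).injective ?_
        rw [hε', hF, ← hε, AlgHom.commutes]
      map_Δ := map_Δ_of_coop hε hε' hF h.2 (continuous_of_cf hF) }

end Chart

end

end BInfty

namespace BInfty

noncomputable section

variable {k : Type u} [Field k] {s : ℤ}

/-! ### The functor from bialgebras to coalgebras -/

theorem Ten.ι_ιInv {U : GrMod.{u, v} k} {t : Ten U} (ht : t ∈ Ten.len U 1) :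
    TensorAlgebra.ι k (TensorAlgebra.ιInv t) = t := by
  rw [Ten.len, pow_one] at ht
  obtain ⟨x, rfl⟩ := ht
  rw [TensorAlgebra.ι_leftInverse x]

theorem negOnePow_smul_smul {M : Type*} [AddCommGroup M] (s : ℤ) (x : M) :
    ((s.negOnePow : ℤˣ) : ℤ) • ((s.negOnePow : ℤˣ) : ℤ) • x = x := by
  rw [smul_smul, ← Units.val_mul, Int.units_mul_self, Units.val_one, one_smul]

namespace Coop

variable {V : GrMod.{u, v} k} (S : Coop (V.shift s))

/-- The differential of `V` for which `m 1` is the differential of `V[s]`. -/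
def diff : V →ₗ[k] V :=
  ((s.negOnePow : ℤˣ) : ℤ) • ((TensorAlgebra.ιInv : Ten (V.shift s) →ₗ[k] V.shift s) ∘ₗ S.m 1)

theorem m_one_eq (x : V) : S.m 1 x = ((s.negOnePow : ℤˣ) : ℤ) •
    (TensorAlgebra.ι k : V.shift s →ₗ[k] Ten (V.shift s)) (S.diff x) := by
  have h : (TensorAlgebra.ι k : V.shift s →ₗ[k] Ten (V.shift s)) (S.diff x) =
      ((s.negOnePow : ℤˣ) : ℤ) • S.m 1 x := by
    rw [← Ten.ι_ιInv (S.m_mem_len 1 x)]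
    exact map_zsmul (TensorAlgebra.ι k : V.shift s →ₗ[k] Ten (V.shift s)) _ _
  rw [h, negOnePow_smul_smul]

theorem diff_mem (n : ℤ) (x : V) (hx : x ∈ V.gr n) : S.diff x ∈ V.gr (n + 1) := by
  have hx' : x ∈ (V.shift s).gr (n - s) := by
    change x ∈ V.gr (s + (n - s))
    rwa [add_sub_cancel]
  have h := (S.m_mem 1 (n - s) x hx').2
  rw [← Ten.ι_ιInv (S.m_mem_len 1 x)] at h
  have h' : TensorAlgebra.ιInv (S.m 1 x) ∈ V.gr (s + (n - s + 1)) :=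
    Ten.mem_gr_of_ι_mem (U := V.shift s) h
  rw [show s + (n - s + 1) = n + 1 by ring] at h'
  exact zsmul_mem h' _

/-- In the relation of index 2 the terms with m_0 vanish and m_1 applied twice remains; the two
signs (-1)^s cancel. -/
theorem diff_diff (h : ∀ n x, ∑ p ∈ Finset.HasAntidiagonal.antidiagonal n,
    derivExt (S.m p.2) (S.m p.1 x) = 0) (x : V) : S.diff (S.diff x) = 0 := by
  have h₂ := h 2 x
  rw [Finset.Nat.sum_antidiagonal_eq_sum_range_succ_mk, Finset.sum_range_succ,
    Finset.sum_range_succ, Finset.sum_range_one] at h₂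
  simp only [S.m_zero', LinearMap.zero_apply, map_zero, zero_add, Nat.sub_self, derivExt_zero,
    add_zero] at h₂
  rw [show 2 - 1 = 1 from rfl, m_one_eq, map_zsmul, derivExt_ι, m_one_eq,
    negOnePow_smul_smul] at h₂
  exact Ten.ι_injective (h₂.trans (map_zero _).symm)

end Coop

namespace ProTensorBialg

variable (Y : ProTensorBialg.{u, v} k s)

/-- The presentation of the underlying algebra. -/
def chart : Chart (Y.V.shift s) Y.bialg.gr := ⟨Y.iso, Y.iso_cont, Y.iso_symm_cont, Y.iso_gr⟩

theorem algebraMap_ε (x : Y.bialg.A) :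
    algebraMap k (Ten (Y.V.shift s)) (Y.bialg.ε x) = Y.chart.cf 0 x := by
  have := Y.iso_ε (Y.iso.symm x)
  rw [AlgEquiv.apply_symm_apply] at this
  exact this

/-- The cooperations of the bialgebra. -/
def coop : Coop (Y.V.shift s) := Y.chart.coop Y.algebraMap_ε

/-- The `B_∞`-coalgebra of a bialgebra. -/
def toCoalg : Coalg.{u, v} k s where
  V := Y.V
  d := Y.coop.diff
  d_mem := Y.coop.diff_mem
  d_d := Y.coop.diff_diff (Y.chart.coop_m_m Y.algebraMap_ε)
  m := Y.coop.m
  m_mem := Y.coop.m_mem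
  m_zero := Y.coop.m_zero
  m_one := Y.coop.m_one_eq
  c := Y.coop.c
  c_mem := Y.coop.c_mem
  c_zero_left := Y.coop.c_zero_left
  c_zero_right := Y.coop.c_zero_right
  coassoc := Y.chart.coop_coassoc Y.algebraMap_ε
  m_m := Y.chart.coop_m_m Y.algebraMap_ε
  m_c := Y.chart.coop_m_c Y.algebraMap_ε

variable {Y} {Z : ProTensorBialg.{u, v} k s}

/-- Full faithfulness of the functor to coalgebras: the induced map is Tf in every length, so
`Chart.isMor_iff` applies. -/
theorem isMor_induced_iff (f : GrHom Y.V Z.V) : Y.bialg.IsMor Z.bialg (induced Y Z f) ↔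
    (∀ r x, Ten.map (f.shift s) (Y.coop.m r x) = Z.coop.m r (f.toLin x)) ∧
    ∀ a b x, TensorProduct.map (Ten.map (f.shift s)).toLinearMap (Ten.map (f.shift s)).toLinearMap
      (Y.coop.c a b x) = Z.coop.c a b (f.toLin x) :=
  Chart.isMor_iff (Φ := Y.chart) (Φ' := Z.chart) (f := f.shift s) Y.algebraMap_ε Z.algebraMap_ε
    fun r x => Z.chart.cf_e r (PiT.map (f.shift s) (Y.iso.symm x))

end ProTensorBialg

/-- Maps that commute with all cooperations commute with the differentials. -/
theorem Coalg.map_d_of_map_m {X Y : Coalg.{u, v} k s} (f : GrHom X.V Y.V)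
    (h : ∀ r x, Ten.map (f.shift s) (X.m r x) = Y.m r (f.toLin x)) (x : X.V) :
    f.toLin (X.d x) = Y.d (f.toLin x) := by
  have h₁ := h 1 x
  rw [X.m_one, map_zsmul, Ten.map_ι] at h₁
  have h₂ := congrArg (((s.negOnePow : ℤˣ) : ℤ) • ·) (h₁.trans (Y.m_one _))
  simp only [negOnePow_smul_smul] at h₂
  exact Ten.ι_injective h₂

/-- Morphisms of `B_∞`-coalgebras are the graded maps that commute with the cooperations. -/
def Coalg.Hom.mk' {X Y : Coalg.{u, v} k s} (f : GrHom X.V Y.V)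
    (hm : ∀ r x, Ten.map (f.shift s) (X.m r x) = Y.m r (f.toLin x))
    (hc : ∀ a b x, TensorProduct.map (Ten.map (f.shift s)).toLinearMap
      (Ten.map (f.shift s)).toLinearMap (X.c a b x) = Y.c a b (f.toLin x)) : X ⟶ Y :=
  (⟨f, Coalg.map_d_of_map_m f hm, hm, hc⟩ : Coalg.Hom X Y)

/-- The functor which takes a bialgebra to the `B_∞`-coalgebra of its cooperations. -/
def toCoalgFunctor (k : Type u) [Field k] (s : ℤ) :
    ProTensorBialg.{u, v} k s ⥤ Coalg.{u, v} k s where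
  obj Y := Y.toCoalg
  map {Y Z} F :=
    have h := (ProTensorBialg.isMor_induced_iff F.f).1 F.isMor
    Coalg.Hom.mk' (X := Y.toCoalg) (Y := Z.toCoalg) F.f h.1 h.2

instance : (toCoalgFunctor.{u, v} k s).Faithful where
  map_injective h := ProTensorBialg.Hom.ext (congrArg Coalg.Hom.f h)

instance : (toCoalgFunctor.{u, v} k s).Full where
  map_surjective F :=
    ⟨⟨F.f, (ProTensorBialg.isMor_induced_iff F.f).2 ⟨F.map_m, F.map_c⟩⟩, rfl⟩

end

end BInfty

namespace BInfty

noncomputable section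

open GradedTensorProduct

variable {k : Type u} [Field k] {U : GrMod.{u, v} k}

/-! ### The bialgebra of a family of cooperations -/

theorem IsHomog.parity_mem {A : Type*} [AddCommGroup A] [Module k A] {gr : ℤ → Submodule k A}
    [DirectSum.Decomposition gr] {I : Submodule k A} (hI : IsHomog gr I) {x : A} (hx : x ∈ I) :
    parity gr x ∈ I := by
  classical
  rw [← DirectSum.sum_support_decompose gr x, map_sum]
  refine Submodule.sum_mem _ fun n _ => ?_
  rw [parity_of_mem gr (SetLike.coe_mem _)]
  exact Submodule.smul_mem _ _ (hI x hx n)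

/-- Elements in all neighbourhoods of `0` vanish. -/
theorem Chart.eq_zero_of_mem_fil {A : Type*} [Ring A] [Algebra k A] [TopologicalSpace A]
    {gr : ℤ → Submodule k A} (Φ : Chart U gr) {x : A} (h : ∀ N, x ∈ (Φ.fil N).1) : x = 0 :=
  Φ.ext fun r => by rw [map_zero]; exact Φ.mem_fil.1 (h (r + 1)) r (by omega)

theorem Chart.trunc_mem_fil {A : Type*} [Ring A] [Algebra k A] [TopologicalSpace A]
    {gr : ℤ → Submodule k A} (Φ : Chart U gr) {N : ℕ} (M : ℕ) {x : A} (hx : x ∈ (Φ.fil N).1) :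
    Φ.trunc M x ∈ Ten.fil U N := by
  rw [trunc, LinearMap.sum_apply]
  refine Submodule.sum_mem _ fun r _ => ?_
  by_cases h : r < N
  · rw [Φ.mem_fil.1 hx r h]; exact zero_mem _
  · exact Ten.len_le_fil (by omega) (Φ.cf_mem_len r x)

theorem Chart.trunc_j_sub_mem {A : Type*} [Ring A] [Algebra k A] [TopologicalSpace A]
    {gr : ℤ → Submodule k A} (Φ : Chart U gr) (N : ℕ) (t : Ten U) :
    Φ.trunc N (Φ.j t) - t ∈ Ten.fil U N := by
  rw [← Φ.j_mem_fil, map_sub, ← neg_mem_iff, neg_sub]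
  exact Φ.sub_j_trunc_mem N (Φ.j t)

namespace Coop

variable (S : Coop U)

/-- The differential of `ΠTU`. -/
def dPi : PiT U →ₗ[k] PiT U :=
  -- The length r component involves neither words longer than r, which are not shortened, nor m_q
  -- with q > r, whose extensions have no values in length r.
  PiT.mkLin (PiT.deg U) 1 (fun r => Ten.proj r ∘ₗ S.D (r + 1) ∘ₗ (Chart.refl U).trunc (r + 1))
    fun r n _ hx => Ten.proj_mem_piece r
      (S.D_mem_deg _ n _ ((Chart.refl U).trunc_mem_deg (r + 1) hx))

theorem coeff_dPi (r : ℕ) (x : PiT U) : (Chart.refl U).cf r (S.dPi x) =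
    Ten.proj r (S.D (r + 1) ((Chart.refl U).trunc (r + 1) x)) :=
  PiT.coeff_mkLin _ _ _ _ _ _

theorem dPi_mem (n : ℤ) (x : PiT U) (hx : x ∈ PiT.deg U n) : S.dPi x ∈ PiT.deg U (n + 1) := by
  rw [(Chart.refl U).mem_gr_iff]
  intro r
  rw [coeff_dPi]
  exact Ten.proj_mem_piece r (S.D_mem_deg _ n _ ((Chart.refl U).trunc_mem_deg (r + 1) hx))

/-- One truncation level N serves for all lengths r < N: passing from r + 1 to N changes neither the
relevant letters of `x` (`h₁`) nor the relevant operations (`h₂`). -/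
theorem dPi_sub_mem (N : ℕ) (x : PiT U) :
    S.dPi x - (Chart.refl U).j (S.D N ((Chart.refl U).trunc N x)) ∈ ((Chart.refl U).fil N).1 := by
  rw [Chart.mem_fil]
  intro r hr
  have h₁ := S.D_mem_fil N ((Chart.refl U).trunc_sub_mem (N := r + 1) (M := N) (M' := r + 1)
    (by omega) le_rfl (x := x) (y := x) (by rw [sub_self]; exact zero_mem _)) r (by omega)
  have h₂ := S.D_sub_mem (show r + 1 ≤ N by omega) ((Chart.refl U).trunc (r + 1) x) r (by omega)
  rw [map_sub, map_sub, sub_eq_zero] at h₁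
  rw [map_sub, sub_eq_zero] at h₂
  rw [map_sub, Chart.cf_j, coeff_dPi, h₁, h₂, sub_self]

theorem hasDeriv_dPi : (Chart.refl U).HasDeriv S S.dPi := by
  intro N t
  have h₁ := S.dPi_sub_mem N ((Chart.refl U).j t)
  have h₂ := (Chart.refl U).j_mem_fil.2 (S.D_mem_fil N ((Chart.refl U).trunc_j_sub_mem N t))
  have := add_mem h₁ h₂
  rwa [map_sub, map_sub, sub_add_sub_cancel] at this

theorem dPi_mem_fil {N : ℕ} {x : PiT U} (hx : x ∈ ((Chart.refl U).fil N).1) :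
    S.dPi x ∈ ((Chart.refl U).fil N).1 := by
  have h := add_mem (S.dPi_sub_mem N x)
    ((Chart.refl U).j_mem_fil.2 (S.D_mem_fil N ((Chart.refl U).trunc_mem_fil N hx)))
  rwa [sub_add_cancel] at h

theorem continuous_dPi : Continuous S.dPi :=
  PiT.continuous_of_fil _ fun N => ⟨N, fun _ hx => S.dPi_mem_fil hx⟩

theorem dPi_dPi (h : ∀ n x, ∑ p ∈ Finset.HasAntidiagonal.antidiagonal n,
    derivExt (S.m p.2) (S.m p.1 x) = 0) (x : PiT U) : S.dPi (S.dPi x) = 0 := by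
  refine (Chart.refl U).eq_zero_of_mem_fil fun N => ?_
  -- The estimates telescope: first the inner, then the outer differential is replaced by `D (N +
  -- 1)`, and the square of the latter is small. Level N + 1 is what `D_D_mem_fil` needs for the
  -- bound N.
  have h₁ := (Chart.refl U).fil_anti N.le_succ (S.dPi_mem_fil (S.dPi_sub_mem (N + 1) x))
  have h₂ := (Chart.refl U).fil_anti N.le_succ
    (S.hasDeriv_dPi (N + 1) (S.D (N + 1) ((Chart.refl U).trunc (N + 1) x)))
  have h₃ := (Chart.refl U).j_mem_fil.2
    (S.D_D_mem_fil h (le_refl (N + 1)) ((Chart.refl U).trunc (N + 1) x))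
  have := add_mem (add_mem h₁ h₂) h₃
  rwa [map_sub, sub_add_sub_cancel, sub_add_cancel] at this

/-- Modulo `fil N` the defect of the Leibniz rule is bilinear and vanishes if either argument lies
in `fil N`. So both arguments may be taken in TU, where the differential is the derivation `D N`. -/
theorem dPi_mul (x y : PiT U) :
    S.dPi (x * y) = S.dPi x * y + parity (PiT.deg U) x * S.dPi y := by
  rw [← sub_eq_zero]
  refine (Chart.refl U).eq_zero_of_mem_fil fun N => ?_
  have hi := (Chart.refl U).isIdeal_fil N
  have hσ : ∀ x ∈ ((Chart.refl U).fil N).1, parity (PiT.deg U) x ∈ ((Chart.refl U).fil N).1 :=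
    fun x hx => ((Chart.refl U).isHomog_fil N).parity_mem hx
  let f : PiT U →ₗ[k] PiT U →ₗ[k] PiT U ⧸ ((Chart.refl U).fil N).1 :=
    ((LinearMap.mul k (PiT U)).compr₂ S.dPi - ((LinearMap.mul k (PiT U)).comp S.dPi +
      (LinearMap.mul k (PiT U)).compl₁₂ (parity (PiT.deg U)) S.dPi)).compr₂
        ((Chart.refl U).fil N).1.mkQ
  have hf : ∀ x y, f x y = ((Chart.refl U).fil N).1.mkQ
      (S.dPi (x * y) - (S.dPi x * y + parity (PiT.deg U) x * S.dPi y)) := fun _ _ => rfl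
  rw [← Submodule.Quotient.mk_eq_zero, ← Submodule.mkQ_apply, ← hf]
  have hq : ∀ {z : PiT U}, z ∈ ((Chart.refl U).fil N).1 →
      ((Chart.refl U).fil N).1.mkQ z = 0 := fun h => (Submodule.Quotient.mk_eq_zero _).2 h
  refine (Chart.refl U).eq_of_fil (f := f.flip y) (g := 0) N (fun x hx => ?_) (fun _ _ => rfl)
    (fun p => ?_) x
  · rw [LinearMap.flip_apply, hf]
    exact hq (sub_mem (S.dPi_mem_fil (hi y x hx).2)
      (add_mem (hi y _ (S.dPi_mem_fil hx)).2 (hi _ _ (hσ x hx)).2))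
  rw [LinearMap.zero_apply, LinearMap.flip_apply]
  refine (Chart.refl U).eq_of_fil (f := f ((Chart.refl U).j p)) (g := 0) N (fun y hy => ?_)
    (fun _ _ => rfl) (fun q => ?_) y
  · rw [hf]
    exact hq (sub_mem (S.dPi_mem_fil (hi _ y hy).1)
      (add_mem (hi _ y hy).1 (hi _ _ (S.dPi_mem_fil hy)).1))
  rw [LinearMap.zero_apply, hf]
  refine hq ?_
  have h₁ := S.hasDeriv_dPi N (p * q)
  have h₂ := (hi ((Chart.refl U).j q) _ (S.hasDeriv_dPi N p)).2
  have h₃ := (hi (parity (PiT.deg U) ((Chart.refl U).j p)) _ (S.hasDeriv_dPi N q)).1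
  have := sub_mem h₁ (add_mem h₂ h₃)
  rw [D_mul, map_add, map_mul (Chart.refl U).j, map_mul (Chart.refl U).j,
    map_mul (Chart.refl U).j, Chart.j_parity] at this
  convert this using 1
  noncomm_ring

/-! ### The coproduct -/

/-- A number `N` for which `I` and `J` contain `∏_{r ≥ N} TʳU`. -/
def level (I J : OpenSub k (PiT U)) : ℕ := ((Chart.refl U).exists_fil_le_inf 0 I J).choose

theorem level_spec (I J : OpenSub k (PiT U)) :
    ((Chart.refl U).fil (level I J)).1 ≤ I.1 ∧ ((Chart.refl U).fil (level I J)).1 ≤ J.1 :=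
  ((Chart.refl U).exists_fil_le_inf 0 I J).choose_spec.2

/-- The component of the coproduct of `ΠTU` in `(A/I) ⊗ (A/J)`. -/
def comulPi (I J : OpenSub k (PiT U)) : PiT U →ₗ[k] (PiT U ⧸ I.1) ⊗[k] (PiT U ⧸ J.1) :=
  tproj I.1 J.1 ∘ₗ
    TensorProduct.map (Chart.refl U).j.toLinearMap (Chart.refl U).j.toLinearMap ∘ₗ
    -- Words of length at least twice the level do not contribute, by `tproj_cm_eq_zero`.
    S.cm (level I J) ∘ₗ (Chart.refl U).trunc (2 * level I J)

theorem tproj_cm_trunc_eq {N M M' P P' : ℕ} (hM : N ≤ M) (hM' : N ≤ M') (hP : 2 * N ≤ P)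
    (hP' : 2 * N ≤ P') (x : PiT U) :
    tproj (Ten.fil U N) (Ten.fil U N) (S.cm M ((Chart.refl U).trunc P x)) =
      tproj (Ten.fil U N) (Ten.fil U N) (S.cm M' ((Chart.refl U).trunc P' x)) := by
  rw [S.tproj_cm_eq hM hM', ← sub_eq_zero, ← map_sub, ← map_sub]
  exact S.tproj_cm_eq_zero hM'
    ((Chart.refl U).trunc_sub_mem hP hP' (by rw [sub_self]; exact zero_mem _))

variable {S} in
-- Independence of the chosen level: any larger truncations give the same component. This makes the
-- components a compatible family, that is, a map into the completed tensor square.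
theorem comulPi_eq {N M P : ℕ} {I J : OpenSub k (PiT U)} (hI : ((Chart.refl U).fil N).1 ≤ I.1)
    (hJ : ((Chart.refl U).fil N).1 ≤ J.1) (hM : N ≤ M) (hP : 2 * N ≤ P) (x : PiT U) :
    S.comulPi I J x = tproj I.1 J.1
      (TensorProduct.map (Chart.refl U).j.toLinearMap (Chart.refl U).j.toLinearMap
        (S.cm M ((Chart.refl U).trunc P x))) := by
  obtain ⟨hI', hJ'⟩ := level_spec I J
  change tproj I.1 J.1 (TensorProduct.map _ _ (S.cm (level I J)
    ((Chart.refl U).trunc (2 * level I J) x))) = _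
  -- The comparison is made at the smaller of the two levels, which is admissible for both
  -- expressions.
  rcases le_total N (level I J) with h | h
  · exact (Chart.refl U).tproj_j_congr hI hJ (S.tproj_cm_trunc_eq h hM (by omega) hP x)
  · exact (Chart.refl U).tproj_j_congr hI' hJ'
      (S.tproj_cm_trunc_eq le_rfl (h.trans hM) le_rfl (by omega) x)

theorem comulPi_eq_zero {N : ℕ} {I J : OpenSub k (PiT U)} (hI : ((Chart.refl U).fil N).1 ≤ I.1)
    (hJ : ((Chart.refl U).fil N).1 ≤ J.1) {x : PiT U}
    (hx : x ∈ ((Chart.refl U).fil (2 * N)).1) : S.comulPi I J x = 0 := by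
  rw [comulPi_eq hI hJ le_rfl le_rfl,
    (Chart.refl U).tproj_j_congr hI hJ (w := 0), map_zero, map_zero]
  rw [map_zero]
  exact S.tproj_cm_eq_zero le_rfl ((Chart.refl U).trunc_mem_fil _ hx)

theorem comulPi_congr {N : ℕ} {I J : OpenSub k (PiT U)} (hI : ((Chart.refl U).fil N).1 ≤ I.1)
    (hJ : ((Chart.refl U).fil N).1 ≤ J.1) {x y : PiT U}
    (hx : x - y ∈ ((Chart.refl U).fil (2 * N)).1) : S.comulPi I J x = S.comulPi I J y := by
  rw [← sub_eq_zero, ← map_sub]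
  exact S.comulPi_eq_zero hI hJ hx

theorem isOpen_ker_comulPi (I J : OpenSub k (PiT U)) :
    IsOpen (LinearMap.ker (S.comulPi I J) : Set (PiT U)) := fun _ hx =>
  ⟨2 * level I J, fun _ hy =>
    add_mem hx (S.comulPi_eq_zero (level_spec I J).1 (level_spec I J).2 hy)⟩

/-- The coproduct of `ΠTU`. -/
def ΔPi : PiT U →ₗ[k] CTensor k (PiT U) :=
  LinearMap.codRestrict _ (LinearMap.pi fun I => LinearMap.pi fun J => S.comulPi I J) (by
    intro x I I' J J' hI hJ
    obtain ⟨hI', hJ'⟩ := level_spec I J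
    change TensorProduct.map _ _ (S.comulPi I J x) = S.comulPi I' J' x
    rw [comulPi_eq hI' hJ' le_rfl le_rfl, comulPi_eq (hI'.trans hI) (hJ'.trans hJ) le_rfl le_rfl,
      factor_tproj])

theorem compΔ_ΔPi (I J : OpenSub k (PiT U)) : compΔ S.ΔPi I J = S.comulPi I J := rfl

theorem hasComul_ΔPi : (Chart.refl U).HasComul S S.ΔPi := by
  intro N I J hI hJ t
  rw [compΔ_ΔPi, comulPi_eq hI hJ le_rfl le_rfl]
  refine (Chart.refl U).tproj_j_congr hI hJ ?_
  rw [← sub_eq_zero, ← map_sub, ← map_sub]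
  exact S.tproj_cm_eq_zero le_rfl ((Chart.refl U).trunc_j_sub_mem _ t)

end Coop

end

end BInfty

namespace BInfty

noncomputable section

open GradedTensorProduct

variable {k : Type u} [Field k] {U : GrMod.{u, v} k}

/-! ### The axioms of a bialgebra -/

/-- The counit of `ΠTU`. -/
def PiT.ε (U : GrMod.{u, v} k) : PiT U →ₐ[k] k :=
  AlgHom.ofLinearMap ((TensorAlgebra.algebraMapInv : Ten U →ₐ[k] k).toLinearMap ∘ₗ PiT.coeff 0)
    (by
      change TensorAlgebra.algebraMapInv (PiT.coeff 0 (1 : PiT U)) = 1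
      rw [PiT.coeff_one, if_pos rfl, map_one])
    (fun x y => by
      change TensorAlgebra.algebraMapInv (PiT.coeff 0 (x * y)) =
        TensorAlgebra.algebraMapInv (PiT.coeff 0 x) * TensorAlgebra.algebraMapInv (PiT.coeff 0 y)
      rw [PiT.coeff_mul, Finset.Nat.antidiagonal_zero, Finset.sum_singleton, map_mul])

theorem PiT.algebraMap_ε (x : PiT U) : algebraMap k (Ten U) (PiT.ε U x) = PiT.coeff 0 x := by
  change algebraMap k (Ten U) (TensorAlgebra.algebraMapInv (PiT.coeff 0 x)) = _
  rw [Ten.algebraMap_algebraMapInv, Ten.proj_of_mem (PiT.coeff_mem_len 0 x)]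

theorem PiT.ε_eq_zero {x : PiT U} (hx : PiT.coeff 0 x = 0) : PiT.ε U x = 0 := by
  change TensorAlgebra.algebraMapInv (PiT.coeff 0 x) = 0
  rw [hx, map_zero]

theorem PiT.fil_one_le_ker_ε : (PiT.fil U 1) ≤ LinearMap.ker (PiT.ε U).toLinearMap :=
  fun _ hx => PiT.ε_eq_zero (hx 0 (by omega))

theorem PiT.isOpen_ker_ε : IsOpen (LinearMap.ker (PiT.ε U).toLinearMap : Set (PiT U)) :=
  fun _ hx => ⟨1, fun _ hy => add_mem hx (PiT.fil_one_le_ker_ε hy)⟩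

theorem PiT.ε_j (t : Ten U) : PiT.ε U ((Chart.refl U).j t) = TensorAlgebra.algebraMapInv t := by
  refine (algebraMap k (Ten U)).injective ?_
  rw [PiT.algebraMap_ε, Ten.algebraMap_algebraMapInv]
  exact (Chart.refl U).cf_j 0 t

theorem Ten.algebraMap_mem_deg (c : k) : algebraMap k (Ten U) c ∈ Ten.deg U 0 := by
  rw [Algebra.algebraMap_eq_smul_one]
  exact Submodule.smul_mem _ _ SetLike.GradedOne.one_mem

/-- T⁰U consists of scalars, which have degree 0, so a component there of another degree is zero. -/
theorem PiT.ε_gr (n : ℤ) (hn : n ≠ 0) (x : PiT U) (hx : x ∈ PiT.deg U n) : PiT.ε U x = 0 := by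
  refine PiT.ε_eq_zero ?_
  have h := (hx 0).2
  have h' := Ten.algebraMap_mem_deg (U := U) (PiT.ε U x)
  rw [PiT.algebraMap_ε] at h'
  rw [← DirectSum.decompose_of_mem_same _ h, DirectSum.decompose_of_mem_ne _ h' hn.symm]

namespace Coop

variable (S : Coop U)

theorem ε_dPi (x : PiT U) : PiT.ε U (S.dPi x) = 0 := by
  refine PiT.ε_eq_zero ((S.coeff_dPi 0 x).trans ?_)
  have h : S.D 1 = 0 := by
    refine LinearMap.ext fun t => ?_
    rw [D, Finset.sum_range_one, S.m_zero', derivExt_zero, LinearMap.zero_apply]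
  rw [h, LinearMap.zero_apply, map_zero]

theorem ΔPi_gr (n : ℤ) (x : PiT U) (hx : x ∈ PiT.deg U n) (I J : OpenSub k (PiT U)) :
    compΔ S.ΔPi I J x ∈ (Submodule.span k {z : PiT U ⊗[k] PiT U | ∃ i j : ℤ, i + j = n ∧
      ∃ x ∈ PiT.deg U i, ∃ y ∈ PiT.deg U j, x ⊗ₜ[k] y = z}).map (tproj I.1 J.1) := by
  refine ⟨_, ?_, rfl⟩
  have h := S.comul_mem_tdeg (level I J) n _
    ((Chart.refl U).trunc_mem_deg (2 * level I J) hx)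
  have h' := tmap_mem_tdeg (Ten.deg U) (Ten.deg U) (PiT.deg U) (PiT.deg U)
    (Chart.refl U).j.toLinearMap (Chart.refl U).j.toLinearMap (r := 0) (s := 0)
    (fun n x hx => by rw [add_zero]; exact (Chart.refl U).j_mem_gr n x hx)
    (fun n x hx => by rw [add_zero]; exact (Chart.refl U).j_mem_gr n x hx) h
  rw [add_zero, add_zero] at h'
  exact h'

theorem ΔPi_one (I J : OpenSub k (PiT U)) :
    compΔ S.ΔPi I J 1 = tproj I.1 J.1 (1 ⊗ₜ[k] 1) := by
  obtain ⟨hI, hJ⟩ := level_spec I J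
  have h := S.hasComul_ΔPi (level I J) I J hI hJ 1
  have h₁ : S.cm (level I J) 1 = 1 ⊗ₜ[k] 1 := by rw [Coop.cm_apply, map_one]; rfl
  rw [h₁, map_one, TensorProduct.map_tmul] at h
  simp only [AlgHom.toLinearMap_apply, map_one] at h
  exact h

/-- As the kernel of the projection is an ideal, arbitrary representatives may be replaced by the
images `z` of truncated coproducts, which are multiplicative on TU. -/
theorem ΔPi_mul (I J : OpenSub k (PiT U)) (hI : IsIdeal I.1) (hI' : IsHomog (PiT.deg U) I.1)
    (hJ : IsIdeal J.1) (hJ' : IsHomog (PiT.deg U) J.1) (a b : PiT U)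
    (x y : PiT.deg U ᵍ⊗[k] PiT.deg U)
    (hx : tproj I.1 J.1 ((of k (PiT.deg U) (PiT.deg U)).symm x) = compΔ S.ΔPi I J a)
    (hy : tproj I.1 J.1 ((of k (PiT.deg U) (PiT.deg U)).symm y) = compΔ S.ΔPi I J b) :
    compΔ S.ΔPi I J (a * b) = tproj I.1 J.1 ((of k (PiT.deg U) (PiT.deg U)).symm (x * y)) := by
  obtain ⟨hI₁, hJ₁⟩ := level_spec I J
  set N := level I J
  let Φ := Chart.refl U
  let z : PiT U → PiT.deg U ᵍ⊗[k] PiT.deg U := fun a => Φ.j₂ (S.comul N (Φ.trunc (2 * N) a))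
  let q : PiT.deg U ᵍ⊗[k] PiT.deg U →ₗ[k] (PiT U ⧸ I.1) ⊗[k] (PiT U ⧸ J.1) :=
    TensorProduct.map I.1.mkQ J.1.mkQ ∘ₗ (of k (PiT.deg U) (PiT.deg U)).symm.toLinearMap
  have hz : ∀ a, q (z a) = compΔ S.ΔPi I J a := fun a => rfl
  have hK : IsIdeal (LinearMap.ker q) := by
    refine isIdeal_ker_map (PiT.deg U) (PiT.deg U) I.1.mkQ J.1.mkQ I.1.mkQ_surjective
      J.1.mkQ_surjective ?_ ?_ ?_ ?_ <;> rwa [Submodule.ker_mkQ]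
  have hx₁ : x - z a ∈ LinearMap.ker q := by
    rw [LinearMap.mem_ker, map_sub, hz, sub_eq_zero]; exact hx
  have hy₁ : y - z b ∈ LinearMap.ker q := by
    rw [LinearMap.mem_ker, map_sub, hz, sub_eq_zero]; exact hy
  have h₁ : q (x * y) = q (z a * z b) := by
    have := add_mem (hK y _ hx₁).2 (hK (z a) _ hy₁).1
    rw [sub_mul, mul_sub, sub_add_sub_cancel, LinearMap.mem_ker, map_sub, sub_eq_zero] at this
    exact this
  -- The product of truncations differs from the truncation of the product, but only by words of
  -- length at least 2N, which the coproduct does not see.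
  have h₂ : a * b - Φ.j (Φ.trunc (2 * N) a * Φ.trunc (2 * N) b) ∈ (Φ.fil (2 * N)).1 := by
    have hi := Φ.isIdeal_fil (2 * N)
    have := add_mem (hi b _ (Φ.sub_j_trunc_mem (2 * N) a)).2
      (hi (Φ.j (Φ.trunc (2 * N) a)) _ (Φ.sub_j_trunc_mem (2 * N) b)).1
    rwa [sub_mul, mul_sub, sub_add_sub_cancel, ← map_mul] at this
  refine (S.comulPi_congr hI₁ hJ₁ h₂).trans ?_
  refine (S.hasComul_ΔPi N I J hI₁ hJ₁ _).trans ?_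
  refine Eq.trans ?_ h₁.symm
  change q (Φ.j₂ (S.comul N (Φ.trunc (2 * N) a * Φ.trunc (2 * N) b))) = _
  rw [map_mul, map_mul]

theorem ΔPi_d (h : ∀ a b x,
    ∑ r ∈ Finset.range (a + b + 1), comulExt S.c a b (S.m r x) =
    ∑ p ∈ Finset.HasAntidiagonal.antidiagonal (a + 1),
      TensorProduct.map (derivExt (S.m p.2)) LinearMap.id (S.c p.1 b x) +
    ∑ p ∈ Finset.HasAntidiagonal.antidiagonal (b + 1),
      TensorProduct.map (parity (Ten.deg U)) (derivExt (S.m p.2)) (S.c a p.1 x))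
    (I J I' J' : OpenSub k (PiT U)) (hI : IsHomog (PiT.deg U) I.1)
    (hI' : I'.1 = I.1 ⊓ I.1.comap S.dPi) (hJ' : J'.1 = J.1 ⊓ J.1.comap S.dPi) (a : PiT U)
    (x : PiT U ⊗[k] PiT U) (hx : tproj I'.1 J'.1 x = compΔ S.ΔPi I' J' a) :
    compΔ S.ΔPi I J (S.dPi a) = tproj I.1 J.1 (TensorProduct.map S.dPi LinearMap.id x +
      TensorProduct.map (parity (PiT.deg U)) S.dPi x) := by
  obtain ⟨hI₁, hJ₁⟩ := level_spec I' J'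
  set N := level I' J'
  let Φ := Chart.refl U
  have hII : I'.1 ≤ I.1 := hI'.le.trans inf_le_left
  have hJJ : J'.1 ≤ J.1 := hJ'.le.trans inf_le_left
  have hdI : I'.1 ≤ I.1.comap S.dPi := hI'.le.trans inf_le_right
  have hdJ : J'.1 ≤ J.1.comap S.dPi := hJ'.le.trans inf_le_right
  have hσ : I'.1 ≤ I.1.comap (parity (PiT.deg U)) := fun x hx => hI.parity_mem (hII hx)
  -- The differential of the tensor square descends to the quotients by `I'` and `J'`; for the
  -- parity this uses the homogeneity of `I`. Hence `x` can be exchanged for a truncated coproduct.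
  have key : ∀ z : PiT U ⊗[k] PiT U, tproj I.1 J.1 (TensorProduct.map S.dPi LinearMap.id z +
      TensorProduct.map (parity (PiT.deg U)) S.dPi z) =
      (TensorProduct.map (Submodule.mapQ _ _ _ hdI) (Submodule.factor hJJ) +
        TensorProduct.map (Submodule.mapQ _ _ _ hσ) (Submodule.mapQ _ _ _ hdJ))
          (tproj I'.1 J'.1 z) := by
    intro z
    rw [LinearMap.add_apply, map_add, tproj, tproj]
    simp only [TensorProduct.map_map]
    rfl
  have hMI : (Φ.fil (2 * N)).1 ≤ I.1 := ((Φ.fil_anti (by omega)).trans hI₁).trans hII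
  have hMJ : (Φ.fil (2 * N)).1 ≤ J.1 := ((Φ.fil_anti (by omega)).trans hJ₁).trans hJJ
  have hda : compΔ S.ΔPi I' J' a = _ :=
    comulPi_eq (S := S) hI₁ hJ₁ (show N ≤ 2 * N by omega) (le_refl (2 * N)) a
  rw [key, hx, hda, ← key, S.hasDeriv_dPi.tproj_D₂ hMI hMJ,
    ← Φ.tproj_j_congr (hI₁.trans hII) (hJ₁.trans hJJ) (S.tproj_cm_D h (le_refl (2 * N)) _),
    ← S.hasComul_ΔPi (2 * N) I J hMI hMJ]
  exact S.comulPi_congr (hI₁.trans hII) (hJ₁.trans hJJ) (S.dPi_sub_mem (2 * N) a)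

theorem algebraMapInv_comp_proj : (TensorAlgebra.algebraMapInv : Ten U →ₐ[k] k).toLinearMap ∘ₗ
    Ten.proj 0 = (TensorAlgebra.algebraMapInv : Ten U →ₐ[k] k).toLinearMap :=
  LinearMap.ext fun t => by
    rw [LinearMap.comp_apply, ← Ten.algebraMap_algebraMapInv]
    simp

/-- The counit sees only length 0 in the left factor, and there the coproduct is 1 ⊗ t by
`comulExt_zero_left`. -/
theorem proj_lid_cm {N b : ℕ} (hb : b < N) (t : Ten U) :
    Ten.proj b (TensorProduct.lid k (Ten U) (TensorProduct.map
      (TensorAlgebra.algebraMapInv : Ten U →ₐ[k] k).toLinearMap LinearMap.id (S.cm N t))) =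
    Ten.proj b t := by
  have h := S.comulExt_eq (show 0 < N by omega) hb t
  rw [comulExt_zero_left] at h
  have h' := congrArg (fun z => TensorProduct.lid k (Ten U) (TensorProduct.map
    (TensorAlgebra.algebraMapInv : Ten U →ₐ[k] k).toLinearMap LinearMap.id z)) h
  simp only [TensorProduct.map_map, algebraMapInv_comp_proj, LinearMap.id_comp,
    TensorProduct.map_tmul, AlgHom.toLinearMap_apply, map_one, TensorProduct.lid_tmul, one_smul,
    LinearMap.id_apply] at h'
  rw [← h']
  generalize S.cm N t = z
  induction z using TensorProduct.induction_on with
  | zero => simp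
  | add x y hx hy => simp only [map_add, hx, hy]
  | tmul x y => simp

theorem proj_rid_cm {N a : ℕ} (ha : a < N) (t : Ten U) :
    Ten.proj a (TensorProduct.rid k (Ten U) (TensorProduct.map LinearMap.id
      (TensorAlgebra.algebraMapInv : Ten U →ₐ[k] k).toLinearMap (S.cm N t))) =
    Ten.proj a t := by
  have h := S.comulExt_eq ha (show 0 < N by omega) t
  rw [comulExt_zero_right] at h
  have h' := congrArg (fun z => TensorProduct.rid k (Ten U) (TensorProduct.map LinearMap.id
    (TensorAlgebra.algebraMapInv : Ten U →ₐ[k] k).toLinearMap z)) h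
  simp only [TensorProduct.map_map, algebraMapInv_comp_proj, LinearMap.id_comp,
    TensorProduct.map_tmul, AlgHom.toLinearMap_apply, map_one, TensorProduct.rid_tmul, one_smul,
    LinearMap.id_apply] at h'
  rw [← h']
  generalize S.cm N t = z
  induction z using TensorProduct.induction_on with
  | zero => simp
  | add x y hx hy => simp only [map_add, hx, hy]
  | tmul x y => simp

theorem ΔPi_ε_left (J : OpenSub k (PiT U)) (a : PiT U) : TensorProduct.lid k (PiT U ⧸ J.1)
    (TensorProduct.map ((LinearMap.ker (PiT.ε U).toLinearMap).liftQ (PiT.ε U).toLinearMap le_rfl)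
      LinearMap.id (compΔ S.ΔPi ⟨LinearMap.ker (PiT.ε U).toLinearMap, PiT.isOpen_ker_ε⟩ J a)) =
    J.1.mkQ a := by
  let Φ := Chart.refl U
  obtain ⟨N, -, hI, hJ⟩ := Φ.exists_fil_le_inf 1
    ⟨LinearMap.ker (PiT.ε U).toLinearMap, PiT.isOpen_ker_ε⟩ J
  have hε : (PiT.ε U).toLinearMap ∘ₗ Φ.j.toLinearMap =
      (TensorAlgebra.algebraMapInv : Ten U →ₐ[k] k).toLinearMap := LinearMap.ext PiT.ε_j
  rw [compΔ_ΔPi, comulPi_eq hI hJ le_rfl le_rfl, tproj, TensorProduct.map_map,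
    TensorProduct.map_map, Submodule.liftQ_mkQ, hε, LinearMap.id_comp]
  have hl : ∀ z : Ten U ⊗[k] Ten U, TensorProduct.lid k (PiT U ⧸ J.1) (TensorProduct.map
      (TensorAlgebra.algebraMapInv : Ten U →ₐ[k] k).toLinearMap (J.1.mkQ ∘ₗ Φ.j.toLinearMap) z) =
      J.1.mkQ (Φ.j (TensorProduct.lid k (Ten U) (TensorProduct.map
        (TensorAlgebra.algebraMapInv : Ten U →ₐ[k] k).toLinearMap LinearMap.id z))) := by
    intro z
    induction z using TensorProduct.induction_on with
    | zero => simp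
    | add x y hx hy => simp only [map_add, hx, hy]
    | tmul x y => simp
  refine (hl _).trans ?_
  rw [← sub_eq_zero, ← map_sub, Submodule.mkQ_apply, Submodule.Quotient.mk_eq_zero]
  refine hJ ?_
  have h₁ := Φ.fil_anti (show N ≤ 2 * N by omega) (Φ.sub_j_trunc_mem (2 * N) a)
  have h₂ : Φ.j (TensorProduct.lid k (Ten U) (TensorProduct.map
      (TensorAlgebra.algebraMapInv : Ten U →ₐ[k] k).toLinearMap LinearMap.id
        (S.cm N (Φ.trunc (2 * N) a))) - Φ.trunc (2 * N) a) ∈ (Φ.fil N).1 := by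
    rw [Φ.j_mem_fil]
    intro r hr
    rw [map_sub, S.proj_lid_cm hr, sub_self]
  have := sub_mem h₂ h₁
  rw [map_sub] at this
  convert this using 1
  abel

theorem ΔPi_ε_right (I : OpenSub k (PiT U)) (a : PiT U) : TensorProduct.rid k (PiT U ⧸ I.1)
    (TensorProduct.map LinearMap.id
      ((LinearMap.ker (PiT.ε U).toLinearMap).liftQ (PiT.ε U).toLinearMap le_rfl)
      (compΔ S.ΔPi I ⟨LinearMap.ker (PiT.ε U).toLinearMap, PiT.isOpen_ker_ε⟩ a)) =
    I.1.mkQ a := by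
  let Φ := Chart.refl U
  obtain ⟨N, -, hI, hJ⟩ := Φ.exists_fil_le_inf 1 I
    ⟨LinearMap.ker (PiT.ε U).toLinearMap, PiT.isOpen_ker_ε⟩
  have hε : (PiT.ε U).toLinearMap ∘ₗ Φ.j.toLinearMap =
      (TensorAlgebra.algebraMapInv : Ten U →ₐ[k] k).toLinearMap := LinearMap.ext PiT.ε_j
  rw [compΔ_ΔPi, comulPi_eq hI hJ le_rfl le_rfl, tproj, TensorProduct.map_map,
    TensorProduct.map_map, Submodule.liftQ_mkQ, hε, LinearMap.id_comp]
  have hl : ∀ z : Ten U ⊗[k] Ten U, TensorProduct.rid k (PiT U ⧸ I.1) (TensorProduct.map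
      (I.1.mkQ ∘ₗ Φ.j.toLinearMap) (TensorAlgebra.algebraMapInv : Ten U →ₐ[k] k).toLinearMap z) =
      I.1.mkQ (Φ.j (TensorProduct.rid k (Ten U) (TensorProduct.map LinearMap.id
        (TensorAlgebra.algebraMapInv : Ten U →ₐ[k] k).toLinearMap z))) := by
    intro z
    induction z using TensorProduct.induction_on with
    | zero => simp
    | add x y hx hy => simp only [map_add, hx, hy]
    | tmul x y => simp
  refine (hl _).trans ?_
  rw [← sub_eq_zero, ← map_sub, Submodule.mkQ_apply, Submodule.Quotient.mk_eq_zero]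
  refine hI ?_
  have h₁ := Φ.fil_anti (show N ≤ 2 * N by omega) (Φ.sub_j_trunc_mem (2 * N) a)
  have h₂ : Φ.j (TensorProduct.rid k (Ten U) (TensorProduct.map LinearMap.id
      (TensorAlgebra.algebraMapInv : Ten U →ₐ[k] k).toLinearMap
        (S.cm N (Φ.trunc (2 * N) a))) - Φ.trunc (2 * N) a) ∈ (Φ.fil N).1 := by
    rw [Φ.j_mem_fil]
    intro r hr
    rw [map_sub, S.proj_rid_cm hr, sub_self]
  have := sub_mem h₂ h₁
  rw [map_sub] at this
  convert this using 1
  abel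

theorem ΔPi_coassoc (h : ∀ a b e x,
    TensorProduct.assoc k _ _ _ (∑ r ∈ Finset.range (a + b + 1),
      TensorProduct.map (comulExt S.c a b) LinearMap.id (S.c r e x)) =
    ∑ r ∈ Finset.range (b + e + 1), TensorProduct.map LinearMap.id (comulExt S.c b e) (S.c a r x))
    (I J K : OpenSub k (PiT U)) (a : PiT U) :
    TensorProduct.assoc k _ _ _ (TensorProduct.map
      (Submodule.liftQ _ (compΔ S.ΔPi I J) le_rfl) LinearMap.id
      (compΔ S.ΔPi ⟨_, S.isOpen_ker_comulPi I J⟩ K a)) =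
    TensorProduct.map LinearMap.id (Submodule.liftQ _ (compΔ S.ΔPi J K) le_rfl)
      (compΔ S.ΔPi I ⟨_, S.isOpen_ker_comulPi J K⟩ a) := by
  let Φ := Chart.refl U
  obtain ⟨N₁, -, hI, hJ⟩ := Φ.exists_fil_le_inf 0 I J
  obtain ⟨N, hN, hK, -⟩ := Φ.exists_fil_le_inf N₁ K K
  replace hI := (Φ.fil_anti hN).trans hI
  replace hJ := (Φ.fil_anti hN).trans hJ
  -- N measures the precision in the triple tensor product. M is large enough for truncated
  -- coassociativity at that precision and for both inner coproducts to be defined modulo `fil M`;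
  -- both sides vanish on `fil (2 * M)`.
  obtain ⟨M, hM, hL, hL'⟩ := Φ.exists_fil_le_inf (2 * N) ⟨_, S.isOpen_ker_comulPi I J⟩
    ⟨_, S.isOpen_ker_comulPi J K⟩
  have hMN : (Φ.fil M).1 ≤ (Φ.fil N).1 := Φ.fil_anti (by omega)
  refine Φ.eq_of_fil
    (f := (TensorProduct.assoc k _ _ _).toLinearMap ∘ₗ TensorProduct.map
      (Submodule.liftQ _ (compΔ S.ΔPi I J) le_rfl) LinearMap.id ∘ₗ
      compΔ S.ΔPi ⟨_, S.isOpen_ker_comulPi I J⟩ K)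
    (g := TensorProduct.map LinearMap.id (Submodule.liftQ _ (compΔ S.ΔPi J K) le_rfl) ∘ₗ
      compΔ S.ΔPi I ⟨_, S.isOpen_ker_comulPi J K⟩) (2 * M) (fun x hx => ?_) (fun x hx => ?_)
    (fun t => ?_) a
  · have : compΔ S.ΔPi ⟨_, S.isOpen_ker_comulPi I J⟩ K x = 0 :=
      S.comulPi_eq_zero hL (hMN.trans hK) hx
    exact (congrArg ((TensorProduct.assoc k _ _ _).toLinearMap ∘ₗ TensorProduct.map
      (Submodule.liftQ _ (compΔ S.ΔPi I J) le_rfl) LinearMap.id) this).trans (map_zero _)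
  · have : compΔ S.ΔPi I ⟨_, S.isOpen_ker_comulPi J K⟩ x = 0 :=
      S.comulPi_eq_zero (hMN.trans hI) hL' hx
    exact (congrArg (TensorProduct.map LinearMap.id
      (Submodule.liftQ _ (compΔ S.ΔPi J K) le_rfl)) this).trans (map_zero _)
  · refine (S.hasComul_ΔPi.coassoc_left (L := ⟨_, S.isOpen_ker_comulPi I J⟩) rfl (hMN.trans hI)
      (hMN.trans hJ) (hMN.trans hK) hL t).trans (Eq.trans ?_ (S.hasComul_ΔPi.coassoc_right
        (L := ⟨_, S.isOpen_ker_comulPi J K⟩) rfl (hMN.trans hI)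
        (hMN.trans hJ) (hMN.trans hK) hL' t).symm)
    exact Φ.map_mkQ_j_congr hI hJ hK (S.map_mkQ_tproj_coassoc h hM t)

end Coop

end

end BInfty

namespace BInfty

noncomputable section

variable {k : Type u} [Field k] {s : ℤ}

/-! ### The equivalence -/

namespace Coalg

variable (X : Coalg.{u, v} k s)

/-- The cooperations of a `B_∞`-coalgebra. -/
def coop : Coop (X.V.shift s) :=
  ⟨X.m, X.m_mem, X.m_zero, X.c, X.c_mem, X.c_zero_left, X.c_zero_right⟩

/-- The topological dg bialgebra of a `B_∞`-coalgebra. -/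
def topBialg : TopDGBialg.{u, max u v} k where
  A := PiT (X.V.shift s)
  gr := PiT.deg (X.V.shift s)
  linear_top t ht := by
    obtain ⟨t', ht', ho, h0⟩ := mem_nhds_iff.1 ht
    obtain ⟨N, hN⟩ := ho 0 h0
    refine ⟨(Chart.refl (X.V.shift s)).fil N, (Chart.refl (X.V.shift s)).isIdeal_fil N,
      (Chart.refl (X.V.shift s)).isHomog_fil N, fun x hx => ht' ?_⟩
    have := hN x hx
    rwa [zero_add] at this
  d := X.coop.dPi
  d_cont := X.coop.continuous_dPi
  d_mem := X.coop.dPi_mem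
  d_d := X.coop.dPi_dPi X.m_m
  d_mul := X.coop.dPi_mul
  ε := PiT.ε (X.V.shift s)
  ε_open := PiT.isOpen_ker_ε
  ε_gr := PiT.ε_gr
  ε_d := X.coop.ε_dPi
  Δ := X.coop.ΔPi
  Δ_open := X.coop.isOpen_ker_comulPi
  Δ_gr := X.coop.ΔPi_gr
  Δ_one := X.coop.ΔPi_one
  Δ_mul := X.coop.ΔPi_mul
  Δ_d I J I' J' hI _ hI' hJ' := X.coop.ΔPi_d X.m_c I J I' J' hI hI' hJ'
  ε_left := X.coop.ΔPi_ε_left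
  ε_right := X.coop.ΔPi_ε_right
  coassoc := X.coop.ΔPi_coassoc X.coassoc

/-- The bialgebra of a `B_∞`-coalgebra, with its presentation. -/
def toBialg : ProTensorBialg.{u, v} k s where
  V := X.V
  bialg := X.topBialg
  iso := AlgEquiv.refl
  iso_cont := continuous_id
  iso_symm_cont := continuous_id
  iso_gr _ _ := Iff.rfl
  iso_ε := PiT.algebraMap_ε

theorem toBialg_coop_m (r : ℕ) (x : X.V.shift s) : X.toBialg.coop.m r x = X.m r x := by
  change (Chart.refl (X.V.shift s)).cf r (X.coop.dPi ((Chart.refl _).j (TensorAlgebra.ι k x))) = _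
  have h := (Chart.refl _).mem_fil.1 (X.coop.hasDeriv_dPi (r + 1) (TensorAlgebra.ι k x)) r
    (by omega)
  rw [map_sub, sub_eq_zero, Chart.cf_j, Coop.D_ι, map_sum, Finset.sum_eq_single r,
    Ten.proj_of_mem (X.coop.m_mem_len r x)] at h
  · exact h
  · intro q _ hq
    exact Ten.proj_of_mem_ne (X.coop.m_mem_len q x) hq
  · intro h
    exact absurd (Finset.mem_range.2 (by omega)) h

/-- The constructed coproduct is represented on generators by the sum of the c_{a,b}, so its
components return the original family. With the analogue for `m` this gives essential surjectivity.
-/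
theorem toBialg_coop_c (a b : ℕ) (x : X.V.shift s) : X.toBialg.coop.c a b x = X.c a b x := by
  change TensorProduct.map ((Chart.refl _).cfQ _) ((Chart.refl _).cfQ _)
    (compΔ X.coop.ΔPi ((Chart.refl _).fil (a + b + 1)) ((Chart.refl _).fil (a + b + 1))
      ((Chart.refl _).j (TensorAlgebra.ι k x))) = _
  rw [X.coop.hasComul_ΔPi (a + b + 1) _ _ le_rfl le_rfl, Chart.map_cfQ_tproj_j,
    Coop.map_proj_cm_ι _ (by omega) (by omega)]
  rfl

theorem map_id_apply (V : GrMod.{u, v} k) (t : Ten (V.shift s)) :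
    Ten.map ((GrHom.id V).shift s) t = t := by
  rw [Ten.map_id _ ((GrHom.id V).shift s) rfl]; rfl

theorem map_id_tensor_apply (V : GrMod.{u, v} k) (z : Ten (V.shift s) ⊗[k] Ten (V.shift s)) :
    TensorProduct.map (Ten.map ((GrHom.id V).shift s)).toLinearMap
      (Ten.map ((GrHom.id V).shift s)).toLinearMap z = z := by
  rw [Ten.map_id _ ((GrHom.id V).shift s) rfl]
  exact congrArg (fun φ : _ →ₗ[k] _ => φ z) TensorProduct.map_id

/-- A `B_∞`-coalgebra is isomorphic to the one of its bialgebra. -/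
def isoToBialg : (toCoalgFunctor k s).obj X.toBialg ≅ X where
  hom := Coalg.Hom.mk' (X := X.toBialg.toCoalg) (Y := X) (GrHom.id X.V)
    (fun r x => (map_id_apply X.V _).trans (X.toBialg_coop_m r x))
    (fun a b x => (map_id_tensor_apply X.V _).trans (X.toBialg_coop_c a b x))
  inv := Coalg.Hom.mk' (X := X) (Y := X.toBialg.toCoalg) (GrHom.id X.V)
    (fun r x => (map_id_apply X.V _).trans (X.toBialg_coop_m r x).symm)
    (fun a b x => (map_id_tensor_apply X.V _).trans (X.toBialg_coop_c a b x).symm)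
  hom_inv_id := Coalg.Hom.ext rfl
  inv_hom_id := Coalg.Hom.ext rfl

end Coalg

instance : (toCoalgFunctor.{u, v} k s).EssSurj where
  mem_essImage X := ⟨X.toBialg, ⟨X.isoToBialg⟩⟩

instance : (toCoalgFunctor.{u, v} k s).IsEquivalence where

end

end BInfty

theorem mainTheorem9 (k : Type u) [Field k] [CharZero k] (s : ℤ) :
    ∃ e : BInfty.Coalg.{u, v} k s ≌ BInfty.ProTensorBialg.{u, v} k s,
      Nonempty (e.functor ⋙ BInfty.ProTensorBialg.forget k s ≅ BInfty.Coalg.forget k s) :=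
  -- The functor from bialgebras keeps V on the nose, so its inverse followed by the forgetful
  -- functor of bialgebras is the round trip on coalgebras followed by theirs; the counit
  -- isomorphism finishes.
  let G := (BInfty.toCoalgFunctor.{u, v} k s).asEquivalence
  ⟨G.symm, ⟨Functor.isoWhiskerRight G.counitIso (BInfty.Coalg.forget k s) ≪≫
    Functor.leftUnitor _⟩⟩
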